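/- **Setting.** Let $N,n\ge 1$ be integers, let $D=\mathrm{diag}(d_1,\dots,d_N)$ and $\tilde D=\mathrm{diag}(\tilde d_1,\dots,\tilde d_n)$ have non-negative real diagonal entries, and let $A\in\mathbb C^{N\times n}$ be deterministic. Let $X=(X_{ij})$ be an $N\times n$ random matrix whose entries are i.i.d. complex random variables with $\mathbb E X_{ij}=0$ and $\mathbb E|X_{ij}|^2=1$. Put $\mathbb R^+=[0,\infty)$, $\boldsymbol\delta_z=\mathrm{dist}(z,\mathbb R^+)$, and $$\Sigma=\tfrac1{\sqrt n}D^{1/2}X\tilde D^{1/2}+A,\qquad Q(z)=(\Sigma\Sigma^*-zI_N)^{-1},\qquad \tilde Q(z)=(\Sigma^*\Sigma-zI_n)^{-1}.$$ For $z\in\mathbb C\setminus\mathbb R^+$ set $\alpha(z)=\frac1n\mathrm{Tr}\,D\,\mathbb E Q(z)$, $\tilde\alpha(z)=\frac1n\mathrm{Tr}\,\tilde D\,\mathbb E\tilde Q(z)$ and $$R(z)=\Big(-z(I_N+\tilde\alpha(z)D)+A(I_n+\alpha(z)\tilde D)^{-1}A^*\Big)^{-1}.$$ Let $(\delta,\tilde\delta)$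 be the solution, among pairs of Stieltjes transforms $z\mapsto\int\frac{\mu(dt)}{t-z}$ of finite non-negative measures carried by $\mathbb R^+$, of the system, for all $z\in\mathbb C\setminus\mathbb R^+$, $$\delta(z)=\tfrac1n\mathrm{Tr}\,D\,T(z),\qquad \tilde\delta(z)=\tfrac1n\mathrm{Tr}\,\tilde D\,\tilde T(z),$$ $$T(z)=\Big(-z(I_N+\tilde\delta(z)D)+A(I_n+\delta(z)\tilde D)^{-1}A^*\Big)^{-1},\qquad \tilde T(z)=\Big(-z(I_n+\delta(z)\tilde D)+A^*(I_N+\tilde\delta(z)D)^{-1}A\Big)^{-1}.$$ Below, $\|\cdot\|$ is the Euclidean norm of a vector and the spectral norm of a matrix. **Proposition.** Let $\boldsymbol{\ell^-},\boldsymbol{d_{\min}},\boldsymbol{\tilde d_{\min}}>0$ and let $\boldsymbol{\ell^+},\boldsymbol{d_{\max}},\boldsymbol{\tilde d_{\max}},\boldsymbol{a_{\max}},M$ be real numbers. There exist real polynomials $\Phi,\Psi$ with non-negative coefficients, depending only on these eight numbers, such that the following holds. For all $N,n,D,\tilde D,A,X$ as above satisfying $$\boldsymbol{\ell^-}\le\tfrac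 Nn\le\boldsymbol{\ell^+},\quad \|D\|\le\boldsymbol{d_{\max}},\quad \|\tilde D\|\le\boldsymbol{\tilde d_{\max}},\quad \|A\|\le\boldsymbol{a_{\max}},\quad \tfrac1N\mathrm{Tr}\,D\ge\boldsymbol{d_{\min}},\quad \tfrac1n\mathrm{Tr}\,\tilde D\ge\boldsymbol{\tilde d_{\min}},$$ and $\mathbb E|X_{ij}|^{8p}\le M$ for some integer $p\ge1$, for all $u,v\in\mathbb C^N$ and all $z\in\mathbb C\setminus\mathbb R^+$, $$\left|u^*\big(R(z)-T(z)\big)v\right|\le\frac1n\,\Phi(|z|)\,\Psi\!\left(\frac1{\boldsymbol\delta_z}\right)\|u\|\,\|v\|.$$ -/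

import Mathlib

open MeasureTheory ProbabilityTheory Matrix
open scoped Matrix.Norms.L2Operator

noncomputable section

namespace InfoPlusNoise

/-- The closed half-line `ℝ⁺ = [0, ∞)`, as a subset of `ℂ`. -/
def nonnegAxis : Set ℂ := (fun x : ℝ => (x : ℂ)) '' Set.Ici 0

/-- `δ_z = dist(z, ℝ⁺)`. -/
def distAxis (z : ℂ) : ℝ := Metric.infDist z nonnegAxis

/-- The complex diagonal matrix with given real diagonal entries. -/
def diagC {k : ℕ} (d : Fin k → ℝ) : Matrix (Fin k) (Fin k) ℂ :=
  Matrix.diagonal fun i => (d i : ℂ)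

/-- On `ℂ ∖ ℝ⁺`, `f` is the Stieltjes transform of a finite nonnegative measure carried by `ℝ⁺`. -/
def IsStieltjes (f : ℂ → ℂ) : Prop :=
  ∃ μ : Measure ℝ, IsFiniteMeasure μ ∧ μ (Set.Iio 0) = 0 ∧
    ∀ z : ℂ, z ∉ nonnegAxis → f z = ∫ t : ℝ, ((t : ℂ) - z)⁻¹ ∂μ

variable {N n : ℕ}

/-- `(-z (I + b D) + A (I + a D̃)⁻¹ A*)⁻¹`: this is `T(z)` for `(a, b) = (δ(z), δ̃(z))` and
`R(z)` for `(a, b) = (α(z), α̃(z))`. -/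
def equivMatrix (D : Matrix (Fin N) (Fin N) ℂ) (Dt : Matrix (Fin n) (Fin n) ℂ)
    (A : Matrix (Fin N) (Fin n) ℂ) (z a b : ℂ) : Matrix (Fin N) (Fin N) ℂ :=
  ((-z) • (1 + b • D) + A * (1 + a • Dt)⁻¹ * Aᴴ)⁻¹

/-- `(-z (I + a D̃) + A* (I + b D)⁻¹ A)⁻¹`, the companion `n × n` matrix. -/
def coEquivMatrix (D : Matrix (Fin N) (Fin N) ℂ) (Dt : Matrix (Fin n) (Fin n) ℂ)
    (A : Matrix (Fin N) (Fin n) ℂ) (z a b : ℂ) : Matrix (Fin n) (Fin n) ℂ :=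
  ((-z) • (1 + a • Dt) + Aᴴ * (1 + b • D)⁻¹ * A)⁻¹

/-- `(δ, δ̃)` is the solution, in the class of Stieltjes transforms of finite nonnegative measures
carried by `ℝ⁺`, of the system `δ = n⁻¹ Tr D T`, `δ̃ = n⁻¹ Tr D̃ T̃` on `ℂ ∖ ℝ⁺`. -/
structure IsFundamentalSolution (D : Matrix (Fin N) (Fin N) ℂ) (Dt : Matrix (Fin n) (Fin n) ℂ)
    (A : Matrix (Fin N) (Fin n) ℂ) (δ δt : ℂ → ℂ) : Prop where
  stieltjes : IsStieltjes δ
  stieltjes_co : IsStieltjes δt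
  eq : ∀ z : ℂ, z ∉ nonnegAxis →
    δ z = (1 / (n : ℂ)) * (D * equivMatrix D Dt A z (δ z) (δt z)).trace
  eq_co : ∀ z : ℂ, z ∉ nonnegAxis →
    δt z = (1 / (n : ℂ)) * (Dt * coEquivMatrix D Dt A z (δ z) (δt z)).trace

variable {Ω : Type*} [MeasurableSpace Ω]

/-- The entries `X i j` are independent, identically distributed complex random variables with
mean `0`, variance `1`, and `E |X i j| ^ m ≤ M`. -/
structure IsIIDEntries (P : Measure Ω) (X : Fin N → Fin n → Ω → ℂ) (m : ℕ) (M : ℝ) : Prop where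
  indep : iIndepFun (fun q : Fin N × Fin n => X q.1 q.2) P
  ident : ∀ i j i' j', IdentDistrib (X i j) (X i' j') P P
  mean_zero : ∀ i j, ∫ ω, X i j ω ∂P = 0
  variance_one : ∀ i j, ∫ ω, ‖X i j ω‖ ^ 2 ∂P = 1
  memLp : ∀ i j, MemLp (X i j) (m : ENNReal) P
  moment_le : ∀ i j, ∫ ω, ‖X i j ω‖ ^ m ∂P ≤ M

/-- `Σ = n^{-1/2} D^{1/2} X D̃^{1/2} + A`, with `D = diag(d)` and `D̃ = diag(dt)`. -/
def sigma (d : Fin N → ℝ) (dt : Fin n → ℝ) (A : Matrix (Fin N) (Fin n) ℂ)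
    (X : Fin N → Fin n → Ω → ℂ) (ω : Ω) : Matrix (Fin N) (Fin n) ℂ :=
  (1 / (Real.sqrt n : ℂ)) •
    (diagC (fun i => Real.sqrt (d i)) * Matrix.of (fun i j => X i j ω) *
      diagC (fun j => Real.sqrt (dt j))) + A

/-- The resolvent `Q(z) = (Σ Σ* - z I)⁻¹`. -/
def resolvent (S : Matrix (Fin N) (Fin n) ℂ) (z : ℂ) : Matrix (Fin N) (Fin N) ℂ :=
  (S * Sᴴ - z • 1)⁻¹

/-- The co-resolvent `Q̃(z) = (Σ* Σ - z I)⁻¹`. -/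
def coResolvent (S : Matrix (Fin N) (Fin n) ℂ) (z : ℂ) : Matrix (Fin n) (Fin n) ℂ :=
  (Sᴴ * S - z • 1)⁻¹

/-- Entrywise expectation of a random matrix. -/
def expect {k : ℕ} (P : Measure Ω) (B : Ω → Matrix (Fin k) (Fin k) ℂ) :
    Matrix (Fin k) (Fin k) ℂ :=
  Matrix.of fun i j => ∫ ω, B ω i j ∂P

/-- `α(z) = n⁻¹ Tr D E Q(z)`. -/
def alpha (P : Measure Ω) (d : Fin N → ℝ) (dt : Fin n → ℝ) (A : Matrix (Fin N) (Fin n) ℂ)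
    (X : Fin N → Fin n → Ω → ℂ) (z : ℂ) : ℂ :=
  (1 / (n : ℂ)) * (diagC d * expect P (fun ω => resolvent (sigma d dt A X ω) z)).trace

/-- `α̃(z) = n⁻¹ Tr D̃ E Q̃(z)`. -/
def coAlpha (P : Measure Ω) (d : Fin N → ℝ) (dt : Fin n → ℝ) (A : Matrix (Fin N) (Fin n) ℂ)
    (X : Fin N → Fin n → Ω → ℂ) (z : ℂ) : ℂ :=
  (1 / (n : ℂ)) * (diagC dt * expect P (fun ω => coResolvent (sigma d dt A X ω) z)).trace

/-- The deterministic matrix `R(z)`. -/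
def matR (P : Measure Ω) (d : Fin N → ℝ) (dt : Fin n → ℝ) (A : Matrix (Fin N) (Fin n) ℂ)
    (X : Fin N → Fin n → Ω → ℂ) (z : ℂ) : Matrix (Fin N) (Fin N) ℂ :=
  equivMatrix (diagC d) (diagC dt) A z (alpha P d dt A X z) (coAlpha P d dt A X z)

/-- The deterministic matrix `T(z)` built from `(δ, δ̃)`. -/
def matT (d : Fin N → ℝ) (dt : Fin n → ℝ) (A : Matrix (Fin N) (Fin n) ℂ)
    (δ δt : ℂ → ℂ) (z : ℂ) : Matrix (Fin N) (Fin N) ℂ :=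
  equivMatrix (diagC d) (diagC dt) A z (δ z) (δt z)

end InfoPlusNoise

end

/-! Let s be the square root of -z with Re s > 0. Up to the factor 1/s, all matrices of the
statement are diagonal blocks of inverses (s + iH + diag w)⁻¹ of size N + n, with H Hermitian and Re
w ≥ 0. For Q and Q̃, H is the Hermitization of Σ and w = 0; for R and T, H is the Hermitization of A
and w = (q d, p d̃), with (p, q) = (sα, sα̃) or (sδ, sδ̃) (`resolvent_eq`, `coResolvent_eq`,
`equivMatrix_eq`). The Hermitian part of such a pencil is diagonal and at least Re s. Hence the
inverse G has norm at most 1 / Re s and satisfies the Ward identity Re G_kk = Σ_l |G_kl|² (Re s + Re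
w_l) (`re_green_diag_row`). The rest is a consistency estimate and a stability estimate.

Consistency (`norm_trace_error_le`): (sα, sα̃) solves the fixed-point system of (sδ, sδ̃) up to
O(1/n). The resolvent identity compares the random G with the deterministic inverse. Each entry of X
is removed exactly, and the result is expanded to second order: first-order terms average to zero,
and the |x|² terms involve diagonal entries of G. Since the variance d_i d̃_j / n is a product,
these sum to products of traces and cancel the contribution of diag w, up to covariances controlled
by the Efron-Stein inequality (`variance_trace_le`). What remains involves fourth moments and
squares of off-diagonal entries, and sums to O(1) over all entries of X (`norm_sum_remainder_le`).

Stability (`stability`): relative errors are measured as |pR - pT| / √(Re pR · Re pT), and likewise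
for q. Cauchy-Schwarz and the Ward identities make the system a strict contraction for the larger of
the two. The gap comes from the Re s part of the Ward identity, bounded below in `le_sum_weight_row`
and `le_sum_weight_col` through the lower bounds on Tr D and Tr D̃. When n is too small for the
consistency error to fit inside this gap, the trivial bound on ‖R - T‖ already has the required
size.

All constants are powers of one parameter L dominating the data, |s| and 1 / Re s, so that L is at
most a constant times (1 + |z|)(1 + 1/δ_z). -/

noncomputable section

namespace InfoPlusNoise


/-! ### Accretive pencils: inverse bounds and Ward identities -/

section Accretive

variable {ι κ : Type*} [Fintype ι] [Fintype κ] [DecidableEq κ]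

lemma sum_norm_sq_col_le (M : Matrix ι κ ℂ) (k : κ) : ∑ l, ‖M l k‖ ^ 2 ≤ ‖M‖ ^ 2 := by
  have h := l2_opNorm_mulVec M (EuclideanSpace.single k (1 : ℂ))
  have h1 : ‖EuclideanSpace.single k (1 : ℂ)‖ = 1 := by simp
  rw [h1, mul_one] at h
  have h2 := pow_le_pow_left₀ (norm_nonneg _) h 2
  rw [EuclideanSpace.norm_sq_eq] at h2
  simpa using h2

variable [DecidableEq ι]

lemma sum_norm_sq_row_le (M : Matrix ι κ ℂ) (k : ι) : ∑ l, ‖M k l‖ ^ 2 ≤ ‖M‖ ^ 2 := by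
  have h := sum_norm_sq_col_le Mᴴ k
  rw [l2_opNorm_conjTranspose] at h
  simpa [conjTranspose_apply] using h

lemma norm_entry_le (M : Matrix ι κ ℂ) (k : ι) (l : κ) : ‖M k l‖ ≤ ‖M‖ := by
  have h := sum_norm_sq_row_le M k
  have h2 : ‖M k l‖ ^ 2 ≤ ∑ l, ‖M k l‖ ^ 2 :=
    Finset.single_le_sum (f := fun l => ‖M k l‖ ^ 2) (fun _ _ => by positivity) (Finset.mem_univ l)
  exact le_of_sq_le_sq (h2.trans h) (norm_nonneg _)

lemma norm_dotProduct_mulVec_le (M : Matrix ι ι ℂ) (u v : EuclideanSpace ℂ ι) :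
    ‖star u.ofLp ⬝ᵥ (M *ᵥ v.ofLp)‖ ≤ ‖M‖ * ‖u‖ * ‖v‖ := by
  have h := l2_opNorm_mulVec M v
  have h2 := norm_inner_le_norm (𝕜 := ℂ) u (WithLp.toLp 2 (M *ᵥ v.ofLp))
  have h3 : inner ℂ u (WithLp.toLp 2 (M *ᵥ v.ofLp)) = star u.ofLp ⬝ᵥ (M *ᵥ v.ofLp) := by
    rw [EuclideanSpace.inner_eq_star_dotProduct, dotProduct_comm]
  rw [h3] at h2
  calc _ ≤ _ := h2
    _ ≤ ‖u‖ * (‖M‖ * ‖v‖) := by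
      gcongr
      exact h
    _ = _ := by ring

/-- The matrix `s + i H + diag(w)`. -/
def pencil (H : Matrix ι ι ℂ) (s : ℂ) (w : ι → ℂ) : Matrix ι ι ℂ :=
  s • 1 + Complex.I • H + diagonal w

/-- The inverse of `s + i H + diag(w)`. -/
def green (H : Matrix ι ι ℂ) (s : ℂ) (w : ι → ℂ) : Matrix ι ι ℂ := (pencil H s w)⁻¹

/-- The term iH is skew-Hermitian and cancels. This diagonal Hermitian part is the source of both
the norm bound and the Ward identities. -/
lemma pencil_add_conjTranspose {H : Matrix ι ι ℂ} (hH : H.IsHermitian) (s : ℂ) (w : ι → ℂ) :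
    pencil H s w + (pencil H s w)ᴴ =
      diagonal (fun k => ((2 * (s.re + (w k).re) : ℝ) : ℂ)) := by
  have e : (pencil H s w)ᴴ = (star s) • 1 - Complex.I • H + diagonal (star w) := by
    unfold pencil
    rw [conjTranspose_add, conjTranspose_add, conjTranspose_smul, conjTranspose_smul,
      diagonal_conjTranspose, hH.eq]
    simp [sub_eq_add_neg]
  rw [e]
  ext k l
  by_cases hkl : k = l
  · subst hkl
    simp only [pencil, Matrix.add_apply, Matrix.sub_apply, Matrix.smul_apply, diagonal_apply_eq, one_apply_eq,
      smul_eq_mul, mul_one, Pi.star_apply]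
    have h1 := Complex.add_conj s
    have h2 := Complex.add_conj (w k)
    simp only [Complex.star_def]
    push_cast at h1 h2 ⊢
    linear_combination h1 + h2
  · simp [pencil, hkl]

lemma re_dotProduct_pencil {H : Matrix ι ι ℂ} (hH : H.IsHermitian) (s : ℂ) (w : ι → ℂ)
    (x : ι → ℂ) :
    (star x ⬝ᵥ (pencil H s w *ᵥ x)).re = ∑ k, (s.re + (w k).re) * ‖x k‖ ^ 2 := by
  have h1 : star (star x ⬝ᵥ (pencil H s w *ᵥ x)) = star x ⬝ᵥ ((pencil H s w)ᴴ *ᵥ x) := by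
    rw [star_dotProduct, star_star, star_mulVec, ← dotProduct_mulVec]
  have h2 : star x ⬝ᵥ (pencil H s w *ᵥ x) + star (star x ⬝ᵥ (pencil H s w *ᵥ x)) =
      ∑ k, ((2 * (s.re + (w k).re) * ‖x k‖ ^ 2 : ℝ) : ℂ) := by
    rw [h1, ← dotProduct_add, ← add_mulVec, pencil_add_conjTranspose hH, dotProduct]
    refine Finset.sum_congr rfl fun k _ => ?_
    rw [mulVec_diagonal]
    have := Complex.conj_mul' (x k)
    simp only [Pi.star_apply, Complex.star_def]
    push_cast at this ⊢
    linear_combination (2 * (s.re + (w k).re) : ℂ) * this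
  rw [Complex.star_def, Complex.add_conj, ← Complex.ofReal_sum] at h2
  have h3 := Complex.ofReal_injective h2
  have h4 : ∑ k, 2 * (s.re + (w k).re) * ‖x k‖ ^ 2 =
      2 * ∑ k, (s.re + (w k).re) * ‖x k‖ ^ 2 := by
    rw [Finset.mul_sum]; exact Finset.sum_congr rfl fun k _ => by ring
  linarith

variable {H : Matrix ι ι ℂ} {s : ℂ} {w : ι → ℂ}

/-- Accretivity: Re ⟨x, Mx⟩ ≥ Re s ‖x‖², compared with ‖x‖ ‖Mx‖ by Cauchy-Schwarz. -/
lemma mul_norm_le_norm_pencil (hH : H.IsHermitian) (hw : ∀ k, 0 ≤ (w k).re)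
    (x : EuclideanSpace ℂ ι) :
    s.re * ‖x‖ ≤ ‖WithLp.toLp 2 (pencil H s w *ᵥ x.ofLp)‖ := by
  have h1 := re_dotProduct_pencil hH s w x.ofLp
  have h2 : s.re * ‖x‖ ^ 2 ≤ (star x.ofLp ⬝ᵥ (pencil H s w *ᵥ x.ofLp)).re := by
    rw [h1, EuclideanSpace.norm_sq_eq, Finset.mul_sum]
    refine Finset.sum_le_sum fun k _ => ?_
    have := hw k
    gcongr
    linarith
  have h3 : ‖star x.ofLp ⬝ᵥ (pencil H s w *ᵥ x.ofLp)‖ ≤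
      ‖x‖ * ‖WithLp.toLp 2 (pencil H s w *ᵥ x.ofLp)‖ := by
    have := norm_inner_le_norm (𝕜 := ℂ) x (WithLp.toLp 2 (pencil H s w *ᵥ x.ofLp))
    rwa [EuclideanSpace.inner_eq_star_dotProduct, dotProduct_comm] at this
  have h4 := h2.trans ((Complex.re_le_norm _).trans h3)
  rcases (norm_nonneg x).eq_or_lt with h0 | h0
  · rw [← h0, mul_zero]; positivity
  · refine le_of_mul_le_mul_left ?_ h0
    linarith

lemma isUnit_pencil (hH : H.IsHermitian) (hs : 0 < s.re) (hw : ∀ k, 0 ≤ (w k).re) :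
    IsUnit (pencil H s w) := by
  rw [← mulVec_injective_iff_isUnit]
  intro x y hxy
  have h : pencil H s w *ᵥ (x - y) = 0 := by
    rw [mulVec_sub]; exact sub_eq_zero.2 hxy
  have h2 := mul_norm_le_norm_pencil (s := s) hH hw (WithLp.toLp 2 (x - y))
  simp only [h, WithLp.toLp_zero, norm_zero] at h2
  have h3 : ‖WithLp.toLp 2 (x - y)‖ = 0 :=
    le_antisymm (by nlinarith [norm_nonneg (WithLp.toLp 2 (x - y))]) (norm_nonneg _)
  rw [norm_eq_zero] at h3
  have h4 : x - y = 0 := congrArg WithLp.ofLp h3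
  exact sub_eq_zero.1 h4

lemma pencil_mul_green (hH : H.IsHermitian) (hs : 0 < s.re) (hw : ∀ k, 0 ≤ (w k).re) :
    pencil H s w * green H s w = 1 :=
  mul_nonsing_inv _ ((isUnit_iff_isUnit_det _).1 (isUnit_pencil hH hs hw))

lemma green_mul_pencil (hH : H.IsHermitian) (hs : 0 < s.re) (hw : ∀ k, 0 ≤ (w k).re) :
    green H s w * pencil H s w = 1 :=
  nonsing_inv_mul _ ((isUnit_iff_isUnit_det _).1 (isUnit_pencil hH hs hw))

lemma norm_green_le (hH : H.IsHermitian) (hs : 0 < s.re) (hw : ∀ k, 0 ≤ (w k).re) :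
    ‖green H s w‖ ≤ 1 / s.re := by
  rw [l2_opNorm_def]
  refine ContinuousLinearMap.opNorm_le_bound _ (by positivity) fun x => ?_
  have h := mul_norm_le_norm_pencil (s := s) hH hw (WithLp.toLp 2 (green H s w *ᵥ x.ofLp))
  rw [mulVec_mulVec, pencil_mul_green hH hs hw, one_mulVec] at h
  rw [one_div, inv_mul_eq_div, le_div_iff₀ hs, mul_comm]
  exact h

/-- The resolvent identity. -/
lemma green_sub_green {H' : Matrix ι ι ℂ} {w' : ι → ℂ} (hH : H.IsHermitian)
    (hH' : H'.IsHermitian) (hs : 0 < s.re) (hw : ∀ k, 0 ≤ (w k).re) (hw' : ∀ k, 0 ≤ (w' k).re) :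
    green H s w - green H' s w' =
      green H s w * (Complex.I • (H' - H) + diagonal (w' - w)) * green H' s w' := by
  have e : Complex.I • (H' - H) + diagonal (w' - w) = pencil H' s w' - pencil H s w := by
    unfold pencil
    rw [smul_sub, show diagonal (w' - w) = diagonal w' - diagonal w from (diagonal_sub _ _).symm]
    abel
  rw [e, mul_sub, sub_mul, green_mul_pencil hH hs hw, mul_assoc, pencil_mul_green hH' hs hw']
  simp

/-- Ward identity: the diagonal of G + G* = G (M + M*) G*, where M is the pencil and G its inverse.
-/
lemma re_green_diag_row (hH : H.IsHermitian) (hs : 0 < s.re) (hw : ∀ k, 0 ≤ (w k).re) (k : ι) :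
    (green H s w k k).re = ∑ l, ‖green H s w k l‖ ^ 2 * (s.re + (w l).re) := by
  have e : green H s w + (green H s w)ᴴ =
      green H s w * diagonal (fun k => ((2 * (s.re + (w k).re) : ℝ) : ℂ)) * (green H s w)ᴴ := by
    have h := congrArg conjTranspose (green_mul_pencil hH hs hw)
    rw [conjTranspose_mul, conjTranspose_one] at h
    rw [← pencil_add_conjTranspose hH, mul_add, add_mul, green_mul_pencil hH hs hw,
      mul_assoc _ _ (green H s w)ᴴ, h]
    rw [one_mul, mul_one, add_comm]
  have h1 := congrFun (congrFun e k) k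
  rw [Matrix.add_apply, conjTranspose_apply, mul_apply, Complex.star_def, Complex.add_conj] at h1
  have h2 : ∀ l, (green H s w * diagonal (fun k => ((2 * (s.re + (w k).re) : ℝ) : ℂ))) k l *
      (green H s w)ᴴ l k = ((2 * (‖green H s w k l‖ ^ 2 * (s.re + (w l).re)) : ℝ) : ℂ) := by
    intro l
    rw [mul_diagonal, conjTranspose_apply]
    have := Complex.mul_conj' (green H s w k l)
    simp only [Complex.star_def]
    push_cast at this ⊢
    linear_combination (2 * (s.re + (w l).re) : ℂ) * this
  rw [Finset.sum_congr rfl fun l _ => h2 l, ← Complex.ofReal_sum] at h1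
  have h3 := Complex.ofReal_injective h1
  rw [← Finset.mul_sum] at h3
  linarith

/-- The same identity read as G + G* = G* (M + M*) G. Both forms are needed, because the resolvent
identity pairs rows of one inverse with columns of the other. -/
lemma re_green_diag_col (hH : H.IsHermitian) (hs : 0 < s.re) (hw : ∀ k, 0 ≤ (w k).re) (k : ι) :
    (green H s w k k).re = ∑ l, ‖green H s w l k‖ ^ 2 * (s.re + (w l).re) := by
  have e : green H s w + (green H s w)ᴴ =
      (green H s w)ᴴ * diagonal (fun k => ((2 * (s.re + (w k).re) : ℝ) : ℂ)) * green H s w := by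
    have h := congrArg conjTranspose (pencil_mul_green hH hs hw)
    rw [conjTranspose_mul, conjTranspose_one] at h
    rw [← pencil_add_conjTranspose hH, mul_add, add_mul, h,
      mul_assoc _ _ (green H s w), pencil_mul_green hH hs hw]
    rw [one_mul, mul_one, add_comm]
  have h1 := congrFun (congrFun e k) k
  rw [Matrix.add_apply, conjTranspose_apply, mul_apply, Complex.star_def, Complex.add_conj] at h1
  have h2 : ∀ l, ((green H s w)ᴴ * diagonal (fun k => ((2 * (s.re + (w k).re) : ℝ) : ℂ))) k l *
      (green H s w) l k = ((2 * (‖green H s w l k‖ ^ 2 * (s.re + (w l).re)) : ℝ) : ℂ) := by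
    intro l
    rw [mul_diagonal, conjTranspose_apply]
    have := Complex.conj_mul' (green H s w l k)
    simp only [Complex.star_def]
    push_cast at this ⊢
    linear_combination (2 * (s.re + (w l).re) : ℂ) * this
  rw [Finset.sum_congr rfl fun l _ => h2 l, ← Complex.ofReal_sum] at h1
  have h3 := Complex.ofReal_injective h1
  rw [← Finset.mul_sum] at h3
  linarith

lemma re_green_diag_nonneg (hH : H.IsHermitian) (hs : 0 < s.re) (hw : ∀ k, 0 ≤ (w k).re)
    (k : ι) : 0 ≤ (green H s w k k).re := by
  rw [re_green_diag_row hH hs hw]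
  refine Finset.sum_nonneg fun l _ => ?_
  have := hw l
  positivity

/-- Cauchy-Schwarz applied to (G M)_kk = 1. A bound on a column of the pencil thus keeps the
corresponding row of the inverse away from zero. -/
lemma one_le_row_mul_col (hH : H.IsHermitian) (hs : 0 < s.re) (hw : ∀ k, 0 ≤ (w k).re) (k : ι) :
    1 ≤ (∑ l, ‖green H s w k l‖ ^ 2) * ∑ l, ‖pencil H s w l k‖ ^ 2 := by
  have h := congrFun (congrFun (green_mul_pencil hH hs hw) k) k
  rw [mul_apply, one_apply_eq] at h
  have h1 : (1 : ℝ) ≤ ∑ l, ‖green H s w k l‖ * ‖pencil H s w l k‖ := by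
    calc (1 : ℝ) = ‖∑ l, green H s w k l * pencil H s w l k‖ := by rw [h, norm_one]
      _ ≤ ∑ l, ‖green H s w k l * pencil H s w l k‖ := norm_sum_le _ _
      _ = _ := by simp
  calc (1 : ℝ) ≤ (∑ l, ‖green H s w k l‖ * ‖pencil H s w l k‖) ^ 2 := one_le_pow₀ h1
    _ ≤ _ := Finset.sum_mul_sq_le_sq_mul_sq _ _ _

lemma one_le_col_mul_row (hH : H.IsHermitian) (hs : 0 < s.re) (hw : ∀ k, 0 ≤ (w k).re) (k : ι) :
    1 ≤ (∑ l, ‖green H s w l k‖ ^ 2) * ∑ l, ‖pencil H s w k l‖ ^ 2 := by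
  have h := congrFun (congrFun (pencil_mul_green hH hs hw) k) k
  rw [mul_apply, one_apply_eq] at h
  have h1 : (1 : ℝ) ≤ ∑ l, ‖green H s w l k‖ * ‖pencil H s w k l‖ := by
    calc (1 : ℝ) = ‖∑ l, pencil H s w k l * green H s w l k‖ := by rw [h, norm_one]
      _ ≤ ∑ l, ‖pencil H s w k l * green H s w l k‖ := norm_sum_le _ _
      _ = _ := by simp [mul_comm]
  calc (1 : ℝ) ≤ (∑ l, ‖green H s w l k‖ * ‖pencil H s w k l‖) ^ 2 := one_le_pow₀ h1
    _ ≤ _ := Finset.sum_mul_sq_le_sq_mul_sq _ _ _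

end Accretive


/-! ### Hermitization, Schur complements and the square root of -z -/

section Blocks

variable {N n : ℕ}

/-- The Hermitian matrix with off-diagonal blocks `S` and `Sᴴ`. -/
def hermitize (S : Matrix (Fin N) (Fin n) ℂ) : Matrix (Fin N ⊕ Fin n) (Fin N ⊕ Fin n) ℂ :=
  fromBlocks 0 S Sᴴ 0

lemma isHermitian_hermitize (S : Matrix (Fin N) (Fin n) ℂ) : (hermitize S).IsHermitian := by
  simp [hermitize, IsHermitian, fromBlocks_conjTranspose]

/-- The vector `(q d, p dt)`. -/
def profile (d : Fin N → ℝ) (dt : Fin n → ℝ) (p q : ℂ) : Fin N ⊕ Fin n → ℂ :=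
  Sum.elim (fun i => q * d i) (fun j => p * dt j)

lemma re_profile_nonneg {d : Fin N → ℝ} {dt : Fin n → ℝ} (hd : ∀ i, 0 ≤ d i)
    (hdt : ∀ j, 0 ≤ dt j) {p q : ℂ} (hp : 0 ≤ p.re) (hq : 0 ≤ q.re) (k : Fin N ⊕ Fin n) :
    0 ≤ (profile d dt p q k).re := by
  rcases k with i | j
  · simpa [profile] using mul_nonneg hq (hd i)
  · simpa [profile] using mul_nonneg hp (hdt j)

/-- After multiplication by s this is a pencil with H = 0, whose diagonal weights s a d_i have
non-negative real part. -/
lemma isUnit_one_add_smul_diagC {k : ℕ} {d : Fin k → ℝ} (hd : ∀ i, 0 ≤ d i) {s a : ℂ}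
    (hs : 0 < s.re) (ha : 0 ≤ (s * a).re) : IsUnit (1 + a • diagC d).det := by
  rw [← isUnit_iff_isUnit_det]
  have h := isUnit_pencil (H := (0 : Matrix (Fin k) (Fin k) ℂ)) (s := s)
    (w := fun i => s * a * d i) (by simp [IsHermitian]) hs
    (fun i => by rw [Complex.re_mul_ofReal]; exact mul_nonneg ha (hd i))
  have e : pencil (0 : Matrix (Fin k) (Fin k) ℂ) s (fun i => s * a * d i) =
      s • (1 + a • diagC d) := by
    unfold pencil diagC
    rw [smul_zero, add_zero, smul_add, smul_smul, ← diagonal_smul]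
    rfl
  have hs0 : s ≠ 0 := by rintro rfl; simp at hs
  rw [e] at h
  exact (isUnit_smul_iff (Units.mk0 s hs0) _).1 h

lemma pencil_hermitize (A : Matrix (Fin N) (Fin n) ℂ) (d : Fin N → ℝ) (dt : Fin n → ℝ)
    (s a b : ℂ) :
    pencil (hermitize A) s (profile d dt (s * a) (s * b)) =
      fromBlocks (s • (1 + b • diagC d)) (Complex.I • A) (Complex.I • Aᴴ)
        (s • (1 + a • diagC dt)) := by
  have e1 : diagonal (profile d dt (s * a) (s * b)) =
      fromBlocks (s • b • diagC d) 0 0 (s • a • diagC dt) := by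
    unfold profile diagC
    rw [← fromBlocks_diagonal]
    simp [← diagonal_smul, Pi.smul_def, mul_assoc]
  unfold pencil
  rw [e1, hermitize, ← fromBlocks_one, fromBlocks_smul, fromBlocks_smul, fromBlocks_add,
    fromBlocks_add]
  simp

variable {d : Fin N → ℝ} {dt : Fin n → ℝ} {s z a b : ℂ}

/-- Schur complement. Eliminating the second block from M G = 1 gives s(1 + bD) + s⁻¹ A (1 + aD̃)⁻¹
A* acting on the first block; the plus sign comes from i² = -1. Multiplication by s, with s² = -z,
yields the matrix inverted in `equivMatrix`. -/
lemma equivMatrix_eq (hd : ∀ i, 0 ≤ d i) (hdt : ∀ j, 0 ≤ dt j) (A : Matrix (Fin N) (Fin n) ℂ)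
    (hs : 0 < s.re) (hz : s ^ 2 = -z) (ha : 0 ≤ (s * a).re) (hb : 0 ≤ (s * b).re) :
    equivMatrix (diagC d) (diagC dt) A z a b =
      s⁻¹ • (green (hermitize A) s (profile d dt (s * a) (s * b))).toBlocks₁₁ := by
  have hs0 : s ≠ 0 := by rintro rfl; simp at hs
  have hM := pencil_mul_green (isHermitian_hermitize A) hs (re_profile_nonneg hd hdt ha hb)
  set G := green (hermitize A) s (profile d dt (s * a) (s * b))
  have hU := isUnit_one_add_smul_diagC hdt hs ha
  rw [pencil_hermitize, ← fromBlocks_toBlocks G, fromBlocks_multiply, ← fromBlocks_one,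
    fromBlocks_inj] at hM
  obtain ⟨h11, -, h21, -⟩ := hM
  set W := 1 + a • diagC dt
  have h21' : G.toBlocks₂₁ = -(s⁻¹ • Complex.I • (W⁻¹ * Aᴴ * G.toBlocks₁₁)) := by
    have h := congrArg (fun M => s⁻¹ • (W⁻¹ * M)) h21
    simp only [Matrix.mul_add, Matrix.smul_mul, Matrix.mul_smul, Matrix.mul_zero, smul_zero,
      ← Matrix.mul_assoc, smul_add, smul_smul, nonsing_inv_mul W hU, Matrix.one_mul,
      inv_mul_cancel₀ hs0, one_smul] at h
    rw [smul_smul]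
    exact eq_neg_of_add_eq_zero_right h
  unfold equivMatrix
  refine inv_eq_right_inv ?_
  rw [h21'] at h11
  refine Eq.trans ?_ h11
  rw [← hz]
  simp only [Matrix.add_mul, Matrix.smul_mul, Matrix.mul_smul, Matrix.mul_neg, smul_smul,
    ← Matrix.mul_assoc]
  rw [smul_add, smul_smul, ← neg_smul]
  congr 2
  · rw [pow_two, ← mul_assoc, inv_mul_cancel₀ hs0, one_mul]
  · linear_combination s⁻¹ * Complex.I_mul_I

lemma coEquivMatrix_eq (hd : ∀ i, 0 ≤ d i) (hdt : ∀ j, 0 ≤ dt j) (A : Matrix (Fin N) (Fin n) ℂ)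
    (hs : 0 < s.re) (hz : s ^ 2 = -z) (ha : 0 ≤ (s * a).re) (hb : 0 ≤ (s * b).re) :
    coEquivMatrix (diagC d) (diagC dt) A z a b =
      s⁻¹ • (green (hermitize A) s (profile d dt (s * a) (s * b))).toBlocks₂₂ := by
  have hs0 : s ≠ 0 := by rintro rfl; simp at hs
  have hM := pencil_mul_green (isHermitian_hermitize A) hs (re_profile_nonneg hd hdt ha hb)
  set G := green (hermitize A) s (profile d dt (s * a) (s * b))
  have hU := isUnit_one_add_smul_diagC hd hs hb
  rw [pencil_hermitize, ← fromBlocks_toBlocks G, fromBlocks_multiply, ← fromBlocks_one,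
    fromBlocks_inj] at hM
  obtain ⟨-, h12, -, h22⟩ := hM
  set W := 1 + b • diagC d
  have h12' : G.toBlocks₁₂ = -(s⁻¹ • Complex.I • (W⁻¹ * A * G.toBlocks₂₂)) := by
    have h := congrArg (fun M => s⁻¹ • (W⁻¹ * M)) h12
    simp only [Matrix.mul_add, Matrix.smul_mul, Matrix.mul_smul, Matrix.mul_zero, smul_zero,
      ← Matrix.mul_assoc, smul_add, smul_smul, nonsing_inv_mul W hU, Matrix.one_mul,
      inv_mul_cancel₀ hs0, one_smul] at h
    rw [smul_smul]
    exact eq_neg_of_add_eq_zero_left h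
  unfold coEquivMatrix
  refine inv_eq_right_inv ?_
  rw [h12', add_comm] at h22
  refine Eq.trans ?_ h22
  rw [← hz]
  simp only [Matrix.add_mul, Matrix.smul_mul, Matrix.mul_smul, Matrix.mul_neg, smul_smul,
    ← Matrix.mul_assoc]
  rw [smul_add, smul_smul, ← neg_smul]
  congr 2
  · rw [pow_two, ← mul_assoc, inv_mul_cancel₀ hs0, one_mul]
  · linear_combination s⁻¹ * Complex.I_mul_I

lemma profile_zero : profile d dt 0 0 = 0 := by
  ext k; rcases k with i | j <;> simp [profile]

lemma resolvent_eq (S : Matrix (Fin N) (Fin n) ℂ) (hs : 0 < s.re) (hz : s ^ 2 = -z) :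
    resolvent S z = s⁻¹ • (green (hermitize S) s 0).toBlocks₁₁ := by
  have h := equivMatrix_eq (d := fun _ : Fin N => 0) (dt := fun _ : Fin n => 0) (a := 0) (b := 0)
    (fun _ => le_rfl) (fun _ => le_rfl) S hs hz (by simp) (by simp)
  rw [mul_zero, profile_zero] at h
  rw [← h, resolvent, equivMatrix]
  congr 1
  simp [sub_eq_add_neg, add_comm]

lemma coResolvent_eq (S : Matrix (Fin N) (Fin n) ℂ) (hs : 0 < s.re) (hz : s ^ 2 = -z) :
    coResolvent S z = s⁻¹ • (green (hermitize S) s 0).toBlocks₂₂ := by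
  have h := coEquivMatrix_eq (d := fun _ : Fin N => 0) (dt := fun _ : Fin n => 0) (a := 0)
    (b := 0) (fun _ => le_rfl) (fun _ => le_rfl) S hs hz (by simp) (by simp)
  rw [mul_zero, profile_zero] at h
  rw [← h, coResolvent, coEquivMatrix]
  congr 1
  simp [sub_eq_add_neg, add_comm]

lemma trace_diagC_mul {k : ℕ} (e : Fin k → ℝ) (M : Matrix (Fin k) (Fin k) ℂ) :
    (diagC e * M).trace = ∑ i, (e i : ℂ) * M i i := by
  simp [trace, diagC, diagonal_mul]

/-- Off the half-line, `-z` has a square root in the open right half-plane, whose real part is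
bounded below through the distance to the half-line. -/
lemma exists_sqrt_neg {z : ℂ} (hz : z ∉ nonnegAxis) :
    ∃ s : ℂ, s ^ 2 = -z ∧ 0 < s.re ∧ distAxis z ≤ 2 * s.re * ‖s‖ := by
  obtain ⟨s₀, hs₀⟩ := IsAlgClosed.exists_pow_nat_eq (-z) (n := 2) (by norm_num)
  have hre : s₀.re ≠ 0 := by
    intro h0
    apply hz
    refine ⟨s₀.im ^ 2, sq_nonneg s₀.im, ?_⟩
    have h1 : s₀ = s₀.im * Complex.I := by
      apply Complex.ext <;> simp [h0]
    have h2 : z = -(s₀ ^ 2) := by rw [hs₀, neg_neg]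
    simp only [h2]
    rw [h1]
    push_cast
    simp [mul_pow]
  obtain ⟨s, hs, hpos⟩ : ∃ s : ℂ, s ^ 2 = -z ∧ 0 < s.re := by
    rcases hre.lt_or_gt with h | h
    · exact ⟨-s₀, by rw [neg_sq, hs₀], by simpa using h⟩
    · exact ⟨s₀, hs₀, h⟩
  refine ⟨s, hs, hpos, ?_⟩
  -- The point of the half-line used to bound the distance is (Im s)²: there z - (Im s)² = -Re s (Re
  -- s + 2i Im s), which carries a factor Re s.
  have hmem : ((s.im ^ 2 : ℝ) : ℂ) ∈ nonnegAxis := ⟨s.im ^ 2, sq_nonneg s.im, rfl⟩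
  refine (Metric.infDist_le_dist_of_mem hmem).trans ?_
  have e : z - ((s.im ^ 2 : ℝ) : ℂ) = -((s.re : ℂ) * ((s.re : ℂ) + 2 * s.im * Complex.I)) := by
    have h2 : z = -(s ^ 2) := by rw [hs, neg_neg]
    have h3 := Complex.re_add_im s
    rw [h2]
    push_cast
    linear_combination (s + s.re + s.im * Complex.I) * h3 - (s.im : ℂ) ^ 2 * Complex.I_sq
  rw [dist_eq_norm, e, norm_neg, norm_mul, Complex.norm_real, Real.norm_of_nonneg hpos.le]
  have h4 : ‖(s.re : ℂ) + 2 * s.im * Complex.I‖ ≤ 2 * ‖s‖ := by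
    refine le_of_sq_le_sq ?_ (by positivity)
    rw [mul_pow, Complex.sq_norm, Complex.sq_norm, Complex.normSq_apply, Complex.normSq_apply]
    simp
    nlinarith [sq_nonneg s.re]
  calc s.re * _ ≤ s.re * (2 * ‖s‖) := by gcongr
    _ = _ := by ring

/-- With -z = s², the integrand s / (t + s²) has real part Re s (t + |s|²) / |t + s²|², which is
non-negative for t ≥ 0. It makes the weights built from (sδ, sδ̃) admissible in the pencil. -/
lemma re_mul_stieltjes_nonneg {f : ℂ → ℂ} (hf : IsStieltjes f) {z s : ℂ} (hz : z ∉ nonnegAxis)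
    (hs : 0 < s.re) (hsz : s ^ 2 = -z) : 0 ≤ (s * f z).re := by
  obtain ⟨μ, hfin, hμ, hf⟩ := hf
  rw [hf z hz, ← integral_const_mul]
  by_cases hi : Integrable (fun t : ℝ => s * ((t : ℂ) - z)⁻¹) μ
  swap
  · rw [integral_undef hi]; simp
  have hre : (∫ t : ℝ, s * ((t : ℂ) - z)⁻¹ ∂μ).re = ∫ t : ℝ, (s * ((t : ℂ) - z)⁻¹).re ∂μ :=
    (integral_re hi).symm
  rw [hre]
  refine integral_nonneg_of_ae ?_
  have hae : ∀ᵐ t ∂μ, (0 : ℝ) ≤ t := by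
    rw [ae_iff]
    simpa [Set.Iio] using hμ
  filter_upwards [hae] with t ht
  have e : (t : ℂ) - z = t + s ^ 2 := by rw [hsz]; ring
  simp only [Pi.zero_apply]
  rw [e, Complex.inv_def, ← mul_assoc, Complex.re_mul_ofReal]
  refine mul_nonneg ?_ (inv_nonneg.2 (Complex.normSq_nonneg _))
  have h2 : (s * (starRingEnd ℂ) ((t : ℂ) + s ^ 2)).re = s.re * (t + (s.re ^ 2 + s.im ^ 2)) := by
    simp [pow_two]
    ring
  rw [h2]
  positivity

end Blocks


/-! ### Stability of the fixed-point system -/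

section Stability

variable {ι : Type*} [Fintype ι] [DecidableEq ι] {H : Matrix ι ι ℂ} {s : ℂ}

/-- Cauchy-Schwarz in the plane. It merges the relative errors on p and q into one relative error on
each weight w_l. -/
lemma sqrt_mul_add_sqrt_mul_le {a b c d : ℝ} (ha : 0 ≤ a) (hb : 0 ≤ b) (hc : 0 ≤ c)
    (hd : 0 ≤ d) : √a * √b + √c * √d ≤ √(a + c) * √(b + d) := by
  rw [← Real.sqrt_mul (by positivity : 0 ≤ a + c)]
  refine Real.le_sqrt_of_sq_le ?_
  have h1 := Real.sq_sqrt ha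
  have h2 := Real.sq_sqrt hb
  have h3 := Real.sq_sqrt hc
  have h4 := Real.sq_sqrt hd
  nlinarith [sq_nonneg (√a * √d - √c * √b)]

/-- Cauchy-Schwarz bound on the difference of two weighted traces. -/
lemma norm_sum_green_sub_le {wR wT : ι → ℂ} (hH : H.IsHermitian) (hs : 0 < s.re)
    (hwR : ∀ k, 0 ≤ (wR k).re) (hwT : ∀ k, 0 ≤ (wT k).re) {D : ι → ℝ} (hD : ∀ k, 0 ≤ D k)
    {P : ℝ} (hP : 0 ≤ P) (hdiff : ∀ l, ‖wT l - wR l‖ ≤ P * (√(wR l).re * √(wT l).re)) :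
    ‖∑ k, (D k : ℂ) * (green H s wR k k - green H s wT k k)‖ ≤
      P * (√(∑ k, D k * ((green H s wR k k).re - s.re * ∑ l, ‖green H s wR k l‖ ^ 2)) *
        √(∑ k, D k * ((green H s wT k k).re - s.re * ∑ l, ‖green H s wT l k‖ ^ 2))) := by
  have hR : ∑ k, D k * ((green H s wR k k).re - s.re * ∑ l, ‖green H s wR k l‖ ^ 2) =
      ∑ x : ι × ι, (√(D x.1) * ‖green H s wR x.1 x.2‖ * √(wR x.2).re) ^ 2 := by
    rw [Fintype.sum_prod_type]
    refine Finset.sum_congr rfl fun k _ => ?_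
    rw [re_green_diag_row hH hs hwR, Finset.mul_sum, ← Finset.sum_sub_distrib, Finset.mul_sum]
    refine Finset.sum_congr rfl fun l _ => ?_
    rw [mul_pow, mul_pow, Real.sq_sqrt (hD k), Real.sq_sqrt (hwR l)]
    ring
  have hT : ∑ k, D k * ((green H s wT k k).re - s.re * ∑ l, ‖green H s wT l k‖ ^ 2) =
      ∑ x : ι × ι, (√(D x.1) * ‖green H s wT x.2 x.1‖ * √(wT x.2).re) ^ 2 := by
    rw [Fintype.sum_prod_type]
    refine Finset.sum_congr rfl fun k _ => ?_
    rw [re_green_diag_col hH hs hwT, Finset.mul_sum, ← Finset.sum_sub_distrib, Finset.mul_sum]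
    refine Finset.sum_congr rfl fun l _ => ?_
    rw [mul_pow, mul_pow, Real.sq_sqrt (hD k), Real.sq_sqrt (hwT l)]
    ring
  have e : ∀ k, green H s wR k k - green H s wT k k =
      ∑ l, green H s wR k l * (wT l - wR l) * green H s wT l k := by
    intro k
    have h := congrFun (congrFun (green_sub_green hH hH hs hwR hwT) k) k
    rw [sub_self, smul_zero, zero_add, Matrix.sub_apply, mul_apply] at h
    rw [h]
    exact Finset.sum_congr rfl fun l _ => by rw [mul_diagonal]; rfl
  calc ‖∑ k, (D k : ℂ) * (green H s wR k k - green H s wT k k)‖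
      = ‖∑ x : ι × ι, (D x.1 : ℂ) *
          (green H s wR x.1 x.2 * (wT x.2 - wR x.2) * green H s wT x.2 x.1)‖ := by
        rw [Fintype.sum_prod_type]
        congr 1
        refine Finset.sum_congr rfl fun k _ => ?_
        rw [e, Finset.mul_sum]
    _ ≤ ∑ x : ι × ι, P * ((√(D x.1) * ‖green H s wR x.1 x.2‖ * √(wR x.2).re) *
          (√(D x.1) * ‖green H s wT x.2 x.1‖ * √(wT x.2).re)) := by
        refine (norm_sum_le _ _).trans (Finset.sum_le_sum fun x _ => ?_)
        rw [norm_mul, norm_mul, norm_mul, Complex.norm_real, Real.norm_of_nonneg (hD _)]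
        have h1 := Real.mul_self_sqrt (hD x.1)
        calc D x.1 * (‖green H s wR x.1 x.2‖ * ‖wT x.2 - wR x.2‖ * ‖green H s wT x.2 x.1‖)
            ≤ D x.1 * (‖green H s wR x.1 x.2‖ * (P * (√(wR x.2).re * √(wT x.2).re)) *
                ‖green H s wT x.2 x.1‖) := by
              have := hD x.1
              gcongr
              exact hdiff _
          _ = _ := by linear_combination (-(‖green H s wR x.1 x.2‖ * (P * (√(wR x.2).re *
              √(wT x.2).re)) * ‖green H s wT x.2 x.1‖)) * h1
    _ = P * ∑ x : ι × ι, ((√(D x.1) * ‖green H s wR x.1 x.2‖ * √(wR x.2).re) *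
          (√(D x.1) * ‖green H s wT x.2 x.1‖ * √(wT x.2).re)) := by rw [Finset.mul_sum]
    _ ≤ _ := by
        rw [hR, hT]
        gcongr
        exact Real.sum_mul_le_sqrt_mul_sqrt _ _ _

/-- The hypothesis reads P A (B - B') ≤ ε. Since only B² - B'² is bounded below, multiply by B + B'
≤ 2B. -/
lemma le_of_contraction {P A B B' ε c : ℝ} (hP : 0 ≤ P) (hA : 0 < A) (hB' : 0 ≤ B') (hc : 0 < c)
    (hBB : c ≤ B ^ 2 - B' ^ 2) (hB : 0 ≤ B) (h : P * (A * B) ≤ ε + P * (A * B')) :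
    P ≤ 2 * ε * B / (A * c) := by
  have hlt : B' ≤ B := by nlinarith
  rw [le_div_iff₀ (by positivity)]
  have hPA : 0 ≤ P * A := by positivity
  have h1 : P * A * (B - B') ≤ ε := by linarith
  have h0 : 0 ≤ P * A * (B - B') := mul_nonneg hPA (by linarith)
  calc P * (A * c) = P * A * c := by ring
    _ ≤ P * A * (B ^ 2 - B' ^ 2) := by gcongr
    _ = (P * A * (B - B')) * (B + B') := by ring
    _ ≤ ε * (B + B') := by gcongr
    _ ≤ ε * (2 * B) := by
      have : 0 ≤ ε := h0.trans h1
      gcongr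
      linarith
    _ = _ := by ring

lemma mul_le_of_le_sqrt_ratio {P ε c K x y : ℝ} (hc : 0 < c) (hε0 : 0 ≤ ε) (hx : 0 < x)
    (hy : c / 2 ≤ y) (hxK : x ≤ K) (hP : P ≤ 2 * ε * √x / (√y * c)) (hcK : c ≤ 2 * K) :
    P * K ≤ 4 * ε * K ^ 2 / c ^ 2 := by
  have hy0 : 0 < y := by linarith
  have hK0 : 0 < K := hx.trans_le hxK
  have hratio : √x / √y ≤ 2 * K / c := by
    rw [← Real.sqrt_div hx.le]
    have h6 : x / y ≤ 2 * K / c := by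
      rw [div_le_div_iff₀ hy0 hc]
      calc x * c ≤ K * c := by gcongr
        _ ≤ K * (2 * y) := by gcongr; linarith
        _ = _ := by ring
    have h7 : 1 ≤ 2 * K / c := by
      rw [le_div_iff₀ hc]; linarith
    rw [Real.sqrt_le_left (by positivity)]
    calc _ ≤ 2 * K / c := h6
      _ ≤ (2 * K / c) ^ 2 := le_self_pow₀ h7 (by norm_num)
  calc P * K ≤ 2 * ε * √x / (√y * c) * K := by gcongr
    _ = 2 * ε / c * (√x / √y) * K := by
      have : √y ≠ 0 := (Real.sqrt_pos.2 hy0).ne'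
      field_simp
    _ ≤ 2 * ε / c * (2 * K / c) * K := by gcongr
    _ = _ := by field_simp; ring

variable {D₁ D₂ : ι → ℝ} {m ε c K : ℝ} {pR qR pT qT : ℂ}

set_option maxHeartbeats 800000 in
-- The case where p has the larger relative error P. Then |wT - wR| ≤ P √(Re wR · Re wT) at every
-- index, and Cauchy-Schwarz with the two Ward identities gives P √(Re pR · Re pT) ≤ ε + P √(Re pR ·
-- (Re pT - c)). The gap c on the exact side bounds P.
lemma stability_of_ratio_le (hH : H.IsHermitian) (hs : 0 < s.re) (hD₁ : ∀ k, 0 ≤ D₁ k)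
    (hD₂ : ∀ k, 0 ≤ D₂ k) (hm : 0 < m) (hc : 0 < c) (hε : 2 * ε ≤ c)
    (hpR : 0 ≤ pR.re) (hqR : 0 ≤ qR.re) (hpT : 0 ≤ pT.re) (hqT : 0 ≤ qT.re)
    (hpR' : pR.re ≤ K) (hqR' : qR.re ≤ K) (hpT' : pT.re ≤ K) (hqT' : qT.re ≤ K)
    {wR wT : ι → ℂ} (hwR : ∀ k, wR k = qR * D₁ k + pR * D₂ k)
    (hwT : ∀ k, wT k = qT * D₁ k + pT * D₂ k)
    (heT : m * pT = ∑ k, (D₁ k : ℂ) * green H s wT k k)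
    (heR : ‖m * pR - ∑ k, (D₁ k : ℂ) * green H s wR k k‖ ≤ m * ε)
    (hlR : m * c ≤ s.re * ∑ k, D₁ k * ∑ l, ‖green H s wR k l‖ ^ 2)
    (hlT : m * c ≤ s.re * ∑ k, D₁ k * ∑ l, ‖green H s wT l k‖ ^ 2)
    (hqR0 : 0 < qR.re) (hqT0 : 0 < qT.re)
    (hratio : ‖qR - qT‖ * (√pR.re * √pT.re) ≤ ‖pR - pT‖ * (√qR.re * √qT.re)) :
    ‖pR - pT‖ ≤ 4 * ε * K ^ 2 / c ^ 2 ∧ ‖qR - qT‖ ≤ 4 * ε * K ^ 2 / c ^ 2 := by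
  have hε0 : 0 ≤ ε := by
    have := (norm_nonneg _).trans heR
    exact nonneg_of_mul_nonneg_right this hm
  have hwR0 : ∀ k, 0 ≤ (wR k).re := fun k => by
    rw [hwR, Complex.add_re, Complex.re_mul_ofReal, Complex.re_mul_ofReal]
    have := hD₁ k; have := hD₂ k; positivity
  have hwT0 : ∀ k, 0 ≤ (wT k).re := fun k => by
    rw [hwT, Complex.add_re, Complex.re_mul_ofReal, Complex.re_mul_ofReal]
    have := hD₁ k; have := hD₂ k; positivity
  -- the weighted traces controlled by the Ward identities
  set SR := ∑ k, D₁ k * ((green H s wR k k).re - s.re * ∑ l, ‖green H s wR k l‖ ^ 2) with hSR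
  set ST := ∑ k, D₁ k * ((green H s wT k k).re - s.re * ∑ l, ‖green H s wT l k‖ ^ 2) with hST
  have hSR0 : 0 ≤ SR := by
    refine Finset.sum_nonneg fun k _ => mul_nonneg (hD₁ k) ?_
    rw [re_green_diag_row hH hs hwR0, Finset.mul_sum, ← Finset.sum_sub_distrib]
    refine Finset.sum_nonneg fun l _ => ?_
    have := hwR0 l
    have : 0 ≤ ‖green H s wR k l‖ ^ 2 * (wR l).re := by positivity
    linarith
  have hST0 : 0 ≤ ST := by
    refine Finset.sum_nonneg fun k _ => mul_nonneg (hD₁ k) ?_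
    rw [re_green_diag_col hH hs hwT0, Finset.mul_sum, ← Finset.sum_sub_distrib]
    refine Finset.sum_nonneg fun l _ => ?_
    have := hwT0 l
    have : 0 ≤ ‖green H s wT l k‖ ^ 2 * (wT l).re := by positivity
    linarith
  have eSR : SR = (∑ k, (D₁ k : ℂ) * green H s wR k k).re -
      s.re * ∑ k, D₁ k * ∑ l, ‖green H s wR k l‖ ^ 2 := by
    rw [hSR, Complex.re_sum, Finset.mul_sum, ← Finset.sum_sub_distrib]
    exact Finset.sum_congr rfl fun k _ => by rw [Complex.re_ofReal_mul]; ring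
  have eST : ST = (∑ k, (D₁ k : ℂ) * green H s wT k k).re -
      s.re * ∑ k, D₁ k * ∑ l, ‖green H s wT l k‖ ^ 2 := by
    rw [hST, Complex.re_sum, Finset.mul_sum, ← Finset.sum_sub_distrib]
    exact Finset.sum_congr rfl fun k _ => by rw [Complex.re_ofReal_mul]; ring
  have hreR : |m * pR.re - (∑ k, (D₁ k : ℂ) * green H s wR k k).re| ≤ m * ε := by
    have h := (Complex.abs_re_le_norm _).trans heR
    rwa [Complex.sub_re, Complex.re_ofReal_mul] at h
  rw [abs_le] at hreR
  have hreT : m * pT.re = (∑ k, (D₁ k : ℂ) * green H s wT k k).re := by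
    rw [← heT, Complex.re_ofReal_mul]
  have hmcε : m * ε ≤ m * c / 2 := by nlinarith
  have hxR : c / 2 ≤ pR.re := by
    have : m * (c / 2) ≤ m * pR.re := by nlinarith
    exact le_of_mul_le_mul_left this hm
  have hxT : c ≤ pT.re := by
    have : m * c ≤ m * pT.re := by nlinarith
    exact le_of_mul_le_mul_left this hm
  have hpR0 : 0 < pR.re := by linarith
  have hpT0 : 0 < pT.re := by linarith
  -- On the approximate side the Ward gap mc absorbs the defect mε, because 2ε ≤ c; on the exact
  -- side the whole gap survives.
  have hSR1 : SR ≤ m * pR.re := by nlinarith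
  have hST1 : ST ≤ m * (pT.re - c) := by nlinarith
  have hK0 : 0 < K := hpR0.trans_le hpR'
  -- the common ratio
  set P := ‖pR - pT‖ / (√pR.re * √pT.re) with hPdef
  have hP0 : 0 ≤ P := by positivity
  have hP1 : ‖pR - pT‖ = P * (√pR.re * √pT.re) := by
    rw [hPdef, div_mul_cancel₀]; positivity
  have hP2 : ‖qR - qT‖ ≤ P * (√qR.re * √qT.re) := by
    rw [hPdef, div_mul_eq_mul_div, le_div_iff₀ (by positivity)]
    exact hratio
  have hdiff : ∀ l, ‖wT l - wR l‖ ≤ P * (√(wR l).re * √(wT l).re) := by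
    intro l
    have e1 : wT l - wR l = -((qR - qT) * D₁ l + (pR - pT) * D₂ l) := by
      rw [hwR, hwT]; ring
    have h1 := hD₁ l
    have h2 := hD₂ l
    calc ‖wT l - wR l‖ ≤ ‖qR - qT‖ * D₁ l + ‖pR - pT‖ * D₂ l := by
          rw [e1, norm_neg]
          refine (norm_add_le _ _).trans ?_
          rw [norm_mul, norm_mul, Complex.norm_real, Complex.norm_real,
            Real.norm_of_nonneg h1, Real.norm_of_nonneg h2]
      _ ≤ P * (√qR.re * √qT.re) * D₁ l + P * (√pR.re * √pT.re) * D₂ l := by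
          rw [← hP1]; gcongr
      _ = P * (√(qR.re * D₁ l) * √(qT.re * D₁ l) + √(pR.re * D₂ l) * √(pT.re * D₂ l)) := by
          rw [Real.sqrt_mul hqR, Real.sqrt_mul hqT, Real.sqrt_mul hpR, Real.sqrt_mul hpT]
          have h3 := Real.mul_self_sqrt h1
          have h4 := Real.mul_self_sqrt h2
          linear_combination (-(P * (√qR.re * √qT.re))) * h3 - (P * (√pR.re * √pT.re)) * h4
      _ ≤ _ := by
          rw [hwR, hwT, Complex.add_re, Complex.re_mul_ofReal, Complex.re_mul_ofReal,
            Complex.add_re, Complex.re_mul_ofReal, Complex.re_mul_ofReal]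
          gcongr
          exact sqrt_mul_add_sqrt_mul_le (by positivity) (by positivity) (by positivity)
            (by positivity)
  have hcs := norm_sum_green_sub_le hH hs hwR0 hwT0 hD₁ hP0 hdiff
  have hmain : m * ‖pR - pT‖ ≤ m * ε + P * (√(m * pR.re) * √(m * (pT.re - c))) := by
    have e2 : (m : ℂ) * (pR - pT) = (m * pR - ∑ k, (D₁ k : ℂ) * green H s wR k k) +
        ∑ k, (D₁ k : ℂ) * (green H s wR k k - green H s wT k k) := by
      have : ∑ k, (D₁ k : ℂ) * (green H s wR k k - green H s wT k k) =
          ∑ k, (D₁ k : ℂ) * green H s wR k k - ∑ k, (D₁ k : ℂ) * green H s wT k k := by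
        rw [← Finset.sum_sub_distrib]
        exact Finset.sum_congr rfl fun k _ => by ring
      rw [this, ← heT]
      ring
    have e3 : m * ‖pR - pT‖ = ‖(m : ℂ) * (pR - pT)‖ := by
      rw [norm_mul, Complex.norm_real, Real.norm_of_nonneg hm.le]
    rw [e3, e2]
    refine (norm_add_le _ _).trans (add_le_add heR (hcs.trans ?_))
    gcongr
  have hmain2 : P * (√pR.re * √pT.re) ≤ ε + P * (√pR.re * √(pT.re - c)) := by
    rw [Real.sqrt_mul hm.le, Real.sqrt_mul hm.le, hP1] at hmain
    have h5 := Real.mul_self_sqrt hm.le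
    refine le_of_mul_le_mul_left ?_ hm
    calc m * (P * (√pR.re * √pT.re)) ≤ _ := hmain
      _ = m * ε + (√m * √m) * (P * (√pR.re * √(pT.re - c))) := by ring
      _ = _ := by rw [h5]; ring
  have hPle := le_of_contraction hP0 (Real.sqrt_pos.2 hpR0) (Real.sqrt_nonneg _) hc
    (by rw [Real.sq_sqrt hpT, Real.sq_sqrt (by linarith)]; linarith) (Real.sqrt_nonneg _) hmain2
  have hPK := mul_le_of_le_sqrt_ratio hc hε0 hpT0 hxR hpT' hPle (by linarith)
  have hsq : ∀ {x y : ℝ}, x ≤ K → y ≤ K → √x * √y ≤ K := by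
    intro x y hx hy
    calc √x * √y ≤ √K * √K := by gcongr
      _ = K := Real.mul_self_sqrt hK0.le
  refine ⟨?_, hP2.trans ?_⟩
  · rw [hP1]
    exact (mul_le_mul_of_nonneg_left (hsq hpR' hpT') hP0).trans hPK
  · exact (mul_le_mul_of_nonneg_left (hsq hqR' hqT') hP0).trans hPK

/-- An approximate solution of the fixed-point system is close to an exact one. -/
lemma stability (hH : H.IsHermitian) (hs : 0 < s.re) (hD₁ : ∀ k, 0 ≤ D₁ k)
    (hD₂ : ∀ k, 0 ≤ D₂ k) (hm : 0 < m) (hc : 0 < c) (hε : 2 * ε ≤ c)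
    (hpR : 0 ≤ pR.re) (hqR : 0 ≤ qR.re) (hpT : 0 ≤ pT.re) (hqT : 0 ≤ qT.re)
    (hpR' : pR.re ≤ K) (hqR' : qR.re ≤ K) (hpT' : pT.re ≤ K) (hqT' : qT.re ≤ K)
    {wR wT : ι → ℂ} (hwR : ∀ k, wR k = qR * D₁ k + pR * D₂ k)
    (hwT : ∀ k, wT k = qT * D₁ k + pT * D₂ k)
    (heT₁ : m * pT = ∑ k, (D₁ k : ℂ) * green H s wT k k)
    (heT₂ : m * qT = ∑ k, (D₂ k : ℂ) * green H s wT k k)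
    (heR₁ : ‖m * pR - ∑ k, (D₁ k : ℂ) * green H s wR k k‖ ≤ m * ε)
    (heR₂ : ‖m * qR - ∑ k, (D₂ k : ℂ) * green H s wR k k‖ ≤ m * ε)
    (hlR₁ : m * c ≤ s.re * ∑ k, D₁ k * ∑ l, ‖green H s wR k l‖ ^ 2)
    (hlR₂ : m * c ≤ s.re * ∑ k, D₂ k * ∑ l, ‖green H s wR k l‖ ^ 2)
    (hlT₁ : m * c ≤ s.re * ∑ k, D₁ k * ∑ l, ‖green H s wT l k‖ ^ 2)
    (hlT₂ : m * c ≤ s.re * ∑ k, D₂ k * ∑ l, ‖green H s wT l k‖ ^ 2)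
    (hR0 : 0 < pR.re ∧ 0 < qR.re) (hT0 : 0 < pT.re ∧ 0 < qT.re) :
    ‖pR - pT‖ ≤ 4 * ε * K ^ 2 / c ^ 2 ∧ ‖qR - qT‖ ≤ 4 * ε * K ^ 2 / c ^ 2 := by
  -- Exchanging (p, D₁) with (q, D₂) leaves the system unchanged, so either relative error may be
  -- the larger one.
  rcases le_total (‖qR - qT‖ * (√pR.re * √pT.re)) (‖pR - pT‖ * (√qR.re * √qT.re)) with h | h
  · exact stability_of_ratio_le hH hs hD₁ hD₂ hm hc hε hpR hqR hpT hqT hpR' hqR' hpT' hqT'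
      hwR hwT heT₁ heR₁ hlR₁ hlT₁ hR0.2 hT0.2 h
  · exact (stability_of_ratio_le hH hs hD₂ hD₁ hm hc hε hqR hpR hqT hpT hqR' hpR' hqT' hpT'
      (fun k => by rw [hwR, add_comm]) (fun k => by rw [hwT, add_comm]) heT₂ heR₂ hlR₂ hlT₂
      hR0.1 hT0.1 h).symm

end Stability


/-! ### Resampling one coordinate and the Efron-Stein inequality -/

section ProductMeasure

variable {κ : Type*} [Fintype κ] [DecidableEq κ] {μ : κ → Measure ℂ}
  [∀ q, IsProbabilityMeasure (μ q)]

lemma measurable_update_uncurry (q : κ) :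
    Measurable fun p : (κ → ℂ) × ℂ => Function.update p.1 q p.2 := by
  refine measurable_pi_lambda _ fun r => ?_
  by_cases h : r = q
  · subst h; simpa using measurable_snd
  · simpa [h, Function.comp_def] using (measurable_pi_apply r).comp measurable_fst

/-- Resampling one coordinate preserves a product measure. -/
lemma measurePreserving_update (q : κ) :
    MeasurePreserving (fun p : (κ → ℂ) × ℂ => Function.update p.1 q p.2)
      ((Measure.pi μ).prod (μ q)) (Measure.pi μ) := by
  refine ⟨measurable_update_uncurry q, (Measure.pi_eq fun t ht => ?_).symm⟩
  rw [Measure.map_apply (measurable_update_uncurry q) (MeasurableSet.univ_pi ht)]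
  have e : (fun p : (κ → ℂ) × ℂ => Function.update p.1 q p.2) ⁻¹' Set.univ.pi t =
      (Set.univ.pi (Function.update t q Set.univ)) ×ˢ t q := by
    ext p
    simp only [Set.mem_preimage, Set.mem_univ_pi, Set.mem_prod]
    constructor
    · intro h
      refine ⟨fun r => ?_, by simpa using h q⟩
      by_cases hr : r = q
      · subst hr; simp
      · simpa [hr] using h r
    · rintro ⟨h1, h2⟩ r
      by_cases hr : r = q
      · subst hr; simpa using h2
      · simpa [hr] using h1 r
  rw [e, Measure.prod_prod, Measure.pi_pi, ← Finset.mul_prod_erase _ _ (Finset.mem_univ q),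
    ← Finset.mul_prod_erase Finset.univ (fun i => μ i (t i)) (Finset.mem_univ q)]
  simp only [Function.update_self, measure_univ, one_mul]
  rw [mul_comm]
  congr 1
  refine Finset.prod_congr rfl fun r hr => ?_
  rw [Function.update_of_ne (Finset.ne_of_mem_erase hr)]

lemma integral_update {E : Type*} [NormedAddCommGroup E] [NormedSpace ℝ E]
    {F : (κ → ℂ) → E} (hF : Integrable F (Measure.pi μ)) (q : κ) :
    ∫ x, F x ∂Measure.pi μ = ∫ x, ∫ t, F (Function.update x q t) ∂μ q ∂Measure.pi μ := by
  have h := measurePreserving_update (μ := μ) q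
  have h2 : Integrable (fun p : (κ → ℂ) × ℂ => F (Function.update p.1 q p.2))
      ((Measure.pi μ).prod (μ q)) := h.integrable_comp_of_integrable hF
  rw [← integral_prod _ h2]
  conv_lhs => rw [← h.map_eq]
  rw [integral_map h.measurable.aemeasurable]
  rw [h.map_eq]
  exact hF.aestronglyMeasurable

lemma integrable_of_bounded {Ω E : Type*} [MeasurableSpace Ω] [NormedAddCommGroup E]
    {P : Measure Ω} [IsFiniteMeasure P] {F : Ω → E} {C : ℝ} (hF : AEStronglyMeasurable F P)
    (hC : ∀ x, ‖F x‖ ≤ C) : Integrable F P :=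
  Integrable.of_bound hF C (Filter.Eventually.of_forall hC)

/-- `F` does not depend on the coordinate `q`. -/
def IndepOf (F : (κ → ℂ) → ℂ) (q : κ) : Prop := ∀ x t, F (Function.update x q t) = F x

lemma integral_eval_mul {h : (κ → ℂ) → ℂ} {q : κ} (hq : IndepOf h q) {C : ℝ} (hm : Measurable h)
    (hC : ∀ x, ‖h x‖ ≤ C) {φ : ℂ → ℂ} (hφ : Integrable φ (μ q)) :
    ∫ x, φ (x q) * h x ∂Measure.pi μ = (∫ t, φ t ∂μ q) * ∫ x, h x ∂Measure.pi μ := by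
  have h1 : Integrable (fun x : κ → ℂ => φ (x q)) (Measure.pi μ) :=
    (measurePreserving_eval μ q).integrable_comp_of_integrable hφ
  have h2 : Integrable (fun x => φ (x q) * h x) (Measure.pi μ) :=
    h1.mul_bdd hm.aestronglyMeasurable (Filter.Eventually.of_forall hC)
  rw [integral_update h2 q]
  simp only [Function.update_self, hq _ _]
  simp_rw [integral_mul_const]
  rw [integral_const_mul]

/-- Integration of one coordinate. -/
def avg (μ : κ → Measure ℂ) (q : κ) (F : (κ → ℂ) → ℂ) (x : κ → ℂ) : ℂ :=
  ∫ t, F (Function.update x q t) ∂μ q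

lemma measurable_avg (q : κ) {F : (κ → ℂ) → ℂ} (hF : Measurable F) : Measurable (avg μ q F) := by
  have h : StronglyMeasurable fun p : (κ → ℂ) × ℂ => F (Function.update p.1 q p.2) :=
    (hF.comp (measurable_update_uncurry q)).stronglyMeasurable
  exact h.integral_prod_right.measurable

lemma norm_avg_le (q : κ) {F : (κ → ℂ) → ℂ} {C : ℝ} (hC : ∀ x, ‖F x‖ ≤ C) (x : κ → ℂ) :
    ‖avg μ q F x‖ ≤ C := by
  have := norm_integral_le_of_norm_le_const (μ := μ q)
    (Filter.Eventually.of_forall fun t => hC (Function.update x q t))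
  simpa [avg] using this

lemma indepOf_avg_self (q : κ) (F : (κ → ℂ) → ℂ) : IndepOf (avg μ q F) q := by
  intro x t
  simp [avg]

lemma IndepOf.avg {F : (κ → ℂ) → ℂ} {r : κ} (h : IndepOf F r) (q : κ) :
    IndepOf (avg μ q F) r := by
  intro x t
  by_cases hqr : q = r
  · subst hqr; exact indepOf_avg_self q F x t
  · simp only [InfoPlusNoise.avg]
    congr 1
    ext t'
    rw [Function.update_comm (Ne.symm hqr), h]

lemma avg_sub (q : κ) {F G : (κ → ℂ) → ℂ} (hF : Measurable F) (hG : Measurable G) {C C' : ℝ}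
    (hC : ∀ x, ‖F x‖ ≤ C) (hC' : ∀ x, ‖G x‖ ≤ C') (x : κ → ℂ) :
    avg μ q (F - G) x = avg μ q F x - avg μ q G x := by
  have hu : Measurable fun t : ℂ => Function.update x q t := measurable_update x
  exact integral_sub
    (integrable_of_bounded (hF.comp hu).aestronglyMeasurable fun t => hC _)
    (integrable_of_bounded (hG.comp hu).aestronglyMeasurable fun t => hC' _)

/-- `‖F - g‖² = ‖F - E F‖² + ‖E F - g‖²` for a constant `g`. -/
lemma integral_norm_sub_sq {Ω : Type*} [MeasurableSpace Ω] {P : Measure Ω}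
    [IsProbabilityMeasure P] {F : Ω → ℂ} {C : ℝ} (hF : AEStronglyMeasurable F P)
    (hC : ∀ x, ‖F x‖ ≤ C) (g : ℂ) :
    ∫ x, ‖F x - g‖ ^ 2 ∂P = ∫ x, ‖F x‖ ^ 2 ∂P - ‖∫ x, F x ∂P‖ ^ 2 + ‖∫ x, F x ∂P - g‖ ^ 2 := by
  have hFi : Integrable F P := integrable_of_bounded hF hC
  have hF2 : Integrable (fun x => ‖F x‖ ^ 2) P :=
    integrable_of_bounded (C := C ^ 2) (hF.norm.pow 2) fun x => by
      rw [norm_pow, norm_norm]; gcongr; exact hC x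
  have hin : Integrable (fun x => inner ℝ g (F x)) P := hFi.const_inner g
  have e1 : ∀ x, ‖F x - g‖ ^ 2 = ‖F x‖ ^ 2 - 2 * inner ℝ g (F x) + ‖g‖ ^ 2 := fun x => by
    rw [norm_sub_sq_real, real_inner_comm]
  simp_rw [e1]
  have hsub : Integrable (fun x => ‖F x‖ ^ 2 - 2 * inner ℝ g (F x)) P := hF2.sub (hin.const_mul 2)
  rw [integral_add hsub (integrable_const _), integral_sub hF2 (hin.const_mul 2), integral_const_mul, integral_inner hFi,
    norm_sub_sq_real, real_inner_comm g]
  simp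
  ring

/-- For fixed other coordinates g is constant in the coordinate q, and the conditional variance of F
is at most the mean square distance to any constant. -/
lemma integral_norm_avg_sq_le (q : κ) {F : (κ → ℂ) → ℂ} (hF : Measurable F) {C : ℝ}
    (hC : ∀ x, ‖F x‖ ≤ C) {g : (κ → ℂ) → ℂ} (hg : IndepOf g q) (hgm : Measurable g) {C' : ℝ}
    (hC' : ∀ x, ‖g x‖ ≤ C') :
    ∫ x, ‖F x‖ ^ 2 ∂Measure.pi μ ≤
      ∫ x, ‖avg μ q F x‖ ^ 2 ∂Measure.pi μ + ∫ x, ‖F x - g x‖ ^ 2 ∂Measure.pi μ := by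
  have hF2 : Integrable (fun x => ‖F x‖ ^ 2) (Measure.pi μ) :=
    integrable_of_bounded (C := C ^ 2) (hF.norm.pow_const 2).aestronglyMeasurable fun x => by
      rw [norm_pow, norm_norm]; gcongr; exact hC x
  have hA2 : Integrable (fun x => ‖avg μ q F x‖ ^ 2) (Measure.pi μ) :=
    integrable_of_bounded (C := C ^ 2)
      ((measurable_avg q hF).norm.pow_const 2).aestronglyMeasurable fun x => by
      rw [norm_pow, norm_norm]; gcongr; exact norm_avg_le q hC x
  have hFg2 : Integrable (fun x => ‖F x - g x‖ ^ 2) (Measure.pi μ) :=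
    integrable_of_bounded (C := (C + C') ^ 2)
      ((hF.sub hgm).norm.pow_const 2).aestronglyMeasurable fun x => by
      rw [norm_pow, norm_norm]
      gcongr
      exact (norm_sub_le _ _).trans (add_le_add (hC x) (hC' x))
  have hP := measurePreserving_update (μ := μ) q
  have hF2' : Integrable (fun x => ∫ t, ‖F (Function.update x q t)‖ ^ 2 ∂μ q) (Measure.pi μ) :=
    (hP.integrable_comp_of_integrable hF2).integral_prod_left
  have hFg2' : Integrable (fun x => ∫ t, ‖F (Function.update x q t) -
      g (Function.update x q t)‖ ^ 2 ∂μ q) (Measure.pi μ) := (hP.integrable_comp_of_integrable hFg2).integral_prod_left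
  rw [integral_update hF2 q, integral_update hFg2 q, ← integral_add hA2 hFg2']
  refine integral_mono hF2' (hA2.add hFg2') fun x => ?_
  have hu : Measurable fun t : ℂ => Function.update x q t := measurable_update x
  have h := integral_norm_sub_sq (P := μ q) (F := fun t => F (Function.update x q t))
    (hF.comp hu).aestronglyMeasurable (fun t => hC _) (g x)
  simp only [hg x _]
  rw [h]
  have h0 := sq_nonneg ‖∫ t, F (Function.update x q t) ∂μ q - g x‖
  simp only [avg]
  linarith

/-- Averaging contracts L², by non-negativity of the conditional variance. -/
lemma integral_norm_avg_sq_le_self (q : κ) {F : (κ → ℂ) → ℂ} (hF : Measurable F) {C : ℝ}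
    (hC : ∀ x, ‖F x‖ ≤ C) :
    ∫ x, ‖avg μ q F x‖ ^ 2 ∂Measure.pi μ ≤ ∫ x, ‖F x‖ ^ 2 ∂Measure.pi μ := by
  have hF2 : Integrable (fun x => ‖F x‖ ^ 2) (Measure.pi μ) :=
    integrable_of_bounded (C := C ^ 2) (hF.norm.pow_const 2).aestronglyMeasurable fun x => by
      rw [norm_pow, norm_norm]; gcongr; exact hC x
  have hA2 : Integrable (fun x => ‖avg μ q F x‖ ^ 2) (Measure.pi μ) :=
    integrable_of_bounded (C := C ^ 2)
      ((measurable_avg q hF).norm.pow_const 2).aestronglyMeasurable fun x => by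
      rw [norm_pow, norm_norm]; gcongr; exact norm_avg_le q hC x
  have hP := measurePreserving_update (μ := μ) q
  have hF2' : Integrable (fun x => ∫ t, ‖F (Function.update x q t)‖ ^ 2 ∂μ q) (Measure.pi μ) :=
    (hP.integrable_comp_of_integrable hF2).integral_prod_left
  rw [integral_update hF2 q]
  refine integral_mono hA2 hF2' fun x => ?_
  have hu : Measurable fun t : ℂ => Function.update x q t := measurable_update x
  have h := integral_norm_sub_sq (P := μ q) (F := fun t => F (Function.update x q t))
    (hF.comp hu).aestronglyMeasurable (fun t => hC _) (avg μ q F x)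
  have h0 : 0 ≤ ∫ t, ‖F (Function.update x q t) - avg μ q F x‖ ^ 2 ∂μ q :=
    integral_nonneg fun t => by positivity
  rw [h] at h0
  simp only [avg, sub_self, norm_zero] at h0 ⊢
  linarith

/-- The Efron-Stein inequality, for the coordinates in a list. -/
lemma efronStein_list (l : List κ) {F : (κ → ℂ) → ℂ} (hF : Measurable F) {C : ℝ}
    (hC : ∀ x, ‖F x‖ ≤ C) {g : κ → (κ → ℂ) → ℂ} (hg : ∀ q, IndepOf (g q) q)
    (hgm : ∀ q, Measurable (g q)) {C' : ℝ} (hC' : ∀ q x, ‖g q x‖ ≤ C') :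
    ∃ F' : (κ → ℂ) → ℂ, Measurable F' ∧ (∀ x, ‖F' x‖ ≤ C) ∧
      (∀ q, IndepOf F q ∨ q ∈ l → IndepOf F' q) ∧
      ∫ x, F' x ∂Measure.pi μ = ∫ x, F x ∂Measure.pi μ ∧
      ∫ x, ‖F x‖ ^ 2 ∂Measure.pi μ ≤ ∫ x, ‖F' x‖ ^ 2 ∂Measure.pi μ +
        (l.map fun q => ∫ x, ‖F x - g q x‖ ^ 2 ∂Measure.pi μ).sum := by
  induction l generalizing F g with
  | nil => exact ⟨F, hF, hC, by simp, rfl, by simp⟩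
  | cons r l ih =>
    obtain ⟨F', h1, h2, h3, h4, h5⟩ := ih (measurable_avg (μ := μ) r hF) (norm_avg_le r hC)
      (g := fun q => avg μ r (g q)) (fun q => (hg q).avg r) (fun q => measurable_avg r (hgm q))
      (fun q => norm_avg_le r (hC' q))
    refine ⟨F', h1, h2, ?_, ?_, ?_⟩
    · intro q hq
      rcases hq with hq | hq
      · exact h3 q (Or.inl (hq.avg r))
      · rcases List.mem_cons.1 hq with rfl | hq
        · exact h3 q (Or.inl (indepOf_avg_self q F))
        · exact h3 q (Or.inr hq)
    · rw [h4]
      exact (integral_update (integrable_of_bounded hF.aestronglyMeasurable hC) r).symm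
    -- Averaging out r costs one term of the sum. The later terms involve the averages of F and of g
    -- q over r; they only decrease, while g q stays independent of q.
    · have h6 := integral_norm_avg_sq_le (μ := μ) r hF hC (hg r) (hgm r) (hC' r)
      have h7 : (l.map fun q => ∫ x, ‖avg μ r F x - avg μ r (g q) x‖ ^ 2 ∂Measure.pi μ).sum ≤
          (l.map fun q => ∫ x, ‖F x - g q x‖ ^ 2 ∂Measure.pi μ).sum := by
        refine List.sum_le_sum fun q _ => ?_
        have h8 := integral_norm_avg_sq_le_self (μ := μ) r (hF.sub (hgm q)) (C := C + C')
          fun x => (norm_sub_le _ _).trans (add_le_add (hC x) (hC' q x))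
        have e : ∀ x, avg μ r (F - g q) x = avg μ r F x - avg μ r (g q) x :=
          avg_sub r hF (hgm q) hC (hC' q)
        simpa only [e, Pi.sub_apply] using h8
      rw [List.map_cons, List.sum_cons]
      linarith

/-- The coordinates of y are replaced by those of x one at a time. -/
lemma eq_of_forall_indepOf {F : (κ → ℂ) → ℂ} (h : ∀ q, IndepOf F q) (x y : κ → ℂ) :
    F x = F y := by
  have key : ∀ S : Finset κ, F (fun q => if q ∈ S then x q else y q) = F y := by
    intro S
    induction S using Finset.induction_on with
    | empty => simp
    | insert q S hq ih =>
      rw [← ih, ← h q (fun r => if r ∈ S then x r else y r) (x q)]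
      congr 1
      ext r
      by_cases hr : r = q
      · subst hr; simp
      · simp [hr]
  simpa using key Finset.univ

/-- The Efron-Stein inequality. -/
lemma efronStein {F : (κ → ℂ) → ℂ} (hF : Measurable F) {C : ℝ}
    (hC : ∀ x, ‖F x‖ ≤ C) {g : κ → (κ → ℂ) → ℂ} (hg : ∀ q, IndepOf (g q) q)
    (hgm : ∀ q, Measurable (g q)) {C' : ℝ} (hC' : ∀ q x, ‖g q x‖ ≤ C') :
    ∫ x, ‖F x - ∫ y, F y ∂Measure.pi μ‖ ^ 2 ∂Measure.pi μ ≤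
      ∑ q, ∫ x, ‖F x - g q x‖ ^ 2 ∂Measure.pi μ := by
  obtain ⟨F', -, -, h3, h4, h5⟩ :=
    efronStein_list (μ := μ) (Finset.univ : Finset κ).toList hF hC hg hgm hC'
  have hconst : ∀ x y, F' x = F' y := eq_of_forall_indepOf fun q => h3 q (Or.inr (by simp))
  have hF' : ∀ x, F' x = ∫ y, F y ∂Measure.pi μ := fun x => by
    rw [← h4]
    conv_rhs => enter [2, y]; rw [hconst y x]
    simp
  simp only [hF', Finset.sum_map_toList] at h5
  rw [integral_norm_sub_sq hF.aestronglyMeasurable hC]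
  simp only [sub_self, norm_zero]
  simp at h5
  linarith

end ProductMeasure


/-! ### Exact effect of one entry on the inverse -/

section RankTwo

variable {ι κ : Type*} [Fintype ι] [DecidableEq ι] {H H₀ : Matrix ι ι ℂ} {s y : ℂ} {k l : ι}

open ComplexConjugate in
/-- Effect on the inverse of changing a pair of conjugate entries of the Hermitian part. -/
lemma green_mul_entry (hH : H.IsHermitian) (hH₀ : H₀.IsHermitian) (hs : 0 < s.re)
    (hd : H - H₀ = single k l y + single l k (conj y)) (B : Matrix ι κ ℂ) (u : ι) (v : κ) :
    (green H s 0 * B) u v = (green H₀ s 0 * B) u v -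
      Complex.I * (y * green H₀ s 0 u k * (green H s 0 * B) l v +
        conj y * green H₀ s 0 u l * (green H s 0 * B) k v) := by
  have h := green_sub_green (w := 0) (w' := 0) hH₀ hH hs (by simp) (by simp)
  rw [hd] at h
  simp only [sub_self, diagonal_zero', add_zero] at h
  have h2 : green H s 0 * B = green H₀ s 0 * B - Complex.I • (green H₀ s 0 *
      (single k l y + single l k (conj y)) * (green H s 0 * B)) := by
    have h3 := congrArg (· * B) h
    simp only [Matrix.sub_mul, Matrix.mul_smul, Matrix.smul_mul] at h3
    rw [← Matrix.mul_assoc, ← h3]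
    abel
  have h4 := congrFun (congrFun h2 u) v
  rw [h4, Matrix.sub_apply, Matrix.smul_apply, smul_eq_mul, Matrix.mul_add, Matrix.add_mul,
    Matrix.add_apply]
  congr 2
  have key : ∀ (a b : ι) (t : ℂ), (green H₀ s 0 * single a b t * (green H s 0 * B)) u v =
      t * green H₀ s 0 u a * (green H s 0 * B) b v := by
    intro a b t
    rw [Matrix.mul_apply, Finset.sum_eq_single b]
    · rw [mul_single_apply_same]; ring
    · intro c _ hc
      rw [mul_single_apply_of_ne _ _ _ _ _ hc, zero_mul]
    · simp
  rw [key, key]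

end RankTwo

/-! ### Scalar Taylor remainders -/

section ScalarExpansion

open ComplexConjugate

/-- Second-order expansion of one off-diagonal term. -/
lemma norm_expansion_le {y Ukk Ukl Ulk Ull Vkk Vlk Pkk Plk : ℂ} {m : ℝ} (hm : 1 ≤ m)
    (hUkk : ‖Ukk‖ ≤ m) (hUlk : ‖Ulk‖ ≤ m) (hUll : ‖Ull‖ ≤ m)
    (hPkk : ‖Pkk‖ ≤ m) (hPlk : ‖Plk‖ ≤ m)
    (ek : Pkk = Vkk - Complex.I * (y * Ukk * Plk + conj y * Ukl * Pkk))
    (el : Plk = Vlk - Complex.I * (y * Ulk * Plk + conj y * Ull * Pkk)) :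
    ‖y * Plk - y * Vlk + Complex.I * (y * conj y) * (Ull * Vkk)‖ ≤
      4 * m ^ 4 * ‖y‖ ^ 4 + 2 * ‖y‖ ^ 2 * (‖Ukl‖ ^ 2 + ‖Ulk‖ ^ 2 + ‖Vlk‖ ^ 2) := by
  set t := ‖y‖ with ht
  have ht0 : 0 ≤ t := norm_nonneg y
  have htc : ‖conj y‖ = t := by rw [Complex.norm_conj]
  have hP : ‖Plk‖ ≤ ‖Vlk‖ + 2 * m ^ 2 * t := by
    rw [el]
    refine (norm_sub_le _ _).trans (add_le_add le_rfl ?_)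
    rw [norm_mul, Complex.norm_I, one_mul]
    refine (norm_add_le _ _).trans ?_
    simp only [norm_mul, htc, ← ht]
    calc t * ‖Ulk‖ * ‖Plk‖ + t * ‖Ull‖ * ‖Pkk‖ ≤ t * m * m + t * m * m := by gcongr
      _ = _ := by ring
  -- Nothing is assumed on the mean of y². The y² term therefore cannot be cancelled; it is kept
  -- because its factor Ulk · Plk consists of off-diagonal entries, whose squares have a small sum.
  have e : y * Plk - y * Vlk + Complex.I * (y * conj y) * (Ull * Vkk) =
      -(Complex.I * (y * y * Ulk * Plk)) -
        (y * conj y * Ull) * (y * Ukk * Plk + conj y * Ukl * Pkk) := by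
    have e1 : Pkk - Vkk = -(Complex.I * (y * Ukk * Plk + conj y * Ukl * Pkk)) := by
      linear_combination ek
    linear_combination y * el - Complex.I * (y * conj y) * Ull * e1 +
      (y * conj y * Ull) * (y * Ukk * Plk + conj y * Ukl * Pkk) * Complex.I_sq
  have h1 : ‖y * Plk - y * Vlk + Complex.I * (y * conj y) * (Ull * Vkk)‖ ≤
      t * t * ‖Ulk‖ * ‖Plk‖ + t * t * m * (t * m * ‖Plk‖ + t * ‖Ukl‖ * m) := by
    rw [e]
    refine (norm_sub_le _ _).trans ?_
    rw [norm_neg, norm_mul, Complex.norm_I, one_mul, norm_mul (y * conj y * Ull)]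
    have h2 : ‖y * Ukk * Plk + conj y * Ukl * Pkk‖ ≤ t * m * ‖Plk‖ + t * ‖Ukl‖ * m := by
      refine (norm_add_le _ _).trans ?_
      simp only [norm_mul, htc, ← ht]
      gcongr
    simp only [norm_mul y, norm_mul (y * y), norm_mul (y * y * Ulk), norm_mul (y * conj y), htc,
      ← ht]
    gcongr
  refine h1.trans ?_
  set u := ‖Ulk‖
  set u' := ‖Ukl‖
  set v := ‖Vlk‖
  have h3 : t * t * u * ‖Plk‖ + t * t * m * (t * m * ‖Plk‖ + t * u' * m) ≤
      t * t * u * (v + 2 * m ^ 2 * t) + t * t * m * (t * m * (v + 2 * m ^ 2 * t) + t * u' * m) := by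
    gcongr
  have h4 : u * (v + 2 * m ^ 2 * t) + m * (t * m * (v + 2 * m ^ 2 * t) + t * u' * m) ≤
      4 * m ^ 4 * t ^ 2 + 2 * (u' ^ 2 + u ^ 2 + v ^ 2) := by
    have : m ^ 4 * t ^ 2 = (m ^ 2 * t) ^ 2 := by ring
    nlinarith [sq_nonneg (u - v), sq_nonneg (u - m ^ 2 * t), sq_nonneg (v - m ^ 2 * t),
      sq_nonneg (u' - m ^ 2 * t), sq_nonneg u', sq_nonneg v, sq_nonneg u]
  calc _ ≤ _ := h3
    _ = t ^ 2 * (u * (v + 2 * m ^ 2 * t) + m * (t * m * (v + 2 * m ^ 2 * t) + t * u' * m)) := by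
      ring
    _ ≤ t ^ 2 * (4 * m ^ 4 * t ^ 2 + 2 * (u' ^ 2 + u ^ 2 + v ^ 2)) := by gcongr
    _ = _ := by ring

/-- First-order expansion of a product of two entries. -/
lemma norm_mul_expansion_le {g u a r p v b q : ℂ} {m t : ℝ} (hv : ‖v‖ ≤ m) (hu : ‖u‖ ≤ m)
    (hm : 1 ≤ m) (hg : g = u + a + r) (hp : p = v + b + q)
    (hgu : ‖g - u‖ ≤ 2 * m ^ 2 * t) (hpv : ‖p - v‖ ≤ 2 * m ^ 2 * t)
    (hr : ‖r‖ ≤ 4 * m ^ 3 * t ^ 2) (hq : ‖q‖ ≤ 4 * m ^ 3 * t ^ 2) :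
    ‖g * p - u * v - (a * v + u * b)‖ ≤ 12 * m ^ 4 * t ^ 2 := by
  have e : g * p - u * v - (a * v + u * b) = (g - u) * (p - v) + r * v + u * q := by
    subst hg hp; ring
  rw [e]
  calc _ ≤ ‖(g - u) * (p - v)‖ + ‖r * v‖ + ‖u * q‖ := norm_add₃_le
    _ ≤ (2 * m ^ 2 * t) * (2 * m ^ 2 * t) + 4 * m ^ 3 * t ^ 2 * m + m * (4 * m ^ 3 * t ^ 2) := by
      simp only [norm_mul]
      have := (norm_nonneg _).trans hgu
      gcongr
    _ = _ := by ring

lemma norm_entry_sub_le {y Uk Ul Mk Ml M M' : ℂ} {m : ℝ} (hUk : ‖Uk‖ ≤ m) (hUl : ‖Ul‖ ≤ m)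
    (hMk : ‖Mk‖ ≤ m) (hMl : ‖Ml‖ ≤ m)
    (e : M' = M - Complex.I * (y * Uk * Ml + conj y * Ul * Mk)) :
    ‖M' - M‖ ≤ 2 * m ^ 2 * ‖y‖ := by
  have e2 : M' - M = -(Complex.I * (y * Uk * Ml + conj y * Ul * Mk)) := by rw [e]; ring
  rw [e2, norm_neg, norm_mul, Complex.norm_I, one_mul]
  have hm : 0 ≤ m := (norm_nonneg _).trans hUk
  refine (norm_add_le _ _).trans ?_
  simp only [norm_mul, Complex.norm_conj]
  calc ‖y‖ * ‖Uk‖ * ‖Ml‖ + ‖y‖ * ‖Ul‖ * ‖Mk‖ ≤ ‖y‖ * m * m + ‖y‖ * m * m := by gcongr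
    _ = _ := by ring

end ScalarExpansion

/-! ### Averaging an expansion in one coordinate -/

section Expectation

open ComplexConjugate

variable {κ : Type*} [Fintype κ] [DecidableEq κ] {μ : κ → Measure ℂ}
  [∀ q, IsProbabilityMeasure (μ q)]

/-- A centred probability measure with unit variance and fourth moment at most `K`. -/
structure IsStandard (ν : Measure ℂ) (K : ℝ) : Prop where
  integrable : Integrable (fun t : ℂ => t) ν
  integrable_sq : Integrable (fun t : ℂ => ‖t‖ ^ 2) ν
  integrable_four : Integrable (fun t : ℂ => ‖t‖ ^ 4) ν
  mean : ∫ t, t ∂ν = 0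
  variance : ∫ t, ‖t‖ ^ 2 ∂ν = 1
  four : ∫ t, ‖t‖ ^ 4 ∂ν ≤ K

/-- A bounded continuous function that does not depend on the coordinate `q`. -/
structure Tame (f : (κ → ℂ) → ℂ) (q : κ) : Prop where
  cont : Continuous f
  bdd : ∃ C, ∀ x, ‖f x‖ ≤ C
  indep : IndepOf f q

namespace Tame

variable {f g : (κ → ℂ) → ℂ} {q : κ}

lemma const (c : ℂ) : Tame (fun _ : κ → ℂ => c) q :=
  ⟨continuous_const, ⟨‖c‖, fun _ => le_rfl⟩, fun _ _ => rfl⟩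

lemma mul (hf : Tame f q) (hg : Tame g q) : Tame (fun x => f x * g x) q := by
  obtain ⟨C, hC⟩ := hf.bdd
  obtain ⟨C', hC'⟩ := hg.bdd
  refine ⟨hf.cont.mul hg.cont, ⟨C * C', fun x => ?_⟩, fun x t => by rw [hf.indep, hg.indep]⟩
  rw [norm_mul]
  exact mul_le_mul (hC x) (hC' x) (norm_nonneg _) ((norm_nonneg _).trans (hC x))

lemma add (hf : Tame f q) (hg : Tame g q) : Tame (fun x => f x + g x) q := by
  obtain ⟨C, hC⟩ := hf.bdd
  obtain ⟨C', hC'⟩ := hg.bdd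
  exact ⟨hf.cont.add hg.cont, ⟨C + C', fun x => (norm_add_le _ _).trans
    (add_le_add (hC x) (hC' x))⟩, fun x t => by rw [hf.indep, hg.indep]⟩

lemma norm_sq (hf : Tame f q) : Tame (fun x => ((‖f x‖ ^ 2 : ℝ) : ℂ)) q := by
  obtain ⟨C, hC⟩ := hf.bdd
  refine ⟨Complex.continuous_ofReal.comp (hf.cont.norm.pow 2), ⟨C ^ 2, fun x => ?_⟩,
    fun x t => by rw [hf.indep]⟩
  rw [Complex.norm_real, norm_pow, norm_norm]
  gcongr
  exact hC x

end Tame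

/-- The functions a, b, h, g do not see the coordinate q. By independence, the terms linear in x_q
and its conjugate have mean zero, |x_q|² is replaced by 1, and |x_q|⁴ by at most K. -/
lemma norm_integral_add_le {q : κ} {K : ℝ} (hν : IsStandard (μ q) K)
    {F a b h : (κ → ℂ) → ℂ} {g : (κ → ℂ) → ℝ} {C₄ : ℝ} (hC₄ : 0 ≤ C₄)
    (hF : Integrable F (Measure.pi μ))
    (ha : Tame a q) (hb : Tame b q) (hh : Tame h q) (hg : Tame (fun x => (g x : ℂ)) q)
    (hle : ∀ x, ‖F x - (x q * a x + conj (x q) * b x) + (‖x q‖ ^ 2 : ℝ) * h x‖ ≤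
      C₄ * ‖x q‖ ^ 4 + ‖x q‖ ^ 2 * g x) :
    ‖∫ x, F x ∂Measure.pi μ + ∫ x, h x ∂Measure.pi μ‖ ≤ C₄ * K + ∫ x, g x ∂Measure.pi μ := by
  have hev := measurePreserving_eval μ q
  have hbdd : ∀ {φ : ℂ → ℂ} {f : (κ → ℂ) → ℂ}, Integrable φ (μ q) → Tame f q →
      Integrable (fun x => φ (x q) * f x) (Measure.pi μ) := by
    intro φ f hφ hf
    obtain ⟨C, hC⟩ := hf.bdd
    exact Integrable.mul_bdd (hev.integrable_comp_of_integrable hφ)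
      hf.cont.measurable.aestronglyMeasurable (Filter.Eventually.of_forall hC)
  have hval : ∀ {φ : ℂ → ℂ} {f : (κ → ℂ) → ℂ}, Integrable φ (μ q) → Tame f q →
      ∫ x, φ (x q) * f x ∂Measure.pi μ = (∫ t, φ t ∂μ q) * ∫ x, f x ∂Measure.pi μ := by
    intro φ f hφ hf
    obtain ⟨C, hC⟩ := hf.bdd
    exact integral_eval_mul hf.indep hf.cont.measurable hC hφ
  have hconj : Integrable (fun t : ℂ => conj t) (μ q) :=
    (Complex.conjCLE : ℂ →L[ℝ] ℂ).integrable_comp hν.integrable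
  have hsqC : Integrable (fun t : ℂ => ((‖t‖ ^ 2 : ℝ) : ℂ)) (μ q) := hν.integrable_sq.ofReal
  have i1 := hbdd hν.integrable ha
  have i2 := hbdd hconj hb
  have i3 := hbdd hsqC hh
  have i4 := hbdd hsqC hg
  have v1 : ∫ x, x q * a x ∂Measure.pi μ = 0 := by
    rw [hval hν.integrable ha, hν.mean, zero_mul]
  have v2 : ∫ x, conj (x q) * b x ∂Measure.pi μ = 0 := by
    rw [hval hconj hb, integral_conj, hν.mean, map_zero, zero_mul]
  have hvar : ∫ t, ((‖t‖ ^ 2 : ℝ) : ℂ) ∂μ q = 1 := by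
    rw [integral_complex_ofReal, hν.variance, Complex.ofReal_one]
  have v3 : ∫ x, ((‖x q‖ ^ 2 : ℝ) : ℂ) * h x ∂Measure.pi μ = ∫ x, h x ∂Measure.pi μ := by
    rw [hval hsqC hh, hvar, one_mul]
  have v4 : ∫ x, ‖x q‖ ^ 2 * g x ∂Measure.pi μ = ∫ x, g x ∂Measure.pi μ := by
    have h := hval hsqC hg
    rw [hvar, one_mul, integral_complex_ofReal] at h
    have h2 : ∫ x : κ → ℂ, ((‖x q‖ ^ 2 : ℝ) : ℂ) * (g x : ℂ) ∂Measure.pi μ =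
        ((∫ x, ‖x q‖ ^ 2 * g x ∂Measure.pi μ : ℝ) : ℂ) := by
      rw [← integral_complex_ofReal]
      simp
    rw [h2] at h
    exact_mod_cast h
  have i5 : Integrable (fun x : κ → ℂ => ‖x q‖ ^ 2 * g x) (Measure.pi μ) := by
    have h := i4.re
    refine h.congr (Filter.Eventually.of_forall fun x => ?_)
    simp [-Complex.ofReal_pow]
  have i6 : Integrable (fun x : κ → ℂ => C₄ * ‖x q‖ ^ 4) (Measure.pi μ) :=
    (hev.integrable_comp_of_integrable hν.integrable_four).const_mul C₄
  have v6 : ∫ x : κ → ℂ, C₄ * ‖x q‖ ^ 4 ∂Measure.pi μ ≤ C₄ * K := by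
    rw [integral_const_mul]
    have h : ∫ x : κ → ℂ, ‖x q‖ ^ 4 ∂Measure.pi μ = ∫ t, ‖t‖ ^ 4 ∂μ q := by
      conv_rhs => rw [← hev.map_eq]
      rw [integral_map hev.measurable.aemeasurable (by fun_prop)]
    rw [h]
    exact mul_le_mul_of_nonneg_left hν.four hC₄
  have i12 : Integrable (fun x => x q * a x + conj (x q) * b x) (Measure.pi μ) := i1.add i2
  have i0 : Integrable (fun x => F x - (x q * a x + conj (x q) * b x)) (Measure.pi μ) :=
    hF.sub i12
  have e : ∫ x, F x ∂Measure.pi μ + ∫ x, h x ∂Measure.pi μ =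
      ∫ x, (F x - (x q * a x + conj (x q) * b x) + (‖x q‖ ^ 2 : ℝ) * h x) ∂Measure.pi μ := by
    rw [integral_add i0 i3, integral_sub hF i12, integral_add i1 i2, v1, v2, v3]
    ring
  rw [e]
  calc _ ≤ ∫ x, (C₄ * ‖x q‖ ^ 4 + ‖x q‖ ^ 2 * g x) ∂Measure.pi μ :=
        norm_integral_le_of_norm_le (i6.add i5) (Filter.Eventually.of_forall hle)
    _ = ∫ x : κ → ℂ, C₄ * ‖x q‖ ^ 4 ∂Measure.pi μ + ∫ x, ‖x q‖ ^ 2 * g x ∂Measure.pi μ :=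
        integral_add i6 i5
    _ ≤ _ := by rw [v4]; linarith

end Expectation


/-! ### The random matrix as a function of its entries, one entry at a time -/

section Model

open ComplexConjugate

variable {N n : ℕ}

/-- The standard deviation `√(d_i dt_j / n)` of an entry. -/
def coef (d : Fin N → ℝ) (dt : Fin n → ℝ) (q : Fin N × Fin n) : ℝ :=
  √(d q.1) * √(dt q.2) / √n

/-- The matrix `Σ` as a function of the array of entries. -/
def model (d : Fin N → ℝ) (dt : Fin n → ℝ) (A : Matrix (Fin N) (Fin n) ℂ)
    (x : Fin N × Fin n → ℂ) : Matrix (Fin N) (Fin n) ℂ :=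
  Matrix.of fun i j => coef d dt (i, j) * x (i, j) + A i j

/-- The inverse of `s + i H`, where `H` is the Hermitization of `Σ`. -/
def modelGreen (d : Fin N → ℝ) (dt : Fin n → ℝ) (A : Matrix (Fin N) (Fin n) ℂ) (s : ℂ)
    (x : Fin N × Fin n → ℂ) : Matrix (Fin N ⊕ Fin n) (Fin N ⊕ Fin n) ℂ :=
  green (hermitize (model d dt A x)) s 0

variable {d : Fin N → ℝ} {dt : Fin n → ℝ} {A : Matrix (Fin N) (Fin n) ℂ} {s : ℂ}

lemma coef_nonneg (q : Fin N × Fin n) : 0 ≤ coef d dt q := by unfold coef; positivity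

lemma coef_sq (hd : ∀ i, 0 ≤ d i) (hdt : ∀ j, 0 ≤ dt j) (q : Fin N × Fin n) :
    coef d dt q ^ 2 = d q.1 * dt q.2 / n := by
  unfold coef
  rw [div_pow, mul_pow, Real.sq_sqrt (hd _), Real.sq_sqrt (hdt _), Real.sq_sqrt (by positivity)]

lemma sigma_eq_model {Ω : Type*} (X : Fin N → Fin n → Ω → ℂ) (ω : Ω) :
    sigma d dt A X ω = model d dt A fun q => X q.1 q.2 ω := by
  ext i j
  simp [sigma, model, diagC, diagonal_mul, mul_diagonal, coef]
  ring

lemma hermitize_model_sub (x : Fin N × Fin n → ℂ) (q : Fin N × Fin n) :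
    hermitize (model d dt A x) - hermitize (model d dt A (Function.update x q 0)) =
      single (Sum.inl q.1) (Sum.inr q.2) (coef d dt q * x q) +
        single (Sum.inr q.2) (Sum.inl q.1) (conj (coef d dt q * x q)) := by
  have key : ∀ i j, model d dt A x i j - model d dt A (Function.update x q 0) i j =
      if q.1 = i ∧ q.2 = j then coef d dt q * x q else 0 := by
    intro i j
    by_cases h : q.1 = i ∧ q.2 = j
    · obtain ⟨h1, h2⟩ := h
      subst h1 h2
      simp [model]
    · have : (i, j) ≠ q := by
        rintro rfl; exact h ⟨rfl, rfl⟩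
      simp [model, h, this]
  ext k l
  rcases k with i | j <;> rcases l with i' | j'
  · simp [hermitize]
  · simpa [hermitize, single_apply] using key i j'
  · have h := congrArg conj (key i' j)
    simp only [map_sub] at h
    simp only [hermitize, Matrix.sub_apply, fromBlocks_apply₂₁, conjTranspose_apply,
      Matrix.add_apply, single_apply, Complex.star_def, h]
    by_cases h1 : q.1 = i' <;> by_cases h2 : q.2 = j <;> simp [h1, h2]
  · simp [hermitize]

/-- Cramer's formula, with a determinant that never vanishes by accretivity. -/
lemma continuous_modelGreen (hs : 0 < s.re) : Continuous (modelGreen d dt A s) := by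
  have hm : Continuous (model d dt A) := by
    refine continuous_matrix fun i j => ?_
    simp only [model, of_apply]
    fun_prop
  have hp : Continuous fun x => pencil (hermitize (model d dt A x)) s 0 := by
    unfold pencil hermitize
    exact (continuous_const.add ((Continuous.matrix_fromBlocks continuous_const hm
      hm.matrix_conjTranspose continuous_const).const_smul Complex.I)).add continuous_const
  have hdet : ∀ x, (pencil (hermitize (model d dt A x)) s 0).det ≠ 0 := fun x =>
    ((isUnit_iff_isUnit_det _).1
      (isUnit_pencil (isHermitian_hermitize _) hs (by simp))).ne_zero
  have e : modelGreen d dt A s = fun x => (pencil (hermitize (model d dt A x)) s 0).det⁻¹ •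
      (pencil (hermitize (model d dt A x)) s 0).adjugate := by
    ext1 x
    rw [modelGreen, green, inv_def, Ring.inverse_eq_inv']
  rw [e]
  exact (hp.matrix_det.inv₀ hdet).smul hp.matrix_adjugate

lemma norm_modelGreen_le (hs : 0 < s.re) (x : Fin N × Fin n → ℂ) :
    ‖modelGreen d dt A s x‖ ≤ 1 / s.re :=
  norm_green_le (isHermitian_hermitize _) hs (by simp)

/-- An exact identity, to be iterated for expansions. The right factor B is kept general: later it
is either 1 or a deterministic matrix brought next to G by cyclicity of the trace. -/
lemma modelGreen_mul_entry {κ : Type*} (hs : 0 < s.re) (x : Fin N × Fin n → ℂ)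
    (q : Fin N × Fin n) (B : Matrix (Fin N ⊕ Fin n) κ ℂ) (u : Fin N ⊕ Fin n) (v : κ) :
    (modelGreen d dt A s x * B) u v = (modelGreen d dt A s (Function.update x q 0) * B) u v -
      Complex.I * (coef d dt q * x q *
        modelGreen d dt A s (Function.update x q 0) u (Sum.inl q.1) *
          (modelGreen d dt A s x * B) (Sum.inr q.2) v +
        conj (coef d dt q * x q) *
          modelGreen d dt A s (Function.update x q 0) u (Sum.inr q.2) *
            (modelGreen d dt A s x * B) (Sum.inl q.1) v) :=
  green_mul_entry (isHermitian_hermitize _) (isHermitian_hermitize _) hs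
    (hermitize_model_sub x q) B u v

lemma modelGreen_entry (hs : 0 < s.re) (x : Fin N × Fin n → ℂ)
    (q : Fin N × Fin n) (u v : Fin N ⊕ Fin n) :
    modelGreen d dt A s x u v = modelGreen d dt A s (Function.update x q 0) u v -
      Complex.I * (coef d dt q * x q *
        modelGreen d dt A s (Function.update x q 0) u (Sum.inl q.1) *
          modelGreen d dt A s x (Sum.inr q.2) v +
        conj (coef d dt q * x q) *
          modelGreen d dt A s (Function.update x q 0) u (Sum.inr q.2) *
            modelGreen d dt A s x (Sum.inl q.1) v) := by
  simpa using modelGreen_mul_entry (d := d) (dt := dt) (A := A) hs x q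
    (1 : Matrix (Fin N ⊕ Fin n) (Fin N ⊕ Fin n) ℂ) u v

variable {B : Matrix (Fin N ⊕ Fin n) (Fin N ⊕ Fin n) ℂ} {m : ℝ}

lemma continuous_modelGreen_mul_entry (hs : 0 < s.re) (B : Matrix (Fin N ⊕ Fin n) (Fin N ⊕ Fin n) ℂ)
    (u v : Fin N ⊕ Fin n) : Continuous fun x => (modelGreen d dt A s x * B) u v :=
  ((continuous_modelGreen hs).matrix_mul continuous_const).matrix_elem u v

lemma continuous_modelGreen_entry (hs : 0 < s.re) (u v : Fin N ⊕ Fin n) :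
    Continuous fun x => modelGreen d dt A s x u v :=
  (continuous_modelGreen hs).matrix_elem u v

lemma tame_modelGreen_mul (hs : 0 < s.re) (B : Matrix (Fin N ⊕ Fin n) (Fin N ⊕ Fin n) ℂ)
    (q : Fin N × Fin n) (u v : Fin N ⊕ Fin n) :
    Tame (fun x => (modelGreen d dt A s (Function.update x q 0) * B) u v) q := by
  refine ⟨(continuous_modelGreen_mul_entry hs B u v).comp
    (continuous_id.update q continuous_const), ⟨1 / s.re * ‖B‖, fun x => ?_⟩, fun x t => ?_⟩
  · exact (norm_entry_le _ _ _).trans ((norm_mul_le _ _).trans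
      (mul_le_mul_of_nonneg_right (norm_modelGreen_le hs _) (norm_nonneg _)))
  · simp

lemma tame_modelGreen (hs : 0 < s.re) (q : Fin N × Fin n) (u v : Fin N ⊕ Fin n) :
    Tame (fun x => modelGreen d dt A s (Function.update x q 0) u v) q := by
  simpa using tame_modelGreen_mul (d := d) (dt := dt) (A := A) hs 1 q u v

variable {μ : Fin N × Fin n → Measure ℂ} [∀ q, IsProbabilityMeasure (μ q)] {K : ℝ}

lemma norm_coef_mul (x : Fin N × Fin n → ℂ) (q : Fin N × Fin n) :
    ‖(coef d dt q : ℂ) * x q‖ = coef d dt q * ‖x q‖ := by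
  rw [norm_mul, Complex.norm_real, Real.norm_of_nonneg (coef_nonneg q)]

/-- Removing one entry changes the mean of a product of two diagonal entries at second order. -/
lemma norm_integral_diag_mul_diag_sub_le (hs : 0 < s.re) (hm : 1 ≤ m) (hG : 1 / s.re ≤ m)
    (hGB : ∀ x, ‖modelGreen d dt A s x * B‖ ≤ m) (q : Fin N × Fin n)
    (hν : IsStandard (μ q) K) (u v : Fin N ⊕ Fin n) :
    ‖∫ x, (modelGreen d dt A s x u u * (modelGreen d dt A s x * B) v v -
        modelGreen d dt A s (Function.update x q 0) u u *
          (modelGreen d dt A s (Function.update x q 0) * B) v v) ∂Measure.pi μ‖ ≤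
      12 * m ^ 4 * coef d dt q ^ 2 := by
  set G := modelGreen d dt A s with hGdef
  set c := coef d dt q with hc
  set k : Fin N ⊕ Fin n := Sum.inl q.1 with hk
  set l : Fin N ⊕ Fin n := Sum.inr q.2 with hl
  have bG : ∀ x u v, ‖G x u v‖ ≤ m := fun x u v =>
    (norm_entry_le _ _ _).trans ((norm_modelGreen_le hs x).trans hG)
  have bP : ∀ x u v, ‖(G x * B) u v‖ ≤ m := fun x u v => (norm_entry_le _ _ _).trans (hGB x)
  have tU := fun u v => tame_modelGreen (d := d) (dt := dt) (A := A) hs q u v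
  have tV := fun u v => tame_modelGreen_mul (d := d) (dt := dt) (A := A) hs B q u v
  have cG := fun u v => continuous_modelGreen_entry (d := d) (dt := dt) (A := A) hs u v
  have cP := fun u v => continuous_modelGreen_mul_entry (d := d) (dt := dt) (A := A) hs B u v
  have hF : Integrable (fun x => G x u u * (G x * B) v v -
      G (Function.update x q 0) u u * (G (Function.update x q 0) * B) v v) (Measure.pi μ) := by
    refine integrable_of_bounded (C := m * m + m * m) (Continuous.aestronglyMeasurable
      (((cG u u).mul (cP v v)).sub ((tU u u).cont.mul (tV v v).cont))) fun x => ?_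
    refine (norm_sub_le _ _).trans ?_
    rw [norm_mul, norm_mul]
    have := bG x u u
    gcongr <;> first | exact bG _ _ _ | exact bP _ _ _
  -- The first-order terms vanish on average, and the whole second-order remainder is put into the
  -- constant g. Hence h = 0 and no fourth moment is spent.
  have h := norm_integral_add_le hν (C₄ := 0) le_rfl hF
    (a := fun x => (-Complex.I * c) * (G (Function.update x q 0) u k *
      G (Function.update x q 0) l u * (G (Function.update x q 0) * B) v v +
        G (Function.update x q 0) u u * (G (Function.update x q 0) v k *
          (G (Function.update x q 0) * B) l v)))
    (b := fun x => (-Complex.I * c) * (G (Function.update x q 0) u l *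
      G (Function.update x q 0) k u * (G (Function.update x q 0) * B) v v +
        G (Function.update x q 0) u u * (G (Function.update x q 0) v l *
          (G (Function.update x q 0) * B) k v)))
    (h := fun _ => 0) (g := fun _ => 12 * m ^ 4 * c ^ 2)
    ((Tame.const _).mul ((((tU u k).mul (tU l u)).mul (tV v v)).add
      ((tU u u).mul ((tU v k).mul (tV l v)))))
    ((Tame.const _).mul ((((tU u l).mul (tU k u)).mul (tV v v)).add
      ((tU u u).mul ((tU v l).mul (tV k v)))))
    (Tame.const 0) (Tame.const _) ?_
  · simpa using h
  intro x
  set U := G (Function.update x q 0) with hU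
  set y : ℂ := c * x q with hy
  have eG := fun u v => modelGreen_entry (d := d) (dt := dt) (A := A) hs x q u v
  have eP := fun u v => modelGreen_mul_entry (d := d) (dt := dt) (A := A) hs x q B u v
  simp only [← hGdef, ← hU, ← hc, ← hk, ← hl, ← hy] at eG eP
  have bU : ∀ u v, ‖U u v‖ ≤ m := fun u v => bG _ u v
  have bV : ∀ u v, ‖(U * B) u v‖ ≤ m := fun u v => bP _ u v
  have dG : ∀ u v, ‖G x u v - U u v‖ ≤ 2 * m ^ 2 * ‖y‖ := fun u v =>
    norm_entry_sub_le (bU u k) (bU u l) (bG x k v) (bG x l v) (eG u v)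
  have dP : ∀ u v, ‖(G x * B) u v - (U * B) u v‖ ≤ 2 * m ^ 2 * ‖y‖ := fun u v =>
    norm_entry_sub_le (bU u k) (bU u l) (bP x k v) (bP x l v) (eP u v)
  have hrem : ∀ {U₁ U₂ e₁ e₂ : ℂ}, ‖U₁‖ ≤ m → ‖U₂‖ ≤ m → ‖e₁‖ ≤ 2 * m ^ 2 * ‖y‖ →
      ‖e₂‖ ≤ 2 * m ^ 2 * ‖y‖ →
      ‖-Complex.I * (y * U₁ * e₁ + conj y * U₂ * e₂)‖ ≤ 4 * m ^ 3 * ‖y‖ ^ 2 := by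
    intro U₁ U₂ e₁ e₂ h1 h2 h3 h4
    rw [norm_mul, norm_neg, Complex.norm_I, one_mul]
    refine (norm_add_le _ _).trans ?_
    simp only [norm_mul, Complex.norm_conj]
    calc ‖y‖ * ‖U₁‖ * ‖e₁‖ + ‖y‖ * ‖U₂‖ * ‖e₂‖
        ≤ ‖y‖ * m * (2 * m ^ 2 * ‖y‖) + ‖y‖ * m * (2 * m ^ 2 * ‖y‖) := by gcongr
      _ = _ := by ring
  have hmain := norm_mul_expansion_le (g := G x u u) (u := U u u)
    (a := -Complex.I * (y * U u k * U l u + conj y * U u l * U k u))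
    (r := -Complex.I * (y * U u k * (G x l u - U l u) + conj y * U u l * (G x k u - U k u)))
    (p := (G x * B) v v) (v := (U * B) v v)
    (b := -Complex.I * (y * U v k * (U * B) l v + conj y * U v l * (U * B) k v))
    (q := -Complex.I * (y * U v k * ((G x * B) l v - (U * B) l v) +
      conj y * U v l * ((G x * B) k v - (U * B) k v)))
    (t := ‖y‖) (bV v v) (bU u u) hm (by linear_combination eG u u) (by linear_combination eP v v)
    (dG u u) (dP v v) (hrem (bU _ _) (bU _ _) (dG _ _) (dG _ _))
    (hrem (bU _ _) (bU _ _) (dP _ _) (dP _ _))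
  have hyc : conj y = c * conj (x q) := by
    rw [hy, map_mul, Complex.conj_ofReal]
  have hny : ‖y‖ = c * ‖x q‖ := norm_coef_mul x q
  rw [hny, hyc, hy] at hmain
  calc _ = _ := by congr 1; ring
    _ ≤ _ := hmain
    _ = _ := by ring

/-- Second-order expansion of the contribution of one pair of entries. -/
lemma norm_integral_entry_le (hs : 0 < s.re) (hm : 1 ≤ m) (hG : 1 / s.re ≤ m)
    (hGB : ∀ x, ‖modelGreen d dt A s x * B‖ ≤ m) (q : Fin N × Fin n)
    (hν : IsStandard (μ q) K) :
    ‖∫ x, (coef d dt q * x q * (modelGreen d dt A s x * B) (Sum.inr q.2) (Sum.inl q.1) +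
        conj (coef d dt q * x q) * (modelGreen d dt A s x * B) (Sum.inl q.1) (Sum.inr q.2))
          ∂Measure.pi μ +
      Complex.I * coef d dt q ^ 2 * ∫ x,
        (modelGreen d dt A s x (Sum.inr q.2) (Sum.inr q.2) *
            (modelGreen d dt A s x * B) (Sum.inl q.1) (Sum.inl q.1) +
          modelGreen d dt A s x (Sum.inl q.1) (Sum.inl q.1) *
            (modelGreen d dt A s x * B) (Sum.inr q.2) (Sum.inr q.2)) ∂Measure.pi μ‖ ≤
      m ^ 4 * coef d dt q ^ 4 * (8 * K + 152) + 8 * coef d dt q ^ 2 *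
        ∫ x, (‖modelGreen d dt A s x (Sum.inl q.1) (Sum.inr q.2)‖ ^ 2 +
          ‖modelGreen d dt A s x (Sum.inr q.2) (Sum.inl q.1)‖ ^ 2 +
          ‖(modelGreen d dt A s x * B) (Sum.inl q.1) (Sum.inr q.2)‖ ^ 2 +
          ‖(modelGreen d dt A s x * B) (Sum.inr q.2) (Sum.inl q.1)‖ ^ 2) ∂Measure.pi μ := by
  have hB1 := fun u v => norm_integral_diag_mul_diag_sub_le (A := A) (μ := μ) hs hm hG hGB q hν u v
  set G := modelGreen d dt A s with hGdef
  set c := coef d dt q with hc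
  have hc0 : 0 ≤ c := coef_nonneg q
  set k : Fin N ⊕ Fin n := Sum.inl q.1 with hk
  set l : Fin N ⊕ Fin n := Sum.inr q.2 with hl
  have bG : ∀ x u v, ‖G x u v‖ ≤ m := fun x u v =>
    (norm_entry_le _ _ _).trans ((norm_modelGreen_le hs x).trans hG)
  have bP : ∀ x u v, ‖(G x * B) u v‖ ≤ m := fun x u v => (norm_entry_le _ _ _).trans (hGB x)
  have tU : ∀ u v, Tame (fun x => G (Function.update x q 0) u v) q :=
    fun u v => tame_modelGreen hs q u v
  have tV : ∀ u v, Tame (fun x => (G (Function.update x q 0) * B) u v) q :=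
    fun u v => tame_modelGreen_mul hs B q u v
  have cG : ∀ u v, Continuous fun x => G x u v := fun u v => continuous_modelGreen_entry hs u v
  have cP : ∀ u v, Continuous fun x => (G x * B) u v :=
    fun u v => continuous_modelGreen_mul_entry hs B u v
  have hev := measurePreserving_eval μ q
  have hm0 : 0 ≤ m := by linarith
  have iF : Integrable (fun x => c * x q * (G x * B) l k + conj (c * x q) * (G x * B) k l)
      (Measure.pi μ) := by
    have i1 : Integrable (fun x : Fin N × Fin n → ℂ => (c : ℂ) * x q) (Measure.pi μ) :=
      (hev.integrable_comp_of_integrable hν.integrable).const_mul _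
    have i2 : Integrable (fun x : Fin N × Fin n → ℂ => conj (c * x q)) (Measure.pi μ) :=
      (Complex.conjCLE : ℂ →L[ℝ] ℂ).integrable_comp i1
    exact (i1.mul_bdd (cP l k).aestronglyMeasurable (Filter.Eventually.of_forall
      fun x => bP x l k)).add (i2.mul_bdd (cP k l).aestronglyMeasurable
        (Filter.Eventually.of_forall fun x => bP x k l))
  -- Here h carries the surviving second-order term i c² (U_ll V_kk + U_kk V_ll), where U is G with
  -- x_q set to 0 and V = U B.
  have hA := norm_integral_add_le hν (C₄ := 8 * m ^ 4 * c ^ 4) (by positivity) iF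
    (a := fun x => c * (G (Function.update x q 0) * B) l k)
    (b := fun x => c * (G (Function.update x q 0) * B) k l)
    (h := fun x => (Complex.I * c ^ 2) * (G (Function.update x q 0) l l *
      (G (Function.update x q 0) * B) k k + G (Function.update x q 0) k k *
      (G (Function.update x q 0) * B) l l))
    (g := fun x => 4 * c ^ 2 * (‖G (Function.update x q 0) k l‖ ^ 2 +
      ‖G (Function.update x q 0) l k‖ ^ 2 + ‖(G (Function.update x q 0) * B) k l‖ ^ 2 +
      ‖(G (Function.update x q 0) * B) l k‖ ^ 2))
    ((Tame.const _).mul (tV l k)) ((Tame.const _).mul (tV k l))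
    ((Tame.const _).mul (((tU l l).mul (tV k k)).add ((tU k k).mul (tV l l))))
    (by
      have h := (Tame.const (q := q) ((4 * c ^ 2 : ℝ) : ℂ)).mul
        ((((tU k l).norm_sq.add (tU l k).norm_sq).add (tV k l).norm_sq).add (tV l k).norm_sq)
      simpa using h) ?_
  swap
  · intro x
    set U := G (Function.update x q 0) with hU
    set y : ℂ := c * x q with hy
    have eP := fun u v => modelGreen_mul_entry (d := d) (dt := dt) (A := A) hs x q B u v
    simp only [← hGdef, ← hU, ← hc, ← hk, ← hl, ← hy] at eP
    have bU : ∀ u v, ‖U u v‖ ≤ m := fun u v => bG _ u v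
    have h1 := norm_expansion_le hm (bU k k) (bU l k) (bU l l) (bP x k k) (bP x l k)
      (eP k k) (eP l k)
    -- The conjugate term is the same expansion with k and l exchanged and y replaced by its
    -- conjugate.
    have h2 := norm_expansion_le (y := conj y) hm (bU l l) (bU k l) (bU k k) (bP x l l) (bP x k l)
      (by rw [Complex.conj_conj, add_comm]; exact eP l l)
      (by rw [Complex.conj_conj, add_comm]; exact eP k l)
    rw [Complex.conj_conj, Complex.norm_conj] at h2
    have hyc : conj y = c * conj (x q) := by
      rw [hy, map_mul, Complex.conj_ofReal]
    have hny : ‖y‖ = c * ‖x q‖ := norm_coef_mul x q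
    have hyy : y * conj y = c ^ 2 * (‖x q‖ ^ 2 : ℝ) := by
      rw [Complex.mul_conj', hny]; push_cast; ring
    have h3 := (norm_add_le _ _).trans (add_le_add h1 h2)
    calc _ = ‖(y * (G x * B) l k - y * (U * B) l k + Complex.I * (y * conj y) *
          (U l l * (U * B) k k)) + (conj y * (G x * B) k l - conj y * (U * B) k l +
            Complex.I * (conj y * y) * (U k k * (U * B) l l))‖ := by
          congr 1
          rw [mul_comm (conj y) y, hyy, hyc, hy]
          ring
      _ ≤ _ := h3
      _ ≤ _ := by
          rw [hny]
          have h4 : 0 ≤ (c * ‖x q‖) ^ 2 * (‖(U * B) k l‖ ^ 2 + ‖(U * B) l k‖ ^ 2) := by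
            positivity
          nlinarith [h4]
  -- comparison with the unmodified entries
  have hS : ∫ x, 4 * c ^ 2 * (‖G (Function.update x q 0) k l‖ ^ 2 +
      ‖G (Function.update x q 0) l k‖ ^ 2 + ‖(G (Function.update x q 0) * B) k l‖ ^ 2 +
      ‖(G (Function.update x q 0) * B) l k‖ ^ 2) ∂Measure.pi μ ≤
      128 * m ^ 4 * c ^ 4 + 8 * c ^ 2 * ∫ x, (‖G x k l‖ ^ 2 + ‖G x l k‖ ^ 2 +
        ‖(G x * B) k l‖ ^ 2 + ‖(G x * B) l k‖ ^ 2) ∂Measure.pi μ := by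
    have bsq : ∀ {w : ℂ}, ‖w‖ ≤ m → ‖w‖ ^ 2 ≤ m ^ 2 := fun h => by gcongr
    have i1 : Integrable (fun x => ‖G x k l‖ ^ 2 + ‖G x l k‖ ^ 2 +
        ‖(G x * B) k l‖ ^ 2 + ‖(G x * B) l k‖ ^ 2) (Measure.pi μ) := by
      refine integrable_of_bounded (C := 4 * m ^ 2) (Continuous.aestronglyMeasurable
        (((((cG k l).norm.pow 2).add ((cG l k).norm.pow 2)).add ((cP k l).norm.pow 2)).add
          ((cP l k).norm.pow 2))) fun x => ?_
      rw [Real.norm_of_nonneg (by positivity)]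
      linarith [bsq (bG x k l), bsq (bG x l k), bsq (bP x k l), bsq (bP x l k)]
    have i2 : Integrable (fun x => 4 * c ^ 2 * (‖G (Function.update x q 0) k l‖ ^ 2 +
        ‖G (Function.update x q 0) l k‖ ^ 2 + ‖(G (Function.update x q 0) * B) k l‖ ^ 2 +
        ‖(G (Function.update x q 0) * B) l k‖ ^ 2)) (Measure.pi μ) := by
      refine integrable_of_bounded (C := 4 * c ^ 2 * (4 * m ^ 2)) (Continuous.aestronglyMeasurable
        (continuous_const.mul ((((((tU k l).cont.norm.pow 2).add ((tU l k).cont.norm.pow 2)).add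
          ((tV k l).cont.norm.pow 2)).add ((tV l k).cont.norm.pow 2))))) fun x => ?_
      rw [Real.norm_of_nonneg (by positivity)]
      gcongr
      linarith [bsq (bG (Function.update x q 0) k l), bsq (bG (Function.update x q 0) l k),
        bsq (bP (Function.update x q 0) k l), bsq (bP (Function.update x q 0) l k)]
    have i3 : Integrable (fun x : Fin N × Fin n → ℂ => ‖x q‖ ^ 2) (Measure.pi μ) :=
      hev.integrable_comp_of_integrable hν.integrable_sq
    have v3 : ∫ x : Fin N × Fin n → ℂ, ‖x q‖ ^ 2 ∂Measure.pi μ = 1 := by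
      rw [← hν.variance]
      conv_rhs => rw [← hev.map_eq]
      rw [integral_map hev.measurable.aemeasurable (by fun_prop)]
    calc _ ≤ ∫ x : Fin N × Fin n → ℂ, (128 * m ^ 4 * c ^ 4 * ‖x q‖ ^ 2 + 8 * c ^ 2 *
          (‖G x k l‖ ^ 2 + ‖G x l k‖ ^ 2 + ‖(G x * B) k l‖ ^ 2 + ‖(G x * B) l k‖ ^ 2))
            ∂Measure.pi μ := by
          refine integral_mono i2 ((i3.const_mul _).add (i1.const_mul _)) fun x => ?_
          set U := G (Function.update x q 0) with hU
          have eG := fun u v => modelGreen_entry (d := d) (dt := dt) (A := A) hs x q u v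
          have eP := fun u v => modelGreen_mul_entry (d := d) (dt := dt) (A := A) hs x q B u v
          simp only [← hGdef, ← hU, ← hc, ← hk, ← hl] at eG eP
          have bU : ∀ u v, ‖U u v‖ ≤ m := fun u v => bG _ u v
          have hny : ‖(c : ℂ) * x q‖ = c * ‖x q‖ := norm_coef_mul x q
          have hgen : ∀ {g u : ℂ}, ‖g - u‖ ≤ 2 * m ^ 2 * ‖(c : ℂ) * x q‖ →
              ‖u‖ ^ 2 ≤ 2 * ‖g‖ ^ 2 + 8 * m ^ 4 * c ^ 2 * ‖x q‖ ^ 2 := by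
            intro g u h
            rw [hny] at h
            have h1 : ‖u‖ ≤ ‖g‖ + 2 * m ^ 2 * (c * ‖x q‖) := by
              have := norm_sub_norm_le u g
              rw [norm_sub_rev] at this
              linarith
            calc ‖u‖ ^ 2 ≤ (‖g‖ + 2 * m ^ 2 * (c * ‖x q‖)) ^ 2 := by gcongr
              _ ≤ 2 * (‖g‖ ^ 2 + (2 * m ^ 2 * (c * ‖x q‖)) ^ 2) := add_sq_le
              _ = _ := by ring
          have h1 := hgen (norm_entry_sub_le (bU k k) (bU k l) (bG x k l) (bG x l l) (eG k l))
          have h2 := hgen (norm_entry_sub_le (bU l k) (bU l l) (bG x k k) (bG x l k) (eG l k))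
          have h3 := hgen (norm_entry_sub_le (bU k k) (bU k l) (bP x k l) (bP x l l) (eP k l))
          have h4 := hgen (norm_entry_sub_le (bU l k) (bU l l) (bP x k k) (bP x l k) (eP l k))
          calc 4 * c ^ 2 * (‖U k l‖ ^ 2 + ‖U l k‖ ^ 2 + ‖(U * B) k l‖ ^ 2 + ‖(U * B) l k‖ ^ 2)
              ≤ 4 * c ^ 2 * ((2 * ‖G x k l‖ ^ 2 + 8 * m ^ 4 * c ^ 2 * ‖x q‖ ^ 2) +
                (2 * ‖G x l k‖ ^ 2 + 8 * m ^ 4 * c ^ 2 * ‖x q‖ ^ 2) +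
                (2 * ‖(G x * B) k l‖ ^ 2 + 8 * m ^ 4 * c ^ 2 * ‖x q‖ ^ 2) +
                (2 * ‖(G x * B) l k‖ ^ 2 + 8 * m ^ 4 * c ^ 2 * ‖x q‖ ^ 2)) := by gcongr
            _ = _ := by ring
      _ = _ := by
          rw [integral_add (i3.const_mul _) (i1.const_mul _), integral_const_mul,
            integral_const_mul, v3, mul_one]
  have iGP : ∀ u v, Integrable (fun x => G x u u * (G x * B) v v) (Measure.pi μ) := fun u v =>
    integrable_of_bounded (C := m * m) ((cG u u).mul (cP v v)).aestronglyMeasurable fun x => by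
      rw [norm_mul]; gcongr; exacts [bG _ _ _, bP _ _ _]
  have iUV : ∀ u v, Integrable (fun x => G (Function.update x q 0) u u *
      (G (Function.update x q 0) * B) v v) (Measure.pi μ) := fun u v =>
    integrable_of_bounded (C := m * m)
      ((tU u u).cont.mul (tV v v).cont).aestronglyMeasurable fun x => by
      rw [norm_mul]; gcongr; exacts [bG _ _ _, bP _ _ _]
  have hB2 := hB1 l k
  have hB3 := hB1 k l
  rw [integral_sub (iGP _ _) (iUV _ _)] at hB2 hB3
  rw [integral_const_mul, integral_add (iUV l k) (iUV k l)] at hA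
  rw [integral_add (iGP l k) (iGP k l)]
  set EF := ∫ x, (c * x q * (G x * B) l k + conj (c * x q) * (G x * B) k l) ∂Measure.pi μ
  set g₁ := ∫ x, G x l l * (G x * B) k k ∂Measure.pi μ
  set g₂ := ∫ x, G x k k * (G x * B) l l ∂Measure.pi μ
  set u₁ := ∫ x, G (Function.update x q 0) l l * (G (Function.update x q 0) * B) k k ∂Measure.pi μ
  set u₂ := ∫ x, G (Function.update x q 0) k k * (G (Function.update x q 0) * B) l l ∂Measure.pi μ
  have hcn : ‖Complex.I * (c : ℂ) ^ 2‖ = c ^ 2 := by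
    rw [norm_mul, Complex.norm_I, one_mul, norm_pow, Complex.norm_real, Real.norm_of_nonneg hc0]
  calc ‖EF + Complex.I * c ^ 2 * (g₁ + g₂)‖
      = ‖(EF + Complex.I * c ^ 2 * (u₁ + u₂)) + Complex.I * c ^ 2 * (g₁ - u₁) +
          Complex.I * c ^ 2 * (g₂ - u₂)‖ := by congr 1; ring
    _ ≤ ‖EF + Complex.I * c ^ 2 * (u₁ + u₂)‖ + ‖Complex.I * c ^ 2 * (g₁ - u₁)‖ +
          ‖Complex.I * c ^ 2 * (g₂ - u₂)‖ := norm_add₃_le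
    _ ≤ ‖EF + Complex.I * c ^ 2 * (u₁ + u₂)‖ + c ^ 2 * (12 * m ^ 4 * c ^ 2) +
          c ^ 2 * (12 * m ^ 4 * c ^ 2) := by
        rw [norm_mul _ (g₁ - u₁), norm_mul _ (g₂ - u₂), hcn]
        gcongr
    -- The constant 152 is 128, from restoring x_q in the four off-diagonal squares, plus twice 12,
    -- from restoring it in the two products of diagonal entries.
    _ ≤ _ := by
        have := hA.trans (add_le_add le_rfl hS)
        linarith

end Model


/-! ### Sums of variances and concentration of traces -/

section ErrorBound

open ComplexConjugate

variable {N n : ℕ} {d : Fin N → ℝ} {dt : Fin n → ℝ} {A : Matrix (Fin N) (Fin n) ℂ} {s : ℂ}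
  {B : Matrix (Fin N ⊕ Fin n) (Fin N ⊕ Fin n) ℂ} {m L K : ℝ}
  {μ : Fin N × Fin n → Measure ℂ} [∀ q, IsProbabilityMeasure (μ q)]

lemma coef_sq_le (hd : ∀ i, 0 ≤ d i) (hdt : ∀ j, 0 ≤ dt j) (hdL : ∀ i, d i ≤ L)
    (hdtL : ∀ j, dt j ≤ L) (q : Fin N × Fin n) : coef d dt q ^ 2 ≤ L ^ 2 / n := by
  rw [coef_sq hd hdt]
  have h1 := hd q.1
  have h2 := hdt q.2
  have h3 := hdL q.1
  have h4 := hdtL q.2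
  gcongr
  calc d q.1 * dt q.2 ≤ L * L := by gcongr; linarith
    _ = _ := by ring

lemma sum_coef_sq_le (hn : 1 ≤ n) (hd : ∀ i, 0 ≤ d i) (hdt : ∀ j, 0 ≤ dt j)
    (hdL : ∀ i, d i ≤ L) (hdtL : ∀ j, dt j ≤ L) (hN : (N : ℝ) ≤ L * n) :
    ∑ q, coef d dt q ^ 2 ≤ L ^ 3 * n := by
  have hn0 : (0 : ℝ) < n := by exact_mod_cast hn
  calc ∑ q, coef d dt q ^ 2 ≤ ∑ _q : Fin N × Fin n, L ^ 2 / n :=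
        Finset.sum_le_sum fun q _ => coef_sq_le hd hdt hdL hdtL q
    _ = N * L ^ 2 := by
        rw [Finset.sum_const, Finset.card_univ, Fintype.card_prod, Fintype.card_fin,
          Fintype.card_fin, nsmul_eq_mul]
        push_cast
        field_simp
    _ ≤ (L * n) * L ^ 2 := by gcongr
    _ = _ := by ring

/-- There are about n² entries, each contributing O(1/n²): fourth-moment remainders sum to O(1). -/
lemma sum_coef_four_le (hn : 1 ≤ n) (hL : 1 ≤ L) (hd : ∀ i, 0 ≤ d i) (hdt : ∀ j, 0 ≤ dt j)
    (hdL : ∀ i, d i ≤ L) (hdtL : ∀ j, dt j ≤ L) (hN : (N : ℝ) ≤ L * n) :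
    ∑ q, coef d dt q ^ 4 ≤ L ^ 5 := by
  have hn0 : (0 : ℝ) < n := by exact_mod_cast hn
  calc ∑ q, coef d dt q ^ 4 ≤ ∑ q, L ^ 2 / n * coef d dt q ^ 2 := by
        refine Finset.sum_le_sum fun q _ => ?_
        calc coef d dt q ^ 4 = coef d dt q ^ 2 * coef d dt q ^ 2 := by ring
          _ ≤ _ := by
            gcongr
            exact coef_sq_le hd hdt hdL hdtL q
    _ = L ^ 2 / n * ∑ q, coef d dt q ^ 2 := by rw [Finset.mul_sum]
    _ ≤ L ^ 2 / n * (L ^ 3 * n) := by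
        gcongr
        exact sum_coef_sq_le hn hd hdt hdL hdtL hN
    _ = _ := by field_simp

lemma integral_norm_eval_sq {q : Fin N × Fin n} (hν : IsStandard (μ q) K) :
    ∫ x : Fin N × Fin n → ℂ, ‖x q‖ ^ 2 ∂Measure.pi μ = 1 := by
  have hev := measurePreserving_eval μ q
  rw [← hν.variance]
  conv_rhs => rw [← hev.map_eq]
  rw [integral_map hev.measurable.aemeasurable (by fun_prop)]

/-- Cauchy-Schwarz between one column of M and one row of M', both controlled by the operator norm.
The bound does not grow with the dimension, which is what keeps the variance of unnormalised traces
of order n. -/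
lemma norm_sum_mul_mul_le {ι : Type*} [Fintype ι] [DecidableEq ι] {e : ι → ℝ} (he : ∀ k, 0 ≤ e k)
    (heL : ∀ k, e k ≤ L) (hL : 0 ≤ L) {M M' : Matrix ι ι ℂ} (hM : ‖M‖ ≤ m) (hM' : ‖M'‖ ≤ m)
    (a b : ι) : ‖∑ k, (e k : ℂ) * (M k a * M' b k)‖ ≤ L * m ^ 2 := by
  have hm : 0 ≤ m := (norm_nonneg _).trans hM
  calc ‖∑ k, (e k : ℂ) * (M k a * M' b k)‖ ≤ ∑ k, L * (‖M k a‖ * ‖M' b k‖) := by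
        refine (norm_sum_le _ _).trans (Finset.sum_le_sum fun k _ => ?_)
        rw [norm_mul, norm_mul, Complex.norm_real, Real.norm_of_nonneg (he k)]
        gcongr
        exact heL k
    _ = L * ∑ k, ‖M k a‖ * ‖M' b k‖ := by rw [Finset.mul_sum]
    _ ≤ L * (√(∑ k, ‖M k a‖ ^ 2) * √(∑ k, ‖M' b k‖ ^ 2)) := by
        gcongr
        exact Real.sum_mul_le_sqrt_mul_sqrt _ _ _
    _ ≤ L * (m * m) := by
        gcongr
        · rw [Real.sqrt_le_left hm]
          exact (sum_norm_sq_col_le M a).trans (by gcongr)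
        · rw [Real.sqrt_le_left hm]
          exact (sum_norm_sq_row_le M' b).trans (by gcongr)
    _ = _ := by ring

/-- Concentration of linear statistics of the resolvent. -/
lemma variance_trace_le (hs : 0 < s.re) (hL : 0 ≤ L) (hG : 1 / s.re ≤ m)
    (hGB : ∀ x, ‖modelGreen d dt A s x * B‖ ≤ m) (hν : ∀ q, IsStandard (μ q) K)
    {e : Fin N ⊕ Fin n → ℝ} (he : ∀ k, 0 ≤ e k) (heL : ∀ k, e k ≤ L) :
    ∫ x, ‖∑ k, (e k : ℂ) * (modelGreen d dt A s x * B) k k -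
      ∫ x', ∑ k, (e k : ℂ) * (modelGreen d dt A s x' * B) k k ∂Measure.pi μ‖ ^ 2 ∂Measure.pi μ ≤
      4 * L ^ 2 * m ^ 4 * ∑ q, coef d dt q ^ 2 := by
  have hm : 0 ≤ m := (norm_nonneg _).trans (hGB 0)
  set F : (Fin N × Fin n → ℂ) → ℂ := fun x => ∑ k, (e k : ℂ) * (modelGreen d dt A s x * B) k k
    with hFdef
  have hFc : Continuous F := continuous_finsetSum _ fun k _ =>
    continuous_const.mul (continuous_modelGreen_mul_entry hs B k k)
  have hFb : ∀ x, ‖F x‖ ≤ ∑ _k : Fin N ⊕ Fin n, L * m := fun x => by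
    refine (norm_sum_le _ _).trans (Finset.sum_le_sum fun k _ => ?_)
    rw [norm_mul, Complex.norm_real, Real.norm_of_nonneg (he k)]
    gcongr
    exacts [heL k, (norm_entry_le _ _ _).trans (hGB x)]
  -- The comparison function for the coordinate q is F with x_q reset to 0, so that each increment
  -- is a rank-two perturbation.
  have hES := efronStein (μ := μ) (F := F) hFc.measurable hFb
    (g := fun q x => F (Function.update x q 0)) (fun q x t => by simp)
    (fun q => (hFc.comp (continuous_id.update q continuous_const)).measurable)
    (fun q x => hFb _)
  refine hES.trans ?_
  rw [Finset.mul_sum]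
  refine Finset.sum_le_sum fun q _ => ?_
  have hev := measurePreserving_eval μ q
  have i3 : Integrable (fun x : Fin N × Fin n → ℂ => ‖x q‖ ^ 2) (Measure.pi μ) :=
    hev.integrable_comp_of_integrable (hν q).integrable_sq
  have hpt : ∀ x, ‖F x - F (Function.update x q 0)‖ ^ 2 ≤
      4 * L ^ 2 * m ^ 4 * coef d dt q ^ 2 * ‖x q‖ ^ 2 := by
    intro x
    set U := modelGreen d dt A s (Function.update x q 0) with hU
    set P := modelGreen d dt A s x * B with hP
    set y : ℂ := coef d dt q * x q with hy
    have hUm : ‖U‖ ≤ m := (norm_modelGreen_le hs _).trans hG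
    have e1 : F x - F (Function.update x q 0) = -(Complex.I *
        (y * ∑ k, (e k : ℂ) * (U k (Sum.inl q.1) * P (Sum.inr q.2) k) +
          conj y * ∑ k, (e k : ℂ) * (U k (Sum.inr q.2) * P (Sum.inl q.1) k))) := by
      simp only [hFdef]
      rw [← Finset.sum_sub_distrib, Finset.mul_sum, Finset.mul_sum, ← Finset.sum_add_distrib,
        Finset.mul_sum, ← Finset.sum_neg_distrib]
      refine Finset.sum_congr rfl fun k _ => ?_
      have h := modelGreen_mul_entry (d := d) (dt := dt) (A := A) hs x q B k k
      rw [← hU, ← hP, ← hy] at h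
      linear_combination (e k : ℂ) * h
    have h1 := norm_sum_mul_mul_le he heL hL hUm (hGB x) (Sum.inl q.1) (Sum.inr q.2)
    have h2 := norm_sum_mul_mul_le he heL hL hUm (hGB x) (Sum.inr q.2) (Sum.inl q.1)
    have h3 : ‖F x - F (Function.update x q 0)‖ ≤ 2 * L * m ^ 2 * ‖y‖ := by
      rw [e1, norm_neg, norm_mul, Complex.norm_I, one_mul]
      refine (norm_add_le _ _).trans ?_
      rw [norm_mul y, norm_mul (conj y), Complex.norm_conj]
      calc _ ≤ ‖y‖ * (L * m ^ 2) + ‖y‖ * (L * m ^ 2) := by gcongr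
        _ = _ := by ring
    have hny : ‖y‖ = coef d dt q * ‖x q‖ := norm_coef_mul x q
    rw [hny] at h3
    calc _ ≤ (2 * L * m ^ 2 * (coef d dt q * ‖x q‖)) ^ 2 := by gcongr
      _ = _ := by ring
  calc _ ≤ ∫ x : Fin N × Fin n → ℂ, 4 * L ^ 2 * m ^ 4 * coef d dt q ^ 2 * ‖x q‖ ^ 2
        ∂Measure.pi μ :=
        integral_mono_of_nonneg (Filter.Eventually.of_forall fun x => by positivity)
          (i3.const_mul _) (Filter.Eventually.of_forall hpt)
    _ = _ := by rw [integral_const_mul, integral_norm_eval_sq (hν q), mul_one]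

/-- The covariance is the mean of the product of the centred variables, bounded by half the sum of
their squares. -/
lemma norm_covariance_le {Ω : Type*} [MeasurableSpace Ω] {P : Measure Ω} [IsProbabilityMeasure P]
    {F F' : Ω → ℂ} {C C' V : ℝ} (hF : AEStronglyMeasurable F P) (hF' : AEStronglyMeasurable F' P)
    (hC : ∀ x, ‖F x‖ ≤ C) (hC' : ∀ x, ‖F' x‖ ≤ C')
    (hV : ∫ x, ‖F x - ∫ y, F y ∂P‖ ^ 2 ∂P ≤ V) (hV' : ∫ x, ‖F' x - ∫ y, F' y ∂P‖ ^ 2 ∂P ≤ V) :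
    ‖(∫ x, F x ∂P) * (∫ x, F' x ∂P) - ∫ x, F x * F' x ∂P‖ ≤ V := by
  set f := ∫ x, F x ∂P
  set f' := ∫ x, F' x ∂P
  have iF : Integrable F P := integrable_of_bounded hF hC
  have iF' : Integrable F' P := integrable_of_bounded hF' hC'
  have iFF' : Integrable (fun x => F x * F' x) P :=
    iF.mul_bdd hF' (Filter.Eventually.of_forall hC')
  have i1 : Integrable (fun x => ‖F x - f‖ ^ 2) P := by
    refine integrable_of_bounded (C := (C + ‖f‖) ^ 2)
      ((hF.sub aestronglyMeasurable_const).norm.pow 2) fun x => ?_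
    rw [norm_pow, norm_norm]
    gcongr
    exact (norm_sub_le _ _).trans (add_le_add (hC x) le_rfl)
  have i2 : Integrable (fun x => ‖F' x - f'‖ ^ 2) P := by
    refine integrable_of_bounded (C := (C' + ‖f'‖) ^ 2)
      ((hF'.sub aestronglyMeasurable_const).norm.pow 2) fun x => ?_
    rw [norm_pow, norm_norm]
    gcongr
    exact (norm_sub_le _ _).trans (add_le_add (hC' x) le_rfl)
  have e : f * f' - ∫ x, F x * F' x ∂P = -∫ x, (F x - f) * (F' x - f') ∂P := by
    have e1 : ∀ x, (F x - f) * (F' x - f') = F x * F' x - f' * F x - f * F' x + f * f' :=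
      fun x => by ring
    simp_rw [e1]
    have j1 : Integrable (fun x => F x * F' x - f' * F x) P := iFF'.sub (iF.const_mul f')
    have j2 : Integrable (fun x => F x * F' x - f' * F x - f * F' x) P :=
      j1.sub (iF'.const_mul f)
    rw [integral_add j2 (integrable_const _), integral_sub j1 (iF'.const_mul f),
      integral_sub iFF' (iF.const_mul f'), integral_const_mul, integral_const_mul]
    simp only [integral_const, probReal_univ, one_smul]
    ring
  rw [e, norm_neg]
  calc _ ≤ ∫ x, (‖F x - f‖ ^ 2 / 2 + ‖F' x - f'‖ ^ 2 / 2) ∂P := by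
        refine norm_integral_le_of_norm_le ((i1.div_const 2).add (i2.div_const 2))
          (Filter.Eventually.of_forall fun x => ?_)
        rw [norm_mul]
        nlinarith [sq_nonneg (‖F x - f‖ - ‖F' x - f'‖)]
    _ = (∫ x, ‖F x - f‖ ^ 2 ∂P) / 2 + (∫ x, ‖F' x - f'‖ ^ 2 ∂P) / 2 := by
        rw [integral_add (i1.div_const 2) (i2.div_const 2), integral_div, integral_div]
    _ ≤ V := by linarith

end ErrorBound


/-! ### Weighted traces and the resolvent identity -/

section TraceError

open ComplexConjugate

variable {N n : ℕ} {d : Fin N → ℝ} {dt : Fin n → ℝ} {A : Matrix (Fin N) (Fin n) ℂ} {s : ℂ}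

/-- The weights `d` on the first block. -/
def weightL (n : ℕ) (d : Fin N → ℝ) : Fin N ⊕ Fin n → ℝ := Sum.elim d 0

/-- The weights `dt` on the second block. -/
def weightR (N : ℕ) (dt : Fin n → ℝ) : Fin N ⊕ Fin n → ℝ := Sum.elim 0 dt

lemma sum_weightL_mul (f : Fin N ⊕ Fin n → ℂ) :
    ∑ k, (weightL n d k : ℂ) * f k = ∑ i, (d i : ℂ) * f (Sum.inl i) := by
  simp [weightL, Fintype.sum_sum_type]

lemma sum_weightR_mul (f : Fin N ⊕ Fin n → ℂ) :
    ∑ k, (weightR N dt k : ℂ) * f k = ∑ j, (dt j : ℂ) * f (Sum.inr j) := by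
  simp [weightR, Fintype.sum_sum_type]

lemma profile_eq (p q : ℂ) (k : Fin N ⊕ Fin n) :
    profile d dt p q k = q * weightL n d k + p * weightR N dt k := by
  rcases k with i | j <;> simp [profile, weightL, weightR]

lemma trace_hermitize_sub (x : Fin N × Fin n → ℂ) (M : Matrix (Fin N ⊕ Fin n) (Fin N ⊕ Fin n) ℂ) :
    ((hermitize (model d dt A x) - hermitize A) * M).trace =
      ∑ q : Fin N × Fin n, (coef d dt q * x q * M (Sum.inr q.2) (Sum.inl q.1) +
        conj (coef d dt q * x q) * M (Sum.inl q.1) (Sum.inr q.2)) := by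
  rw [trace]
  simp only [diag_apply, mul_apply, Fintype.sum_sum_type, Matrix.sub_apply, hermitize,
    fromBlocks_apply₁₁, fromBlocks_apply₁₂, fromBlocks_apply₂₁, fromBlocks_apply₂₂,
    conjTranspose_apply, Matrix.zero_apply, sub_self, zero_mul, Finset.sum_const_zero, zero_add,
    add_zero, ← star_sub]
  rw [Finset.sum_comm (s := (Finset.univ : Finset (Fin n))), ← Finset.sum_add_distrib,
    Fintype.sum_prod_type]
  refine Finset.sum_congr rfl fun i _ => ?_
  rw [← Finset.sum_add_distrib]
  refine Finset.sum_congr rfl fun j _ => ?_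
  simp [model]

/-- The difference of weighted traces, through the resolvent identity. -/
lemma sum_weight_sub (hs : 0 < s.re) {w : Fin N ⊕ Fin n → ℂ} (hw : ∀ k, 0 ≤ (w k).re)
    (e : Fin N ⊕ Fin n → ℝ) (x : Fin N × Fin n → ℂ) :
    ∑ k, (e k : ℂ) * (modelGreen d dt A s x k k - green (hermitize A) s w k k) =
      ∑ k, w k * (modelGreen d dt A s x *
        (diagonal (fun k => (e k : ℂ)) * green (hermitize A) s w)) k k -
      Complex.I * ∑ q : Fin N × Fin n, (coef d dt q * x q * (modelGreen d dt A s x *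
          (diagonal (fun k => (e k : ℂ)) * green (hermitize A) s w)) (Sum.inr q.2) (Sum.inl q.1) +
        conj (coef d dt q * x q) * (modelGreen d dt A s x *
          (diagonal (fun k => (e k : ℂ)) * green (hermitize A) s w))
            (Sum.inl q.1) (Sum.inr q.2)) := by
  have h := green_sub_green (w := w) (w' := 0) (isHermitian_hermitize A)
    (isHermitian_hermitize (model d dt A x)) hs hw (by simp)
  rw [← trace_hermitize_sub]
  set R := green (hermitize A) s w
  change R - modelGreen d dt A s x = R * _ * modelGreen d dt A s x at h
  set G := modelGreen d dt A s x
  set E : Matrix (Fin N ⊕ Fin n) (Fin N ⊕ Fin n) ℂ := diagonal fun k => (e k : ℂ)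
  set Δ := hermitize (model d dt A x) - hermitize A
  have e1 : ∑ k, (e k : ℂ) * (G k k - R k k) = -(E * (R - G)).trace := by
    rw [trace, ← Finset.sum_neg_distrib]
    refine Finset.sum_congr rfl fun k _ => ?_
    simp only [diag_apply, E, diagonal_mul, Matrix.sub_apply]
    ring
  have e2 : ∑ k, w k * (G * (E * R)) k k = (diagonal w * (G * (E * R))).trace := by
    rw [trace]
    exact Finset.sum_congr rfl fun k _ => by rw [diag_apply, diagonal_mul]
  -- Cyclicity of the trace isolates the perturbation, leaving G times the deterministic matrix E R.
  have e3 : (E * (R * (Complex.I • Δ + diagonal (0 - w)) * G)).trace =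
      ((Complex.I • Δ + diagonal (0 - w)) * (G * (E * R))).trace := by
    rw [← Matrix.mul_assoc, ← Matrix.mul_assoc, Matrix.mul_assoc, Matrix.trace_mul_comm,
      Matrix.mul_assoc]
  have e4 : diagonal (0 - w) = -diagonal w := by
    rw [zero_sub]; exact (diagonal_neg w).symm
  rw [e1, h, e3, e2, e4, Matrix.add_mul, trace_add, Matrix.smul_mul, trace_smul, Matrix.neg_mul,
    trace_neg, smul_eq_mul]
  ring

end TraceError


/-! ### Consistency: the mean traces nearly solve the system -/

section TraceErrorBound

open ComplexConjugate

variable {N n : ℕ} {d : Fin N → ℝ} {dt : Fin n → ℝ} {A : Matrix (Fin N) (Fin n) ℂ} {s : ℂ}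
  {L K m : ℝ} {μ : Fin N × Fin n → Measure ℂ} [∀ q, IsProbabilityMeasure (μ q)]
  {B : Matrix (Fin N ⊕ Fin n) (Fin N ⊕ Fin n) ℂ}

lemma weightL_nonneg (hd : ∀ i, 0 ≤ d i) (k : Fin N ⊕ Fin n) : 0 ≤ weightL n d k := by
  rcases k with i | j
  · exact hd i
  · exact le_rfl

lemma weightR_nonneg (hdt : ∀ j, 0 ≤ dt j) (k : Fin N ⊕ Fin n) : 0 ≤ weightR N dt k := by
  rcases k with i | j
  · exact le_rfl
  · exact hdt j

lemma weightL_le (hL : 0 ≤ L) (hd : ∀ i, d i ≤ L) (k : Fin N ⊕ Fin n) : weightL n d k ≤ L := by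
  rcases k with i | j
  · exact hd i
  · exact hL

lemma weightR_le (hL : 0 ≤ L) (hdt : ∀ j, dt j ≤ L) (k : Fin N ⊕ Fin n) :
    weightR N dt k ≤ L := by
  rcases k with i | j
  · exact hL
  · exact hdt j

/-- The variance d_i d̃_j / n is a product, so the double sum factorises into weighted traces. This
is why two scalar unknowns suffice. -/
lemma sum_coef_sq_mul (hd : ∀ i, 0 ≤ d i) (hdt : ∀ j, 0 ≤ dt j) (f g : Fin N ⊕ Fin n → ℂ) :
    ∑ q : Fin N × Fin n, (coef d dt q : ℂ) ^ 2 *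
      (f (Sum.inr q.2) * g (Sum.inl q.1) + f (Sum.inl q.1) * g (Sum.inr q.2)) =
    1 / n * ((∑ k, (weightR N dt k : ℂ) * f k) * (∑ k, (weightL n d k : ℂ) * g k) +
      (∑ k, (weightL n d k : ℂ) * f k) * (∑ k, (weightR N dt k : ℂ) * g k)) := by
  rw [sum_weightL_mul, sum_weightL_mul, sum_weightR_mul, sum_weightR_mul, Finset.sum_mul_sum,
    Finset.sum_mul_sum, Finset.sum_comm, ← Finset.sum_add_distrib, Finset.mul_sum,
    Fintype.sum_prod_type]
  refine Finset.sum_congr rfl fun i _ => ?_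
  rw [← Finset.sum_add_distrib, Finset.mul_sum]
  refine Finset.sum_congr rfl fun j _ => ?_
  rw [← Complex.ofReal_pow, coef_sq hd hdt]
  push_cast
  ring

/-- Each row has square sum at most m², and there are N + n ≤ 2Ln rows. There is thus one power of n
where a crude count of the entries would give two. -/
lemma sum_offdiag_le {M : Matrix (Fin N ⊕ Fin n) (Fin N ⊕ Fin n) ℂ} (hM : ‖M‖ ≤ m)
    (hL : 1 ≤ L) (hN : (N : ℝ) ≤ L * n) :
    ∑ q : Fin N × Fin n, (‖M (Sum.inl q.1) (Sum.inr q.2)‖ ^ 2 +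
      ‖M (Sum.inr q.2) (Sum.inl q.1)‖ ^ 2) ≤ 2 * L * n * m ^ 2 := by
  have hm : 0 ≤ m := (norm_nonneg _).trans hM
  have hrow : ∀ k, ∑ l, ‖M k l‖ ^ 2 ≤ m ^ 2 := fun k =>
    (sum_norm_sq_row_le M k).trans (by gcongr)
  rw [Finset.sum_add_distrib, Fintype.sum_prod_type, Fintype.sum_prod_type,
    Finset.sum_comm (f := fun (i : Fin N) (j : Fin n) => ‖M (Sum.inr j) (Sum.inl i)‖ ^ 2)]
  have h1 : ∑ i : Fin N, ∑ j : Fin n, ‖M (Sum.inl i) (Sum.inr j)‖ ^ 2 ≤ N * m ^ 2 := by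
    calc _ ≤ ∑ _i : Fin N, m ^ 2 := by
          refine Finset.sum_le_sum fun i _ => le_trans ?_ (hrow (Sum.inl i))
          rw [Fintype.sum_sum_type]
          exact le_add_of_nonneg_left (Finset.sum_nonneg fun _ _ => by positivity)
      _ = _ := by simp
  have h2 : ∑ j : Fin n, ∑ i : Fin N, ‖M (Sum.inr j) (Sum.inl i)‖ ^ 2 ≤ n * m ^ 2 := by
    calc _ ≤ ∑ _j : Fin n, m ^ 2 := by
          refine Finset.sum_le_sum fun j _ => le_trans ?_ (hrow (Sum.inr j))
          rw [Fintype.sum_sum_type]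
          exact le_add_of_nonneg_right (Finset.sum_nonneg fun _ _ => by positivity)
      _ = _ := by simp
  have h3 : (n : ℝ) ≤ L * n := le_mul_of_one_le_left (by positivity) hL
  calc _ ≤ N * m ^ 2 + n * m ^ 2 := add_le_add h1 h2
    _ ≤ (L * n) * m ^ 2 + (L * n) * m ^ 2 := by gcongr
    _ = _ := by ring

/-- Sum over all entries of the remainders of the second-order expansion. -/
lemma norm_sum_remainder_le (hs : 0 < s.re) (hL : 1 ≤ L) (ha : 1 / s.re ≤ L) (hn : 1 ≤ n)
    (hd : ∀ i, 0 ≤ d i) (hdt : ∀ j, 0 ≤ dt j) (hdL : ∀ i, d i ≤ L) (hdtL : ∀ j, dt j ≤ L)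
    (hN : (N : ℝ) ≤ L * n) (hν : ∀ q, IsStandard (μ q) L)
    (hGB : ∀ x, ‖modelGreen d dt A s x * B‖ ≤ L ^ 3) :
    ‖∑ q : Fin N × Fin n, (∫ x, (coef d dt q * x q *
        (modelGreen d dt A s x * B) (Sum.inr q.2) (Sum.inl q.1) +
        conj (coef d dt q * x q) * (modelGreen d dt A s x * B) (Sum.inl q.1) (Sum.inr q.2))
          ∂Measure.pi μ +
      Complex.I * coef d dt q ^ 2 * ∫ x,
        (modelGreen d dt A s x (Sum.inr q.2) (Sum.inr q.2) *
            (modelGreen d dt A s x * B) (Sum.inl q.1) (Sum.inl q.1) +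
          modelGreen d dt A s x (Sum.inl q.1) (Sum.inl q.1) *
            (modelGreen d dt A s x * B) (Sum.inr q.2) (Sum.inr q.2)) ∂Measure.pi μ)‖ ≤
      192 * L ^ 18 := by
  have hL3 : 1 ≤ L ^ 3 := one_le_pow₀ hL
  have hLL3 : L ≤ L ^ 3 := le_self_pow₀ hL (by norm_num)
  have hn0 : (0 : ℝ) < n := by exact_mod_cast hn
  have h := fun q => norm_integral_entry_le (A := A) (B := B) (μ := μ) hs hL3 (ha.trans hLL3) hGB q
    (hν q)
  set G := modelGreen d dt A s with hG
  have bG : ∀ x, ‖G x‖ ≤ L ^ 3 := fun x => (norm_modelGreen_le hs x).trans (ha.trans hLL3)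
  have bG' : ∀ x u v, ‖G x u v‖ ≤ L ^ 3 := fun x u v => (norm_entry_le _ _ _).trans (bG x)
  have bP' : ∀ x u v, ‖(G x * B) u v‖ ≤ L ^ 3 := fun x u v => (norm_entry_le _ _ _).trans (hGB x)
  have cG : ∀ u v, Continuous fun x => G x u v := fun u v => continuous_modelGreen_entry hs u v
  have cP : ∀ u v, Continuous fun x => (G x * B) u v :=
    fun u v => continuous_modelGreen_mul_entry hs B u v
  have iS : ∀ q : Fin N × Fin n, Integrable (fun x => ‖G x (Sum.inl q.1) (Sum.inr q.2)‖ ^ 2 +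
      ‖G x (Sum.inr q.2) (Sum.inl q.1)‖ ^ 2 + ‖(G x * B) (Sum.inl q.1) (Sum.inr q.2)‖ ^ 2 +
      ‖(G x * B) (Sum.inr q.2) (Sum.inl q.1)‖ ^ 2) (Measure.pi μ) := by
    intro q
    have bsq : ∀ {w : ℂ}, ‖w‖ ≤ L ^ 3 → ‖w‖ ^ 2 ≤ (L ^ 3) ^ 2 := fun h => by gcongr
    refine integrable_of_bounded (C := 4 * (L ^ 3) ^ 2) (Continuous.aestronglyMeasurable
      (((((cG _ _).norm.pow 2).add ((cG _ _).norm.pow 2)).add ((cP _ _).norm.pow 2)).add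
        ((cP _ _).norm.pow 2))) fun x => ?_
    rw [Real.norm_of_nonneg (by positivity)]
    linarith [bsq (bG' x (Sum.inl q.1) (Sum.inr q.2)), bsq (bG' x (Sum.inr q.2) (Sum.inl q.1)),
      bsq (bP' x (Sum.inl q.1) (Sum.inr q.2)), bsq (bP' x (Sum.inr q.2) (Sum.inl q.1))]
  have hsumS : ∑ q : Fin N × Fin n, ∫ x, (‖G x (Sum.inl q.1) (Sum.inr q.2)‖ ^ 2 +
      ‖G x (Sum.inr q.2) (Sum.inl q.1)‖ ^ 2 + ‖(G x * B) (Sum.inl q.1) (Sum.inr q.2)‖ ^ 2 +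
      ‖(G x * B) (Sum.inr q.2) (Sum.inl q.1)‖ ^ 2) ∂Measure.pi μ ≤ 4 * L * n * (L ^ 3) ^ 2 := by
    rw [← integral_finsetSum _ fun q _ => iS q]
    calc _ ≤ ∫ _x, 4 * L * n * (L ^ 3) ^ 2 ∂Measure.pi μ := by
          refine integral_mono (integrable_finsetSum _ fun q _ => iS q) (integrable_const _)
            fun x => ?_
          have h1 := sum_offdiag_le (bG x) hL hN
          have h2 := sum_offdiag_le (hGB x) hL hN
          calc _ = ∑ q : Fin N × Fin n, (‖G x (Sum.inl q.1) (Sum.inr q.2)‖ ^ 2 +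
                ‖G x (Sum.inr q.2) (Sum.inl q.1)‖ ^ 2) +
                ∑ q : Fin N × Fin n, (‖(G x * B) (Sum.inl q.1) (Sum.inr q.2)‖ ^ 2 +
                ‖(G x * B) (Sum.inr q.2) (Sum.inl q.1)‖ ^ 2) := by
                rw [← Finset.sum_add_distrib]
                exact Finset.sum_congr rfl fun q _ => by ring
            _ ≤ _ := by linarith
      _ = _ := by simp
  have hc4 := sum_coef_four_le hn hL hd hdt hdL hdtL hN
  refine (norm_sum_le _ _).trans ((Finset.sum_le_sum fun q _ => h q).trans ?_)
  rw [Finset.sum_add_distrib]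
  have p1 : ∑ q : Fin N × Fin n, (L ^ 3) ^ 4 * coef d dt q ^ 4 * (8 * L + 152) ≤ 160 * L ^ 18 := by
    calc _ = (L ^ 3) ^ 4 * (8 * L + 152) * ∑ q, coef d dt q ^ 4 := by
          rw [Finset.mul_sum]
          exact Finset.sum_congr rfl fun q _ => by ring
      _ ≤ (L ^ 3) ^ 4 * (160 * L) * L ^ 5 := by
          gcongr
          linarith
      _ = _ := by ring
  -- The off-diagonal squares sum to O(n) and each carries a factor of order 1/n, so this part is
  -- O(1) as well.
  have p2 : ∑ q : Fin N × Fin n, 8 * coef d dt q ^ 2 *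
      ∫ x, (‖G x (Sum.inl q.1) (Sum.inr q.2)‖ ^ 2 +
      ‖G x (Sum.inr q.2) (Sum.inl q.1)‖ ^ 2 + ‖(G x * B) (Sum.inl q.1) (Sum.inr q.2)‖ ^ 2 +
      ‖(G x * B) (Sum.inr q.2) (Sum.inl q.1)‖ ^ 2) ∂Measure.pi μ ≤ 32 * L ^ 18 := by
    calc _ ≤ ∑ q : Fin N × Fin n, 8 * (L ^ 2 / n) *
          ∫ x, (‖G x (Sum.inl q.1) (Sum.inr q.2)‖ ^ 2 +
          ‖G x (Sum.inr q.2) (Sum.inl q.1)‖ ^ 2 + ‖(G x * B) (Sum.inl q.1) (Sum.inr q.2)‖ ^ 2 +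
          ‖(G x * B) (Sum.inr q.2) (Sum.inl q.1)‖ ^ 2) ∂Measure.pi μ := by
          refine Finset.sum_le_sum fun q _ => ?_
          have h0 : 0 ≤ ∫ x, (‖G x (Sum.inl q.1) (Sum.inr q.2)‖ ^ 2 +
            ‖G x (Sum.inr q.2) (Sum.inl q.1)‖ ^ 2 + ‖(G x * B) (Sum.inl q.1) (Sum.inr q.2)‖ ^ 2 +
            ‖(G x * B) (Sum.inr q.2) (Sum.inl q.1)‖ ^ 2) ∂Measure.pi μ :=
            integral_nonneg fun x => by positivity
          gcongr
          exact coef_sq_le hd hdt hdL hdtL q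
      _ ≤ 8 * (L ^ 2 / n) * (4 * L * n * (L ^ 3) ^ 2) := by
          rw [← Finset.mul_sum]
          gcongr
      _ = 32 * L ^ 9 := by field_simp; ring
      _ ≤ _ := by
          gcongr
          norm_num
  linarith

/-- The mean weighted trace of the resolvent and that of its deterministic equivalent differ by a
bounded quantity. -/
lemma norm_trace_error_le (hs : 0 < s.re) (hL : 1 ≤ L) (ha : 1 / s.re ≤ L) (hn : 1 ≤ n)
    (hd : ∀ i, 0 ≤ d i) (hdt : ∀ j, 0 ≤ dt j) (hdL : ∀ i, d i ≤ L) (hdtL : ∀ j, dt j ≤ L)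
    (hN : (N : ℝ) ≤ L * n) (hν : ∀ q, IsStandard (μ q) L) {p q : ℂ} (hp0 : 0 ≤ p.re)
    (hq0 : 0 ≤ q.re)
    (hp : n * p = ∫ x, ∑ k, (weightL n d k : ℂ) * modelGreen d dt A s x k k ∂Measure.pi μ)
    (hq : n * q = ∫ x, ∑ k, (weightR N dt k : ℂ) * modelGreen d dt A s x k k ∂Measure.pi μ)
    {e : Fin N ⊕ Fin n → ℝ} (he : ∀ k, 0 ≤ e k) (heL : ∀ k, e k ≤ L) :
    ‖∫ x, ∑ k, (e k : ℂ) * modelGreen d dt A s x k k ∂Measure.pi μ -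
      ∑ k, (e k : ℂ) * green (hermitize A) s (profile d dt p q) k k‖ ≤ 200 * L ^ 18 := by
  have hL0 : 0 ≤ L := by linarith
  have hn0 : (0 : ℝ) < n := by exact_mod_cast hn
  have hnC : (n : ℂ) ≠ 0 := by exact_mod_cast hn0.ne'
  have hw := re_profile_nonneg hd hdt hp0 hq0
  set R := green (hermitize A) s (profile d dt p q) with hR
  set B : Matrix (Fin N ⊕ Fin n) (Fin N ⊕ Fin n) ℂ := diagonal (fun k => (e k : ℂ)) * R with hB
  have hRn : ‖R‖ ≤ L := (norm_green_le (isHermitian_hermitize A) hs hw).trans ha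
  have hEn : ‖(diagonal (fun k => (e k : ℂ)) : Matrix (Fin N ⊕ Fin n) (Fin N ⊕ Fin n) ℂ)‖ ≤ L := by
    rw [l2_opNorm_diagonal, pi_norm_le_iff_of_nonneg hL0]
    intro k
    rw [Complex.norm_real, Real.norm_of_nonneg (he k)]
    exact heL k
  -- One factor L for each of G, the weights and R. The same bound L³ then serves for G itself, so
  -- all earlier estimates apply with m = L³.
  have hGB : ∀ x, ‖modelGreen d dt A s x * B‖ ≤ L ^ 3 := fun x => by
    calc _ ≤ ‖modelGreen d dt A s x‖ * ‖B‖ := norm_mul_le _ _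
      _ ≤ L * (L * L) := by
        gcongr
        · exact (norm_modelGreen_le hs x).trans ha
        · exact (norm_mul_le _ _).trans (by gcongr)
      _ = _ := by ring
  have hLL3 : L ≤ L ^ 3 := le_self_pow₀ hL (by norm_num)
  have hrem := norm_sum_remainder_le (A := A) (B := B) (μ := μ) hs hL ha hn hd hdt hdL hdtL hN hν
    hGB
  have hid := sum_weight_sub (d := d) (dt := dt) (A := A) hs hw e
  rw [← hR, ← hB] at hid
  have hG1 : ∀ x, ‖modelGreen d dt A s x * 1‖ ≤ L ^ 3 := fun x => by
    rw [mul_one]; exact (norm_modelGreen_le hs x).trans (ha.trans hLL3)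
  have hvar : ∀ (C : Matrix (Fin N ⊕ Fin n) (Fin N ⊕ Fin n) ℂ),
      (∀ x, ‖modelGreen d dt A s x * C‖ ≤ L ^ 3) → ∀ (f : Fin N ⊕ Fin n → ℝ), (∀ k, 0 ≤ f k) →
      (∀ k, f k ≤ L) →
      ∫ x, ‖∑ k, (f k : ℂ) * (modelGreen d dt A s x * C) k k -
        ∫ x', ∑ k, (f k : ℂ) * (modelGreen d dt A s x' * C) k k ∂Measure.pi μ‖ ^ 2
          ∂Measure.pi μ ≤ 4 * L ^ 17 * n := by
    intro C hC f hf hfL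
    refine (variance_trace_le hs hL0 (ha.trans hLL3) hC hν hf hfL).trans ?_
    calc _ ≤ 4 * L ^ 2 * (L ^ 3) ^ 4 * (L ^ 3 * n) := by
          gcongr
          exact sum_coef_sq_le hn hd hdt hdL hdtL hN
      _ = _ := by ring
  set G := modelGreen d dt A s with hG
  have bG' : ∀ x u v, ‖G x u v‖ ≤ L ^ 3 := fun x u v => (norm_entry_le _ _ _).trans
    ((norm_modelGreen_le hs x).trans (ha.trans hLL3))
  have bP' : ∀ x u v, ‖(G x * B) u v‖ ≤ L ^ 3 := fun x u v => (norm_entry_le _ _ _).trans (hGB x)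
  have cG : ∀ u v, Continuous fun x => G x u v := fun u v => continuous_modelGreen_entry hs u v
  have cP : ∀ u v, Continuous fun x => (G x * B) u v :=
    fun u v => continuous_modelGreen_mul_entry hs B u v
  -- weighted traces
  have cT : ∀ (f : Fin N ⊕ Fin n → ℝ), Continuous fun x => ∑ k, (f k : ℂ) * G x k k := fun f =>
    continuous_finsetSum _ fun k _ => continuous_const.mul (cG k k)
  have cT' : ∀ (f : Fin N ⊕ Fin n → ℝ), Continuous fun x => ∑ k, (f k : ℂ) * (G x * B) k k :=
    fun f => continuous_finsetSum _ fun k _ => continuous_const.mul (cP k k)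
  have bT : ∀ (f : Fin N ⊕ Fin n → ℝ) x, ‖∑ k, (f k : ℂ) * G x k k‖ ≤ ∑ k, |f k| * L ^ 3 :=
    fun f x => (norm_sum_le _ _).trans (Finset.sum_le_sum fun k _ => by
      rw [norm_mul, Complex.norm_real, Real.norm_eq_abs]; gcongr; exact bG' x k k)
  have bT' : ∀ (f : Fin N ⊕ Fin n → ℝ) x, ‖∑ k, (f k : ℂ) * (G x * B) k k‖ ≤
      ∑ k, |f k| * L ^ 3 :=
    fun f x => (norm_sum_le _ _).trans (Finset.sum_le_sum fun k _ => by
      rw [norm_mul, Complex.norm_real, Real.norm_eq_abs]; gcongr; exact bP' x k k)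
  have iT : ∀ f : Fin N ⊕ Fin n → ℝ,
      Integrable (fun x => ∑ k, (f k : ℂ) * G x k k) (Measure.pi μ) := fun f =>
    integrable_of_bounded (cT f).aestronglyMeasurable (bT f)
  have iT' : ∀ f : Fin N ⊕ Fin n → ℝ,
      Integrable (fun x => ∑ k, (f k : ℂ) * (G x * B) k k) (Measure.pi μ) := fun f =>
    integrable_of_bounded (cT' f).aestronglyMeasurable (bT' f)
  have iTT : ∀ f g : Fin N ⊕ Fin n → ℝ, Integrable (fun x => (∑ k, (f k : ℂ) * G x k k) *
      ∑ k, (g k : ℂ) * (G x * B) k k) (Measure.pi μ) := fun f g =>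
    (iT f).mul_bdd (cT' g).aestronglyMeasurable (Filter.Eventually.of_forall (bT' g))
  have hcov : ∀ f g : Fin N ⊕ Fin n → ℝ, (∀ k, 0 ≤ f k) → (∀ k, f k ≤ L) → (∀ k, 0 ≤ g k) →
      (∀ k, g k ≤ L) → ‖(∫ x, ∑ k, (f k : ℂ) * G x k k ∂Measure.pi μ) *
        (∫ x, ∑ k, (g k : ℂ) * (G x * B) k k ∂Measure.pi μ) -
        ∫ x, (∑ k, (f k : ℂ) * G x k k) * ∑ k, (g k : ℂ) * (G x * B) k k ∂Measure.pi μ‖ ≤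
        4 * L ^ 17 * n := by
    intro f g hf hfL hg hgL
    have h1 := hvar 1 hG1 f hf hfL
    simp only [mul_one] at h1
    exact norm_covariance_le (cT f).aestronglyMeasurable (cT' g).aestronglyMeasurable (bT f)
      (bT' g) h1 (hvar B hGB g hg hgL)
  have hwl := weightL_nonneg (n := n) hd
  have hwl' := weightL_le (n := n) hL0 hdL
  have hwr := weightR_nonneg (N := N) hdt
  have hwr' := weightR_le (N := N) hL0 hdtL
  have hcov1 := hcov _ _ hwr hwr' hwl hwl'
  have hcov2 := hcov _ _ hwl hwl' hwr hwr'
  -- integrability of the individual terms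
  have iF : ∀ r : Fin N × Fin n, Integrable (fun x => coef d dt r * x r *
      (G x * B) (Sum.inr r.2) (Sum.inl r.1) + conj (coef d dt r * x r) *
      (G x * B) (Sum.inl r.1) (Sum.inr r.2)) (Measure.pi μ) := by
    intro r
    have hev := measurePreserving_eval μ r
    have i1 : Integrable (fun x : Fin N × Fin n → ℂ => (coef d dt r : ℂ) * x r) (Measure.pi μ) :=
      (hev.integrable_comp_of_integrable (hν r).integrable).const_mul _
    have i2 : Integrable (fun x : Fin N × Fin n → ℂ => conj (coef d dt r * x r))
        (Measure.pi μ) :=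
      (Complex.conjCLE : ℂ →L[ℝ] ℂ).integrable_comp i1
    exact (i1.mul_bdd (cP _ _).aestronglyMeasurable (Filter.Eventually.of_forall
      fun x => bP' x _ _)).add (i2.mul_bdd (cP _ _).aestronglyMeasurable
        (Filter.Eventually.of_forall fun x => bP' x _ _))
  have iGP : ∀ r : Fin N × Fin n, Integrable (fun x => G x (Sum.inr r.2) (Sum.inr r.2) *
      (G x * B) (Sum.inl r.1) (Sum.inl r.1) + G x (Sum.inl r.1) (Sum.inl r.1) *
      (G x * B) (Sum.inr r.2) (Sum.inr r.2)) (Measure.pi μ) := by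
    intro r
    have h1 : ∀ u v, Integrable (fun x => G x u u * (G x * B) v v) (Measure.pi μ) := fun u v =>
      integrable_of_bounded (C := L ^ 3 * L ^ 3) ((cG u u).mul (cP v v)).aestronglyMeasurable
        fun x => by rw [norm_mul]; gcongr; exacts [bG' _ _ _, bP' _ _ _]
    exact (h1 _ _).add (h1 _ _)
  have hsum : ∑ r : Fin N × Fin n, (coef d dt r : ℂ) ^ 2 * ∫ x, (G x (Sum.inr r.2) (Sum.inr r.2) *
      (G x * B) (Sum.inl r.1) (Sum.inl r.1) + G x (Sum.inl r.1) (Sum.inl r.1) *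
      (G x * B) (Sum.inr r.2) (Sum.inr r.2)) ∂Measure.pi μ =
      1 / n * ((∫ x, (∑ k, (weightR N dt k : ℂ) * G x k k) *
        ∑ k, (weightL n d k : ℂ) * (G x * B) k k ∂Measure.pi μ) +
      ∫ x, (∑ k, (weightL n d k : ℂ) * G x k k) *
        ∑ k, (weightR N dt k : ℂ) * (G x * B) k k ∂Measure.pi μ) := by
    rw [← integral_add (iTT _ _) (iTT _ _), ← integral_const_mul]
    simp_rw [← integral_const_mul]
    rw [← integral_finsetSum _ fun r _ => (iGP r).const_mul _]
    congr 1
    ext1 x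
    exact sum_coef_sq_mul hd hdt (fun k => G x k k) (fun k => (G x * B) k k)
  -- The expectation of `sum_weight_sub`, with the diagonal weights split as q times `weightL` plus
  -- p times `weightR`.
  have hlhs : ∫ x, ∑ k, (e k : ℂ) * G x k k ∂Measure.pi μ - ∑ k, (e k : ℂ) * R k k =
      q * (∫ x, ∑ k, (weightL n d k : ℂ) * (G x * B) k k ∂Measure.pi μ) +
      p * (∫ x, ∑ k, (weightR N dt k : ℂ) * (G x * B) k k ∂Measure.pi μ) -
      Complex.I * ∑ r : Fin N × Fin n, ∫ x, (coef d dt r * x r *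
        (G x * B) (Sum.inr r.2) (Sum.inl r.1) + conj (coef d dt r * x r) *
        (G x * B) (Sum.inl r.1) (Sum.inr r.2)) ∂Measure.pi μ := by
    have e1 : ∫ x, ∑ k, (e k : ℂ) * G x k k ∂Measure.pi μ - ∑ k, (e k : ℂ) * R k k =
        ∫ x, ∑ k, (e k : ℂ) * (G x k k - R k k) ∂Measure.pi μ := by
      have : ∀ x, ∑ k, (e k : ℂ) * (G x k k - R k k) =
          ∑ k, (e k : ℂ) * G x k k - ∑ k, (e k : ℂ) * R k k := fun x => by
        rw [← Finset.sum_sub_distrib]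
        exact Finset.sum_congr rfl fun k _ => by ring
      simp_rw [this]
      rw [integral_sub (iT e) (integrable_const _)]
      simp
    have e2 : ∀ x, ∑ k, profile d dt p q k * (G x * B) k k =
        q * ∑ k, (weightL n d k : ℂ) * (G x * B) k k +
        p * ∑ k, (weightR N dt k : ℂ) * (G x * B) k k := fun x => by
      rw [Finset.mul_sum, Finset.mul_sum, ← Finset.sum_add_distrib]
      exact Finset.sum_congr rfl fun k _ => by rw [profile_eq]; ring
    rw [e1]
    simp_rw [hid, e2]
    rw [← integral_finsetSum _ fun r _ => iF r, ← integral_const_mul, ← integral_const_mul,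
      ← integral_const_mul]
    have j1 := (iT' (weightL n d)).const_mul q
    have j2 := (iT' (weightR N dt)).const_mul p
    have j3 := (integrable_finsetSum Finset.univ fun r _ => iF r).const_mul Complex.I
    rw [← integral_add j1 j2]
    exact integral_sub (j1.add j2) j3
  rw [hlhs]
  rw [Finset.sum_add_distrib] at hrem
  simp_rw [mul_assoc Complex.I] at hrem
  rw [← Finset.mul_sum, hsum] at hrem
  rw [← hp] at hcov2
  rw [← hq] at hcov1
  set S := ∑ r : Fin N × Fin n, ∫ x, (coef d dt r * x r *
        (G x * B) (Sum.inr r.2) (Sum.inl r.1) + conj (coef d dt r * x r) *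
        (G x * B) (Sum.inl r.1) (Sum.inr r.2)) ∂Measure.pi μ
  set P₁ := ∫ x, ∑ k, (weightL n d k : ℂ) * (G x * B) k k ∂Measure.pi μ
  set P₂ := ∫ x, ∑ k, (weightR N dt k : ℂ) * (G x * B) k k ∂Measure.pi μ
  set C₁ := ∫ x, (∑ k, (weightR N dt k : ℂ) * G x k k) *
        ∑ k, (weightL n d k : ℂ) * (G x * B) k k ∂Measure.pi μ
  set C₂ := ∫ x, (∑ k, (weightL n d k : ℂ) * G x k k) *
        ∑ k, (weightR N dt k : ℂ) * (G x * B) k k ∂Measure.pi μ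
  -- Since nq and np are mean traces of G, the first two brackets are covariances. The third is the
  -- second-order remainder: the main terms have cancelled.
  have efin : q * P₁ + p * P₂ - Complex.I * S = 1 / n * (n * q * P₁ - C₁) +
      1 / n * (n * p * P₂ - C₂) - Complex.I * (S + Complex.I * (1 / n * (C₁ + C₂))) := by
    field_simp
    linear_combination (C₁ + C₂) * Complex.I_sq
  have hninv : ‖(1 / n : ℂ)‖ = 1 / n := by simp
  rw [efin]
  calc _ ≤ ‖(1 / n : ℂ) * (n * q * P₁ - C₁)‖ + ‖(1 / n : ℂ) * (n * p * P₂ - C₂)‖ +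
        ‖Complex.I * (S + Complex.I * (1 / n * (C₁ + C₂)))‖ :=
        (norm_sub_le _ _).trans (add_le_add (norm_add_le _ _) le_rfl)
    _ ≤ 1 / n * (4 * L ^ 17 * n) + 1 / n * (4 * L ^ 17 * n) + 192 * L ^ 18 := by
        rw [norm_mul, norm_mul, norm_mul, hninv, Complex.norm_I, one_mul]
        gcongr
    _ = 8 * L ^ 17 + 192 * L ^ 18 := by field_simp; ring
    _ ≤ 8 * L ^ 18 + 192 * L ^ 18 := by
        gcongr
        norm_num
    _ = _ := by ring

end TraceErrorBound


/-! ### From the probability space to the product measure -/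

section Transfer

variable {N n : ℕ} {d : Fin N → ℝ} {dt : Fin n → ℝ} {A : Matrix (Fin N) (Fin n) ℂ} {s z : ℂ}
  {Ω : Type*} [MeasurableSpace Ω] {P : Measure Ω} [IsProbabilityMeasure P]
  {X : Fin N → Fin n → Ω → ℂ} {M L : ℝ} {p : ℕ}

lemma IsIIDEntries.aemeasurable {m : ℕ} (hX : IsIIDEntries P X m M) (i : Fin N) (j : Fin n) :
    AEMeasurable (X i j) P :=
  (hX.ident i j i j).aemeasurable_fst

/-- The law of an entry is standard. -/
lemma IsIIDEntries.isStandard (hX : IsIIDEntries P X (8 * p) M) (hp : 1 ≤ p) (hM : 1 + M ≤ L)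
    (q : Fin N × Fin n) : IsStandard (P.map (X q.1 q.2)) L := by
  have hm := hX.aemeasurable q.1 q.2
  have hle : ∀ r : ℕ, r ≤ 8 → MemLp (X q.1 q.2) (r : ENNReal) P := fun r hr =>
    (hX.memLp q.1 q.2).mono_exponent (by exact_mod_cast hr.trans (by omega))
  have hpow : ∀ r : ℕ, r ≤ 8 → Integrable (fun ω => ‖X q.1 q.2 ω‖ ^ r) P := fun r hr =>
    (hle r hr).integrable_norm_pow'
  have hpow8 : Integrable (fun ω => ‖X q.1 q.2 ω‖ ^ (8 * p)) P :=
    (hX.memLp q.1 q.2).integrable_norm_pow'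
  have hXint : Integrable (X q.1 q.2) P := by
    have := hle 1 (by norm_num)
    rw [Nat.cast_one, memLp_one_iff_integrable] at this
    exact this
  refine ⟨?_, ?_, ?_, ?_, ?_, ?_⟩
  · rw [integrable_map_measure (by fun_prop) hm]
    exact hXint
  · rw [integrable_map_measure (by fun_prop) hm]
    exact hpow 2 (by norm_num)
  · rw [integrable_map_measure (by fun_prop) hm]
    exact hpow 4 (by norm_num)
  · rw [integral_map hm (by fun_prop)]
    exact hX.mean_zero q.1 q.2
  · rw [integral_map hm (by fun_prop)]
    exact hX.variance_one q.1 q.2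
  · rw [integral_map hm (by fun_prop)]
    -- Only the fourth moment matters: t⁴ ≤ 1 + t^(8p), according to whether t ≤ 1 or t ≥ 1.
    calc ∫ ω, ‖X q.1 q.2 ω‖ ^ 4 ∂P ≤ ∫ ω, (1 + ‖X q.1 q.2 ω‖ ^ (8 * p)) ∂P := by
          refine integral_mono (hpow 4 (by norm_num)) ((integrable_const _).add hpow8) fun ω => ?_
          change ‖X q.1 q.2 ω‖ ^ 4 ≤ 1 + ‖X q.1 q.2 ω‖ ^ (8 * p)
          rcases le_total ‖X q.1 q.2 ω‖ 1 with h | h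
          · have h1 := pow_le_one₀ (n := 4) (norm_nonneg _) h
            have h2 : 0 ≤ ‖X q.1 q.2 ω‖ ^ (8 * p) := by positivity
            linarith
          · have h1 := pow_le_pow_right₀ h (show 4 ≤ 8 * p by omega)
            linarith
      _ = 1 + ∫ ω, ‖X q.1 q.2 ω‖ ^ (8 * p) ∂P := by
          rw [integral_add (integrable_const _) hpow8]
          simp
      _ ≤ L := by linarith [hX.moment_le q.1 q.2]

lemma IsIIDEntries.map_eq {m : ℕ} (hX : IsIIDEntries P X m M) :
    P.map (fun ω (q : Fin N × Fin n) => X q.1 q.2 ω) =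
      Measure.pi fun q : Fin N × Fin n => P.map (X q.1 q.2) :=
  (iIndepFun_iff_map_fun_eq_pi_map (fun q : Fin N × Fin n => hX.aemeasurable q.1 q.2)).1 hX.indep

lemma IsIIDEntries.integral_comp {m : ℕ} (hX : IsIIDEntries P X m M)
    {F : (Fin N × Fin n → ℂ) → ℂ} (hF : Continuous F) :
    ∫ ω, F (fun q => X q.1 q.2 ω) ∂P =
      ∫ x, F x ∂Measure.pi fun q : Fin N × Fin n => P.map (X q.1 q.2) := by
  rw [← hX.map_eq, integral_map]
  · exact aemeasurable_pi_lambda _ fun q => hX.aemeasurable q.1 q.2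
  · exact hF.measurable.aestronglyMeasurable

/-- The factor s removes the s⁻¹ of `resolvent_eq`. Independence enters through
`IsIIDEntries.integral_comp`, which replaces the joint law by the product of the laws of the
entries. -/
lemma IsIIDEntries.alpha_eq {m : ℕ} (hX : IsIIDEntries P X m M) (hn : 1 ≤ n) (hs : 0 < s.re)
    (hz : s ^ 2 = -z) :
    n * (s * alpha P d dt A X z) = ∫ x, ∑ k, (weightL n d k : ℂ) * modelGreen d dt A s x k k
      ∂Measure.pi fun q : Fin N × Fin n => P.map (X q.1 q.2) := by
  have : ∀ q : Fin N × Fin n, IsProbabilityMeasure (P.map (X q.1 q.2)) := fun q =>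
    Measure.isProbabilityMeasure_map (hX.aemeasurable q.1 q.2)
  have hs0 : s ≠ 0 := by rintro rfl; simp at hs
  have hn0 : (n : ℂ) ≠ 0 := by exact_mod_cast (by omega : n ≠ 0)
  simp_rw [sum_weightL_mul]
  rw [integral_finsetSum]
  · rw [alpha, trace_diagC_mul]
    have h : ∀ i, expect P (fun ω => resolvent (sigma d dt A X ω) z) i i =
        s⁻¹ * ∫ x, modelGreen d dt A s x (Sum.inl i) (Sum.inl i)
          ∂Measure.pi fun q : Fin N × Fin n => P.map (X q.1 q.2) := by
      intro i
      rw [← hX.integral_comp (continuous_modelGreen_entry hs _ _), ← integral_const_mul]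
      simp only [expect, of_apply]
      congr 1
      ext ω
      rw [resolvent_eq _ hs hz, sigma_eq_model]
      rfl
    simp_rw [h, integral_const_mul]
    have e : ∀ a b : ℂ, a * (s⁻¹ * b) = s⁻¹ * (a * b) := fun a b => by ring
    simp_rw [e]
    rw [← Finset.mul_sum]
    field_simp
  · intro i _
    refine Integrable.const_mul ?_ _
    exact integrable_of_bounded (continuous_modelGreen_entry hs _ _).aestronglyMeasurable
      fun x => (norm_entry_le _ _ _).trans (norm_modelGreen_le hs x)

lemma IsIIDEntries.coAlpha_eq {m : ℕ} (hX : IsIIDEntries P X m M) (hn : 1 ≤ n) (hs : 0 < s.re)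
    (hz : s ^ 2 = -z) :
    n * (s * coAlpha P d dt A X z) = ∫ x, ∑ k, (weightR N dt k : ℂ) * modelGreen d dt A s x k k
      ∂Measure.pi fun q : Fin N × Fin n => P.map (X q.1 q.2) := by
  have : ∀ q : Fin N × Fin n, IsProbabilityMeasure (P.map (X q.1 q.2)) := fun q =>
    Measure.isProbabilityMeasure_map (hX.aemeasurable q.1 q.2)
  have hs0 : s ≠ 0 := by rintro rfl; simp at hs
  have hn0 : (n : ℂ) ≠ 0 := by exact_mod_cast (by omega : n ≠ 0)
  simp_rw [sum_weightR_mul]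
  rw [integral_finsetSum]
  · rw [coAlpha, trace_diagC_mul]
    have h : ∀ j, expect P (fun ω => coResolvent (sigma d dt A X ω) z) j j =
        s⁻¹ * ∫ x, modelGreen d dt A s x (Sum.inr j) (Sum.inr j)
          ∂Measure.pi fun q : Fin N × Fin n => P.map (X q.1 q.2) := by
      intro j
      rw [← hX.integral_comp (continuous_modelGreen_entry hs _ _), ← integral_const_mul]
      simp only [expect, of_apply]
      congr 1
      ext ω
      rw [coResolvent_eq _ hs hz, sigma_eq_model]
      rfl
    simp_rw [h, integral_const_mul]
    have e : ∀ a b : ℂ, a * (s⁻¹ * b) = s⁻¹ * (a * b) := fun a b => by ring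
    simp_rw [e]
    rw [← Finset.mul_sum]
    field_simp
  · intro i _
    refine Integrable.const_mul ?_ _
    exact integrable_of_bounded (continuous_modelGreen_entry hs _ _).aestronglyMeasurable
      fun x => (norm_entry_le _ _ _).trans (norm_modelGreen_le hs x)

variable {μ : Fin N × Fin n → Measure ℂ} [∀ q, IsProbabilityMeasure (μ q)]
  {e : Fin N ⊕ Fin n → ℝ}

lemma re_integral_trace_nonneg (hs : 0 < s.re) (he : ∀ k, 0 ≤ e k) :
    0 ≤ (∫ x, ∑ k, (e k : ℂ) * modelGreen d dt A s x k k ∂Measure.pi μ).re := by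
  have hi : Integrable (fun x => ∑ k, (e k : ℂ) * modelGreen d dt A s x k k) (Measure.pi μ) :=
    integrable_finsetSum _ fun k _ => (integrable_of_bounded
      (continuous_modelGreen_entry hs _ _).aestronglyMeasurable
      fun x => (norm_entry_le _ _ _).trans (norm_modelGreen_le hs x)).const_mul _
  have hre : (∫ x, ∑ k, (e k : ℂ) * modelGreen d dt A s x k k ∂Measure.pi μ).re =
      ∫ x, (∑ k, (e k : ℂ) * modelGreen d dt A s x k k).re ∂Measure.pi μ := (integral_re hi).symm
  rw [hre]
  refine integral_nonneg fun x => ?_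
  rw [Pi.zero_apply, Complex.re_sum]
  refine Finset.sum_nonneg fun k _ => ?_
  rw [Complex.re_ofReal_mul]
  exact mul_nonneg (he k) (re_green_diag_nonneg (isHermitian_hermitize _) hs (by simp) k)

lemma norm_integral_trace_le (hs : 0 < s.re) (ha : 1 / s.re ≤ L) (he : ∀ k, 0 ≤ e k) :
    ‖∫ x, ∑ k, (e k : ℂ) * modelGreen d dt A s x k k ∂Measure.pi μ‖ ≤ (∑ k, e k) * L := by
  have h : ∀ x, ‖∑ k, (e k : ℂ) * modelGreen d dt A s x k k‖ ≤ (∑ k, e k) * L := fun x => by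
    rw [Finset.sum_mul]
    refine (norm_sum_le _ _).trans (Finset.sum_le_sum fun k _ => ?_)
    rw [norm_mul, Complex.norm_real, Real.norm_of_nonneg (he k)]
    have := he k
    gcongr
    exact (norm_entry_le _ _ _).trans ((norm_modelGreen_le hs x).trans ha)
  simpa using norm_integral_le_of_norm_le_const (μ := Measure.pi μ)
    (Filter.Eventually.of_forall h)

end Transfer


/-! ### Quantitative comparison of the two deterministic inverses -/

section Comparison

variable {N n : ℕ} {d : Fin N → ℝ} {dt : Fin n → ℝ} {A : Matrix (Fin N) (Fin n) ℂ} {s : ℂ}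
  {L : ℝ} {p q : ℂ}

lemma norm_profile_le (hd : ∀ i, 0 ≤ d i) (hdt : ∀ j, 0 ≤ dt j)
    (hdL : ∀ i, d i ≤ L) (hdtL : ∀ j, dt j ≤ L) {b : ℝ} (hp : ‖p‖ ≤ b) (hq : ‖q‖ ≤ b)
    (k : Fin N ⊕ Fin n) : ‖profile d dt p q k‖ ≤ b * L := by
  have hb : 0 ≤ b := (norm_nonneg _).trans hp
  rcases k with i | j
  · simp only [profile, Sum.elim_inl, norm_mul, Complex.norm_real, Real.norm_of_nonneg (hd i)]
    have := hd i
    gcongr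
    exact hdL i
  · simp only [profile, Sum.elim_inr, norm_mul, Complex.norm_real, Real.norm_of_nonneg (hdt j)]
    have := hdt j
    gcongr
    exact hdtL j

lemma sum_hermitize_col_le (A : Matrix (Fin N) (Fin n) ℂ) (k : Fin N ⊕ Fin n) :
    ∑ l, ‖hermitize A l k‖ ^ 2 ≤ ‖A‖ ^ 2 := by
  rcases k with i | j
  · simpa [hermitize, Fintype.sum_sum_type] using sum_norm_sq_row_le A i
  · simpa [hermitize, Fintype.sum_sum_type] using sum_norm_sq_col_le A j

/-- The diagonal entry contributes at most (2L⁴)² and the column of the Hermitization at most ‖A‖² ≤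
L⁸; the factor 2 of (a + b)² ≤ 2(a² + b²) gives 10 L⁸, whatever the dimension. -/
lemma sum_pencil_col_le (hL : 1 ≤ L) (hsL : ‖s‖ ≤ L) (hA : ‖A‖ ≤ L) {w : Fin N ⊕ Fin n → ℂ}
    (hw : ∀ k, ‖w k‖ ≤ L ^ 4) (k : Fin N ⊕ Fin n) :
    ∑ l, ‖pencil (hermitize A) s w l k‖ ^ 2 ≤ 10 * L ^ 8 := by
  have hterm : ∀ l, ‖pencil (hermitize A) s w l k‖ ^ 2 ≤
      2 * ((if l = k then (2 * L ^ 4) ^ 2 else 0) + ‖hermitize A l k‖ ^ 2) := by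
    intro l
    have e : pencil (hermitize A) s w l k =
        (if l = k then s + w k else 0) + Complex.I * hermitize A l k := by
      by_cases h : l = k
      · subst h; simp [pencil]; ring
      · simp [pencil, h]
    have h1 : ‖(if l = k then s + w k else 0)‖ ≤ if l = k then 2 * L ^ 4 else 0 := by
      split_ifs
      · have h4 : L ≤ L ^ 4 := le_self_pow₀ hL (by norm_num)
        calc _ ≤ ‖s‖ + ‖w k‖ := norm_add_le _ _
          _ ≤ _ := by linarith [hw k]
      · simp
    rw [e]
    calc _ ≤ (‖(if l = k then s + w k else 0)‖ + ‖hermitize A l k‖) ^ 2 := by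
          gcongr
          refine (norm_add_le _ _).trans ?_
          rw [norm_mul, Complex.norm_I, one_mul]
      _ ≤ 2 * (‖(if l = k then s + w k else 0)‖ ^ 2 + ‖hermitize A l k‖ ^ 2) := add_sq_le
      _ ≤ 2 * ((if l = k then 2 * L ^ 4 else 0) ^ 2 + ‖hermitize A l k‖ ^ 2) := by gcongr
      _ = _ := by split_ifs <;> simp
  calc _ ≤ ∑ l, 2 * ((if l = k then (2 * L ^ 4) ^ 2 else 0) + ‖hermitize A l k‖ ^ 2) :=
        Finset.sum_le_sum fun l _ => hterm l
    _ = 2 * ((2 * L ^ 4) ^ 2 + ∑ l, ‖hermitize A l k‖ ^ 2) := by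
        rw [← Finset.mul_sum, Finset.sum_add_distrib, Finset.sum_ite_eq' Finset.univ k]
        simp
    _ ≤ 2 * ((2 * L ^ 4) ^ 2 + L ^ 2) := by
        gcongr
        exact (sum_hermitize_col_le A k).trans (by gcongr)
    _ ≤ 2 * ((2 * L ^ 4) ^ 2 + L ^ 8) := by gcongr; norm_num
    _ = _ := by ring

/-- Off the diagonal only iH remains, and H is Hermitian. The column bound for the pencil therefore
also bounds its rows. -/
lemma norm_pencil_conjTranspose_entry (w : Fin N ⊕ Fin n → ℂ) (k l : Fin N ⊕ Fin n) :
    ‖pencil (hermitize A) s w k l‖ = ‖pencil (hermitize A) s w l k‖ := by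
  by_cases h : k = l
  · rw [h]
  · have h' : l ≠ k := fun h' => h h'.symm
    have e := congrFun (congrFun (isHermitian_hermitize A) k) l
    rw [conjTranspose_apply] at e
    simp only [pencil, Matrix.add_apply, Matrix.smul_apply, one_apply_ne h, one_apply_ne h',
      diagonal_apply_ne _ h, diagonal_apply_ne _ h', smul_eq_mul, mul_zero, zero_add, add_zero,
      norm_mul]
    rw [← e, norm_star]

variable {w : Fin N ⊕ Fin n → ℂ} {e : Fin N ⊕ Fin n → ℝ}

/-- The contraction gap. Each row of the inverse has square sum at least 1/(10 L⁸), the total weight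
is at least n / L², and Re s ≥ 1/L. -/
lemma le_sum_weight_row (hs : 0 < s.re) (hL : 1 ≤ L) (ha : 1 / s.re ≤ L) (hsL : ‖s‖ ≤ L)
    (hA : ‖A‖ ≤ L) (hw0 : ∀ k, 0 ≤ (w k).re) (hw : ∀ k, ‖w k‖ ≤ L ^ 4) (he : ∀ k, 0 ≤ e k)
    (hsum : n ≤ L ^ 2 * ∑ k, e k) :
    n * (1 / (10 * L ^ 11)) ≤
      s.re * ∑ k, e k * ∑ l, ‖green (hermitize A) s w k l‖ ^ 2 := by
  have hL0 : 0 < L := by linarith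
  have hrow : ∀ k, 1 / (10 * L ^ 8) ≤ ∑ l, ‖green (hermitize A) s w k l‖ ^ 2 := by
    intro k
    have h1 := one_le_row_mul_col (isHermitian_hermitize A) hs hw0 k
    have h2 := sum_pencil_col_le hL hsL hA hw k
    rw [div_le_iff₀ (by positivity)]
    exact h1.trans (by gcongr)
  have has : 1 / L ≤ s.re := by
    rw [div_le_iff₀ hs] at ha
    rw [div_le_iff₀ hL0]
    linarith
  calc n * (1 / (10 * L ^ 11)) ≤ (L ^ 2 * ∑ k, e k) * (1 / (10 * L ^ 11)) := by gcongr
    _ = 1 / L * ∑ k, e k * (1 / (10 * L ^ 8)) := by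
        rw [← Finset.sum_mul]; field_simp
    _ ≤ _ := by
        gcongr with k
        · exact Finset.sum_nonneg fun k _ => mul_nonneg (he k) (by positivity)
        · exact he k
        · exact hrow k

lemma le_sum_weight_col (hs : 0 < s.re) (hL : 1 ≤ L) (ha : 1 / s.re ≤ L) (hsL : ‖s‖ ≤ L)
    (hA : ‖A‖ ≤ L) (hw0 : ∀ k, 0 ≤ (w k).re) (hw : ∀ k, ‖w k‖ ≤ L ^ 4) (he : ∀ k, 0 ≤ e k)
    (hsum : n ≤ L ^ 2 * ∑ k, e k) :
    n * (1 / (10 * L ^ 11)) ≤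
      s.re * ∑ k, e k * ∑ l, ‖green (hermitize A) s w l k‖ ^ 2 := by
  have hL0 : 0 < L := by linarith
  have hcol : ∀ k, 1 / (10 * L ^ 8) ≤ ∑ l, ‖green (hermitize A) s w l k‖ ^ 2 := by
    intro k
    have h1 := one_le_col_mul_row (isHermitian_hermitize A) hs hw0 k
    have h2 := sum_pencil_col_le hL hsL hA hw k
    simp_rw [norm_pencil_conjTranspose_entry (A := A) (s := s) w k] at h1
    rw [div_le_iff₀ (by positivity)]
    exact h1.trans (by gcongr)
  have has : 1 / L ≤ s.re := by
    rw [div_le_iff₀ hs] at ha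
    rw [div_le_iff₀ hL0]
    linarith
  calc n * (1 / (10 * L ^ 11)) ≤ (L ^ 2 * ∑ k, e k) * (1 / (10 * L ^ 11)) := by gcongr
    _ = 1 / L * ∑ k, e k * (1 / (10 * L ^ 8)) := by
        rw [← Finset.sum_mul]; field_simp
    _ ≤ _ := by
        gcongr with k
        · exact Finset.sum_nonneg fun k _ => mul_nonneg (he k) (by positivity)
        · exact he k
        · exact hcol k

/-- The Ward identity with the non-negative contribution of w discarded. -/
lemma le_re_sum_weight (hs : 0 < s.re) (hw0 : ∀ k, 0 ≤ (w k).re) (he : ∀ k, 0 ≤ e k) :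
    s.re * ∑ k, e k * ∑ l, ‖green (hermitize A) s w k l‖ ^ 2 ≤
      (∑ k, (e k : ℂ) * green (hermitize A) s w k k).re := by
  rw [Complex.re_sum, Finset.mul_sum]
  refine Finset.sum_le_sum fun k _ => ?_
  rw [Complex.re_ofReal_mul, re_green_diag_row (isHermitian_hermitize A) hs hw0, mul_left_comm,
    Finset.mul_sum]
  refine mul_le_mul_of_nonneg_left (Finset.sum_le_sum fun l _ => ?_) (he k)
  rw [mul_comm]
  gcongr
  linarith [hw0 l]

lemma norm_sum_weight_le (hs : 0 < s.re) (ha : 1 / s.re ≤ L) (hw0 : ∀ k, 0 ≤ (w k).re)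
    (he : ∀ k, 0 ≤ e k) :
    ‖∑ k, (e k : ℂ) * green (hermitize A) s w k k‖ ≤ (∑ k, e k) * L := by
  rw [Finset.sum_mul]
  refine (norm_sum_le _ _).trans (Finset.sum_le_sum fun k _ => ?_)
  rw [norm_mul, Complex.norm_real, Real.norm_of_nonneg (he k)]
  have := he k
  gcongr
  exact (norm_entry_le _ _ _).trans ((norm_green_le (isHermitian_hermitize A) hs hw0).trans ha)

lemma sum_weightL : ∑ k, weightL n d k = ∑ i, d i := by
  simp [weightL, Fintype.sum_sum_type]

lemma sum_weightR : ∑ k, weightR N dt k = ∑ j, dt j := by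
  simp [weightR, Fintype.sum_sum_type]

/-- Comparison of the two deterministic matrices in the Hermitized picture. -/
lemma norm_green_sub_green_le {μ : Fin N × Fin n → Measure ℂ} [∀ q, IsProbabilityMeasure (μ q)]
    {pT qT : ℂ} (hs : 0 < s.re) (hL : 1 ≤ L) (ha : 1 / s.re ≤ L) (hsL : ‖s‖ ≤ L) (hA : ‖A‖ ≤ L)
    (hn : 1 ≤ n) (hd : ∀ i, 0 ≤ d i) (hdt : ∀ j, 0 ≤ dt j) (hdL : ∀ i, d i ≤ L)
    (hdtL : ∀ j, dt j ≤ L) (hN : (N : ℝ) ≤ L * n) (hν : ∀ q, IsStandard (μ q) L)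
    (hsd : n ≤ L ^ 2 * ∑ i, d i) (hsdt : n ≤ L ^ 2 * ∑ j, dt j)
    (hp : n * p = ∫ x, ∑ k, (weightL n d k : ℂ) * modelGreen d dt A s x k k ∂Measure.pi μ)
    (hq : n * q = ∫ x, ∑ k, (weightR N dt k : ℂ) * modelGreen d dt A s x k k ∂Measure.pi μ)
    (hpT0 : 0 ≤ pT.re) (hqT0 : 0 ≤ qT.re)
    (hpT : n * pT = ∑ k, (weightL n d k : ℂ) *
      green (hermitize A) s (profile d dt pT qT) k k)
    (hqT : n * qT = ∑ k, (weightR N dt k : ℂ) *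
      green (hermitize A) s (profile d dt pT qT) k k) :
    0 ≤ p.re ∧ 0 ≤ q.re ∧ ‖green (hermitize A) s (profile d dt p q) -
      green (hermitize A) s (profile d dt pT qT)‖ ≤ 1 / n * (80000 * L ^ 49) := by
  have hL0 : 0 < L := by linarith
  have hn0 : (0 : ℝ) < n := by exact_mod_cast hn
  have hwl := weightL_nonneg (n := n) hd
  have hwr := weightR_nonneg (N := N) hdt
  have hreal : ∀ r : ℂ, ((n : ℂ) * r).re = n * r.re := fun r => by
    rw [← Complex.ofReal_natCast, Complex.re_ofReal_mul]
  have hnorm : ∀ r : ℂ, ‖(n : ℂ) * r‖ = n * ‖r‖ := fun r => by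
    rw [norm_mul, Complex.norm_natCast]
  have hp0 : 0 ≤ p.re := by
    have h := re_integral_trace_nonneg (d := d) (dt := dt) (A := A) (μ := μ) hs hwl
    rw [← hp, hreal] at h
    exact nonneg_of_mul_nonneg_right h hn0
  have hq0 : 0 ≤ q.re := by
    have h := re_integral_trace_nonneg (d := d) (dt := dt) (A := A) (μ := μ) hs hwr
    rw [← hq, hreal] at h
    exact nonneg_of_mul_nonneg_right h hn0
  refine ⟨hp0, hq0, ?_⟩
  have hwR0 := re_profile_nonneg hd hdt hp0 hq0
  have hwT0 := re_profile_nonneg hd hdt hpT0 hqT0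
  have hH := isHermitian_hermitize A
  -- a priori bounds
  have hsumL : (∑ k, weightL n d k) * L ≤ n * L ^ 3 := by
    rw [sum_weightL]
    calc (∑ i, d i) * L ≤ (∑ _i : Fin N, L) * L := by gcongr with i; exact hdL i
      _ = N * L * L := by simp
      _ ≤ (L * n) * L * L := by gcongr
      _ = _ := by ring
  have hsumR : (∑ k, weightR N dt k) * L ≤ n * L ^ 3 := by
    rw [sum_weightR]
    calc (∑ j, dt j) * L ≤ (∑ _j : Fin n, L) * L := by gcongr with j; exact hdtL j
      _ = n * L ^ 2 := by simp; ring
      _ ≤ n * L ^ 3 := by gcongr; norm_num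
  have bnd : ∀ {r I : ℂ}, n * r = I → ‖I‖ ≤ n * L ^ 3 → ‖r‖ ≤ L ^ 3 := by
    intro r I h1 h2
    rw [← h1, hnorm] at h2
    exact le_of_mul_le_mul_left h2 hn0
  have bp : ‖p‖ ≤ L ^ 3 := bnd hp ((norm_integral_trace_le hs ha hwl).trans hsumL)
  have bq : ‖q‖ ≤ L ^ 3 := bnd hq ((norm_integral_trace_le hs ha hwr).trans hsumR)
  have bpT : ‖pT‖ ≤ L ^ 3 := bnd hpT ((norm_sum_weight_le hs ha hwT0 hwl).trans hsumL)
  have bqT : ‖qT‖ ≤ L ^ 3 := bnd hqT ((norm_sum_weight_le hs ha hwT0 hwr).trans hsumR)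
  have bwR : ∀ k, ‖profile d dt p q k‖ ≤ L ^ 4 := fun k =>
    (norm_profile_le hd hdt hdL hdtL bp bq k).trans_eq (by ring)
  have bwT : ∀ k, ‖profile d dt pT qT k‖ ≤ L ^ 4 := fun k =>
    (norm_profile_le hd hdt hdL hdtL bpT bqT k).trans_eq (by ring)
  have bR := (norm_green_le hH hs hwR0).trans ha
  have bT := (norm_green_le hH hs hwT0).trans ha
  set R := green (hermitize A) s (profile d dt p q) with hR
  set T := green (hermitize A) s (profile d dt pT qT) with hT
  -- The threshold is where 2ε ≤ c holds for the ε and c chosen below: 4000 L²⁹ = 2 · 200 L¹⁸ · 10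
  -- L¹¹. For smaller n the trivial bound 2L is already of the form constant / n.
  rcases lt_or_ge (n : ℝ) (4000 * L ^ 29) with hsmall | hlarge
  · calc ‖R - T‖ ≤ L + L := (norm_sub_le _ _).trans (add_le_add bR bT)
      _ = 1 / n * (2 * L * n) := by field_simp; ring
      _ ≤ 1 / n * (2 * L * (4000 * L ^ 29)) := by gcongr
      _ = 1 / n * (8000 * L ^ 30) := by ring
      _ ≤ 1 / n * (80000 * L ^ 49) := by gcongr <;> norm_num
  set ε : ℝ := 200 * L ^ 18 / n with hε
  set c : ℝ := 1 / (10 * L ^ 11) with hc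
  have hc0 : 0 < c := by positivity
  have hεc : 2 * ε ≤ c := by
    rw [hε, hc, ← mul_div_assoc, div_le_div_iff₀ hn0 (by positivity)]
    calc _ = 4000 * L ^ 29 := by ring
      _ ≤ 1 * n := by linarith
  have hnε : n * ε = 200 * L ^ 18 := by rw [hε]; field_simp
  have her : ∀ {e : Fin N ⊕ Fin n → ℝ} {r : ℂ}, (∀ k, 0 ≤ e k) → (∀ k, e k ≤ L) →
      n * r = ∫ x, ∑ k, (e k : ℂ) * modelGreen d dt A s x k k ∂Measure.pi μ →
      ‖((n : ℝ) : ℂ) * r - ∑ k, (e k : ℂ) * R k k‖ ≤ n * ε := by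
    intro e r h1 h2 h3
    rw [Complex.ofReal_natCast, h3, hnε]
    exact norm_trace_error_le hs hL ha hn hd hdt hdL hdtL hN hν hp0 hq0 hp hq h1 h2
  have er1 := her hwl (weightL_le hL0.le hdL) hp
  have er2 := her hwr (weightR_le hL0.le hdtL) hq
  have hsd' : n ≤ L ^ 2 * ∑ k, weightL n d k := by rw [sum_weightL]; exact hsd
  have hsdt' : n ≤ L ^ 2 * ∑ k, weightR N dt k := by rw [sum_weightR]; exact hsdt
  have lR1 := le_sum_weight_row hs hL ha hsL hA hwR0 bwR hwl hsd'
  have lR2 := le_sum_weight_row hs hL ha hsL hA hwR0 bwR hwr hsdt'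
  have lT1 := le_sum_weight_col hs hL ha hsL hA hwT0 bwT hwl hsd'
  have lT2 := le_sum_weight_col hs hL ha hsL hA hwT0 bwT hwr hsdt'
  -- Strict positivity of the real parts: the relative errors in `stability` have their square roots
  -- as denominators.
  have posR : ∀ {e : Fin N ⊕ Fin n → ℝ} {r : ℂ}, (∀ k, 0 ≤ e k) →
      ‖((n : ℝ) : ℂ) * r - ∑ k, (e k : ℂ) * R k k‖ ≤ n * ε →
      n * c ≤ s.re * ∑ k, e k * ∑ l, ‖R k l‖ ^ 2 → 0 < r.re := by
    intro e r h1 h2 h3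
    have h4 := le_re_sum_weight (A := A) hs hwR0 h1
    have h5 := (Complex.abs_re_le_norm _).trans h2
    rw [Complex.sub_re, Complex.re_ofReal_mul, abs_le] at h5
    have h6 : n * ε < n * c := by
      refine mul_lt_mul_of_pos_left ?_ hn0
      linarith
    have h7 : 0 < n * r.re := by linarith [h5.1]
    exact pos_of_mul_pos_right h7 hn0.le
  have posT : ∀ {e : Fin N ⊕ Fin n → ℝ} {r : ℂ}, (∀ k, 0 ≤ e k) → n ≤ L ^ 2 * ∑ k, e k →
      n * r = ∑ k, (e k : ℂ) * T k k → 0 < r.re := by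
    intro e r h1 h2 h3
    have h4 := le_sum_weight_row hs hL ha hsL hA hwT0 bwT h1 h2
    have h5 := le_re_sum_weight (A := A) hs hwT0 h1
    rw [← hT, ← h3, hreal] at h5
    have h6 : 0 < n * c := by positivity
    exact pos_of_mul_pos_right (h6.trans_le (h4.trans h5)) hn0.le
  obtain ⟨st1, st2⟩ := stability (K := L ^ 3) (c := c) (ε := ε) (m := n) hH hs hwl hwr hn0 hc0 hεc
    hp0 hq0 hpT0 hqT0 ((Complex.re_le_norm _).trans bp) ((Complex.re_le_norm _).trans bq)
    ((Complex.re_le_norm _).trans bpT) ((Complex.re_le_norm _).trans bqT)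
    (profile_eq p q) (profile_eq pT qT) (by rw [Complex.ofReal_natCast]; exact hpT)
    (by rw [Complex.ofReal_natCast]; exact hqT) er1 er2 lR1 lR2 lT1 lT2
    ⟨posR hwl er1 lR1, posR hwr er2 lR2⟩ ⟨posT hwl hsd' hpT, posT hwr hsdt' hqT⟩
  have hval : 4 * ε * (L ^ 3) ^ 2 / c ^ 2 = 80000 * L ^ 46 / n := by
    rw [hε, hc]; field_simp; ring
  rw [hval] at st1 st2
  have hdiff : ‖(diagonal (profile d dt pT qT - profile d dt p q) :
      Matrix (Fin N ⊕ Fin n) (Fin N ⊕ Fin n) ℂ)‖ ≤ 80000 * L ^ 46 / n * L := by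
    rw [l2_opNorm_diagonal, pi_norm_le_iff_of_nonneg (by positivity)]
    intro k
    have h := norm_profile_le hd hdt hdL hdtL (b := 80000 * L ^ 46 / n) (p := pT - p) (q := qT - q)
      (by rw [norm_sub_rev]; exact st1) (by rw [norm_sub_rev]; exact st2) k
    refine le_of_eq_of_le ?_ h
    congr 1
    rw [Pi.sub_apply, profile_eq, profile_eq, profile_eq]
    ring
  have hid := green_sub_green hH hH hs hwR0 hwT0
  rw [sub_self, smul_zero, zero_add, ← hR, ← hT] at hid
  rw [hid]
  calc _ ≤ ‖R‖ * ‖(diagonal (profile d dt pT qT - profile d dt p q) :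
        Matrix (Fin N ⊕ Fin n) (Fin N ⊕ Fin n) ℂ)‖ * ‖T‖ :=
        (norm_mul_le _ _).trans (by gcongr; exact norm_mul_le _ _)
    _ ≤ L * (80000 * L ^ 46 / n * L) * L := by gcongr
    _ = _ := by ring

end Comparison


/-! ### Assembly -/

section Main

variable {N n : ℕ}

lemma isClosed_nonnegAxis : IsClosed nonnegAxis :=
  Complex.isometry_ofReal.isClosedEmbedding.isClosedMap _ isClosed_Ici

lemma distAxis_pos {z : ℂ} (hz : z ∉ nonnegAxis) : 0 < distAxis z :=
  (isClosed_nonnegAxis.notMem_iff_infDist_pos ⟨0, 0, by simp, by simp⟩).1 hz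

lemma norm_le_one_add_of_sq_eq_neg {s z : ℂ} (h : s ^ 2 = -z) : ‖s‖ ≤ 1 + ‖z‖ := by
  have h' : ‖s‖ ^ 2 = ‖z‖ := by rw [← norm_pow, h, norm_neg]
  nlinarith [norm_nonneg s, sq_nonneg (‖s‖ - 1)]

/-- Padding u and v with zeros on the second block preserves their norms. -/
lemma norm_dotProduct_toBlocks₁₁_le (M : Matrix (Fin N ⊕ Fin n) (Fin N ⊕ Fin n) ℂ)
    (u v : EuclideanSpace ℂ (Fin N)) :
    ‖star u.ofLp ⬝ᵥ (M.toBlocks₁₁ *ᵥ v.ofLp)‖ ≤ ‖M‖ * ‖u‖ * ‖v‖ := by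
  have hnorm : ∀ u : EuclideanSpace ℂ (Fin N),
      ‖WithLp.toLp 2 (Sum.elim u.ofLp (0 : Fin n → ℂ))‖ = ‖u‖ := fun u => by
    simp [EuclideanSpace.norm_eq, Fintype.sum_sum_type]
  have h := norm_dotProduct_mulVec_le M (WithLp.toLp 2 (Sum.elim u.ofLp (0 : Fin n → ℂ)))
    (WithLp.toLp 2 (Sum.elim v.ofLp (0 : Fin n → ℂ)))
  rw [hnorm, hnorm] at h
  refine le_of_eq_of_le ?_ h
  congr 1
  simp [dotProduct, mulVec, Fintype.sum_sum_type, toBlocks₁₁]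

/-- The bound in terms of the square root `s` of `-z` and of one parameter `L` dominating all the
data. -/
lemma norm_bilinear_le {d : Fin N → ℝ} {dt : Fin n → ℝ} {A : Matrix (Fin N) (Fin n) ℂ} {s z : ℂ}
    {L M : ℝ} {Ω : Type*} [MeasurableSpace Ω] {P : Measure Ω} [IsProbabilityMeasure P]
    {X : Fin N → Fin n → Ω → ℂ} {p : ℕ} (hp : 1 ≤ p) (hX : IsIIDEntries P X (8 * p) M)
    (hML : 1 + M ≤ L) {δ δt : ℂ → ℂ} (hδ : IsFundamentalSolution (diagC d) (diagC dt) A δ δt)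
    (hz : z ∉ nonnegAxis) (hsz : s ^ 2 = -z) (hs : 0 < s.re) (hL : 1 ≤ L) (ha : 1 / s.re ≤ L)
    (hsL : ‖s‖ ≤ L) (hA : ‖A‖ ≤ L) (hn : 1 ≤ n) (hd : ∀ i, 0 ≤ d i) (hdt : ∀ j, 0 ≤ dt j)
    (hdL : ∀ i, d i ≤ L) (hdtL : ∀ j, dt j ≤ L) (hN : (N : ℝ) ≤ L * n)
    (hsd : n ≤ L ^ 2 * ∑ i, d i) (hsdt : n ≤ L ^ 2 * ∑ j, dt j)
    (u v : EuclideanSpace ℂ (Fin N)) :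
    ‖star u.ofLp ⬝ᵥ ((matR P d dt A X z - matT d dt A δ δt z) *ᵥ v.ofLp)‖ ≤
      1 / n * (80000 * L ^ 50) * ‖u‖ * ‖v‖ := by
  have : ∀ q : Fin N × Fin n, IsProbabilityMeasure (P.map (X q.1 q.2)) := fun q =>
    Measure.isProbabilityMeasure_map (hX.aemeasurable q.1 q.2)
  have hs0 : s ≠ 0 := by rintro rfl; simp at hs
  have hnC : (n : ℂ) ≠ 0 := by exact_mod_cast (by omega : n ≠ 0)
  have hpT0 := re_mul_stieltjes_nonneg hδ.stieltjes hz hs hsz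
  have hqT0 := re_mul_stieltjes_nonneg hδ.stieltjes_co hz hs hsz
  have hpT : n * (s * δ z) = ∑ k, (weightL n d k : ℂ) *
      green (hermitize A) s (profile d dt (s * δ z) (s * δt z)) k k := by
    rw [sum_weightL_mul]
    conv_lhs => rw [hδ.eq z hz, equivMatrix_eq hd hdt A hs hsz hpT0 hqT0, trace_diagC_mul]
    simp only [Matrix.smul_apply, smul_eq_mul, mul_left_comm _ s⁻¹]
    rw [← Finset.mul_sum]
    field_simp
    rfl
  have hqT : n * (s * δt z) = ∑ k, (weightR N dt k : ℂ) *
      green (hermitize A) s (profile d dt (s * δ z) (s * δt z)) k k := by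
    rw [sum_weightR_mul]
    conv_lhs => rw [hδ.eq_co z hz, coEquivMatrix_eq hd hdt A hs hsz hpT0 hqT0, trace_diagC_mul]
    simp only [Matrix.smul_apply, smul_eq_mul, mul_left_comm _ s⁻¹]
    rw [← Finset.mul_sum]
    field_simp
    rfl
  obtain ⟨hp0, hq0, hle⟩ := norm_green_sub_green_le hs hL ha hsL hA hn hd hdt hdL hdtL hN
    (hX.isStandard hp hML) hsd hsdt (hX.alpha_eq hn hs hsz) (hX.coAlpha_eq hn hs hsz) hpT0 hqT0
    hpT hqT
  rw [matR, matT, equivMatrix_eq hd hdt A hs hsz hp0 hq0,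
    equivMatrix_eq hd hdt A hs hsz hpT0 hqT0, ← smul_sub, smul_mulVec, dotProduct_smul, norm_smul]
  have hb := norm_dotProduct_toBlocks₁₁_le (green (hermitize A) s (profile d dt
    (s * alpha P d dt A X z) (s * coAlpha P d dt A X z)) -
    green (hermitize A) s (profile d dt (s * δ z) (s * δt z))) u v
  -- The prefactor 1/s relating the blocks to R and T costs one more L, turning L⁴⁹ into L⁵⁰.
  have hsinv : ‖s⁻¹‖ ≤ L := by
    rw [norm_inv, ← one_div]
    refine le_trans ?_ ha
    gcongr
    exact Complex.re_le_norm s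
  calc _ ≤ L * (‖green (hermitize A) s (profile d dt (s * alpha P d dt A X z)
        (s * coAlpha P d dt A X z)) - green (hermitize A) s
          (profile d dt (s * δ z) (s * δt z))‖ * ‖u‖ * ‖v‖) := by
        gcongr
        exact hb
    _ ≤ L * ((1 / n * (80000 * L ^ 49)) * ‖u‖ * ‖v‖) := by gcongr
    _ = _ := by ring

end Main

end InfoPlusNoise

end

theorem mainTheorem4
    (lmin lmax dmin dmax dtmin dtmax amax M : ℝ)
    (hl : 0 < lmin) (hd : 0 < dmin) (hdt : 0 < dtmin) :
    ∃ Φ Ψ : Polynomial ℝ, (∀ k, 0 ≤ Φ.coeff k) ∧ (∀ k, 0 ≤ Ψ.coeff k) ∧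
      ∀ (N n : ℕ), 1 ≤ n → lmin ≤ (N : ℝ) / n → (N : ℝ) / n ≤ lmax →
      ∀ (d : Fin N → ℝ) (dt : Fin n → ℝ) (A : Matrix (Fin N) (Fin n) ℂ),
        (∀ i, 0 ≤ d i) → (∀ j, 0 ≤ dt j) →
        ‖InfoPlusNoise.diagC d‖ ≤ dmax → ‖InfoPlusNoise.diagC dt‖ ≤ dtmax → ‖A‖ ≤ amax →
        dmin ≤ (1 / (N : ℝ)) * ∑ i, d i → dtmin ≤ (1 / (n : ℝ)) * ∑ j, dt j →
      ∀ (Ω : Type*) [MeasurableSpace Ω] (P : Measure Ω) [IsProbabilityMeasure P]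
        (X : Fin N → Fin n → Ω → ℂ) (p : ℕ), 1 ≤ p →
        InfoPlusNoise.IsIIDEntries P X (8 * p) M →
      ∀ (δ δt : ℂ → ℂ),
        InfoPlusNoise.IsFundamentalSolution
          (InfoPlusNoise.diagC d) (InfoPlusNoise.diagC dt) A δ δt →
      ∀ (u v : EuclideanSpace ℂ (Fin N)) (z : ℂ), z ∉ InfoPlusNoise.nonnegAxis →
        ‖star u.ofLp ⬝ᵥ ((InfoPlusNoise.matR P d dt A X z -
            InfoPlusNoise.matT d dt A δ δt z) *ᵥ v.ofLp)‖ ≤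
          (1 / (n : ℝ)) * Φ.eval ‖z‖ * Ψ.eval (1 / InfoPlusNoise.distAxis z) * ‖u‖ * ‖v‖ := by
  set κ : ℝ := 2 + |lmax| + 1 / lmin + |dmax| + 1 / dmin + |dtmax| + 1 / dtmin + |amax| + |M|
    with hκ
  have i1 : 0 < 1 / lmin := by positivity
  have i2 : 0 < 1 / dmin := by positivity
  have i3 : 0 < 1 / dtmin := by positivity
  have j1 := abs_nonneg lmax
  have j2 := abs_nonneg dmax
  have j3 := abs_nonneg dtmax
  have j4 := abs_nonneg amax
  have j5 := abs_nonneg M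
  have hκ1 : 1 ≤ κ := by linarith
  have hcoeff : ∀ k, 0 ≤ ((1 + Polynomial.X) ^ 50 : Polynomial ℝ).coeff k := fun k => by
    rw [Polynomial.coeff_one_add_X_pow]; positivity
  -- The final bound is 80000 L⁵⁰ / n with L ≤ 2κ (1 + |z|)(1 + 1/δ_z), which separates into one
  -- polynomial in |z| and one in 1/δ_z.
  refine ⟨Polynomial.C (80000 * (2 * κ) ^ 50) * (1 + Polynomial.X) ^ 50,
    (1 + Polynomial.X) ^ 50, fun k => ?_, hcoeff, ?_⟩
  · rw [Polynomial.coeff_C_mul]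
    exact mul_nonneg (by positivity) (hcoeff k)
  intro N n hn hl1 hl2 d dt A hd0 hdt0 hdm hdtm hAm hdmin hdtmin Ω _ P _ X p hp hX δ δt hδ u v z hz
  obtain ⟨s, hsz, hs, hdist⟩ := InfoPlusNoise.exists_sqrt_neg hz
  have hδz := InfoPlusNoise.distAxis_pos hz
  have hn0 : (0 : ℝ) < n := by exact_mod_cast hn
  have hN0 : (0 : ℝ) < N := by
    rw [le_div_iff₀ hn0] at hl1
    exact (mul_pos hl hn0).trans_le hl1
  have hsa : 0 < 1 / s.re := by positivity
  set L : ℝ := κ * (1 + ‖s‖ + 1 / s.re) with hL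
  have hfac : 1 ≤ 1 + ‖s‖ + 1 / s.re := by linarith [norm_nonneg s]
  have hκL : κ ≤ L := le_mul_of_one_le_right (by linarith) hfac
  have hL1 : 1 ≤ L := hκ1.trans hκL
  have hfL : 1 + ‖s‖ + 1 / s.re ≤ L := le_mul_of_one_le_left (by linarith) hκ1
  have hsn := InfoPlusNoise.norm_le_one_add_of_sq_eq_neg hsz
  -- From dist(z, ℝ⁺) ≤ 2 Re s |s| and |s| ≤ 1 + |z|: the only place where the distance to the
  -- half-line enters.
  have hinv : 1 / s.re ≤ 2 * (1 + ‖z‖) * (1 / InfoPlusNoise.distAxis z) := by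
    rw [mul_one_div, div_le_div_iff₀ hs hδz, one_mul]
    calc InfoPlusNoise.distAxis z ≤ 2 * s.re * ‖s‖ := hdist
      _ ≤ 2 * s.re * (1 + ‖z‖) := by gcongr
      _ = _ := by ring
  have hLle : L ≤ 2 * κ * (1 + ‖z‖) * (1 + 1 / InfoPlusNoise.distAxis z) := by
    have h : 1 + ‖s‖ + 1 / s.re ≤ 2 * (1 + ‖z‖) * (1 + 1 / InfoPlusNoise.distAxis z) := by
      have := norm_nonneg z
      calc _ ≤ 1 + (1 + ‖z‖) + 2 * (1 + ‖z‖) * (1 / InfoPlusNoise.distAxis z) := by gcongr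
        _ ≤ 2 * (1 + ‖z‖) + 2 * (1 + ‖z‖) * (1 / InfoPlusNoise.distAxis z) := by linarith
        _ = _ := by ring
    calc L ≤ κ * (2 * (1 + ‖z‖) * (1 + 1 / InfoPlusNoise.distAxis z)) := by rw [hL]; gcongr
      _ = _ := by ring
  have hentry : ∀ {k : ℕ} {e : Fin k → ℝ}, (∀ i, 0 ≤ e i) → ∀ i, e i ≤ ‖InfoPlusNoise.diagC e‖ := by
    intro k e he i
    rw [InfoPlusNoise.diagC, l2_opNorm_diagonal]
    have h := norm_le_pi_norm (fun i => (e i : ℂ)) i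
    rwa [Complex.norm_real, Real.norm_of_nonneg (he i)] at h
  have k1 := le_abs_self lmax
  have k2 := le_abs_self dmax
  have k3 := le_abs_self dtmax
  have k4 := le_abs_self amax
  have k5 := le_abs_self M
  have hnN : (n : ℝ) ≤ L * N := by
    rw [le_div_iff₀ hn0] at hl1
    calc (n : ℝ) = 1 / lmin * (lmin * n) := by field_simp
      _ ≤ L * N := by
        gcongr
        linarith
  have hNd : (N : ℝ) ≤ L * ∑ i, d i := by
    have h0 : 0 ≤ ∑ i, d i := Finset.sum_nonneg fun i _ => hd0 i
    have h1 : N * dmin ≤ ∑ i, d i := by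
      calc N * dmin ≤ N * (1 / N * ∑ i, d i) := by gcongr
        _ = _ := by field_simp
    calc (N : ℝ) = 1 / dmin * (N * dmin) := by field_simp
      _ ≤ L * ∑ i, d i := by
        gcongr
        linarith
  have hndt : (n : ℝ) ≤ L * ∑ j, dt j := by
    have h0 : 0 ≤ ∑ j, dt j := Finset.sum_nonneg fun j _ => hdt0 j
    have h1 : n * dtmin ≤ ∑ j, dt j := by
      calc n * dtmin ≤ n * (1 / n * ∑ j, dt j) := by gcongr
        _ = _ := by field_simp
    calc (n : ℝ) = 1 / dtmin * (n * dtmin) := by field_simp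
      _ ≤ L * ∑ j, dt j := by
        gcongr
        linarith
  have hbound := InfoPlusNoise.norm_bilinear_le (L := L) hp hX (by linarith) hδ hz hsz hs hL1
    (by linarith [norm_nonneg s]) (by linarith) (by linarith) hn hd0 hdt0
    (fun i => by linarith [hentry hd0 i]) (fun j => by linarith [hentry hdt0 j])
    (by
      rw [div_le_iff₀ hn0] at hl2
      exact hl2.trans (by gcongr; linarith))
    -- One factor L passes from n to N, through the lower bound on N/n, and another from N to Tr D.
    (calc (n : ℝ) ≤ L * N := hnN
      _ ≤ L * (L * ∑ i, d i) := by gcongr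
      _ = _ := by ring)
    (hndt.trans (by
      have h0 : 0 ≤ ∑ j, dt j := Finset.sum_nonneg fun j _ => hdt0 j
      gcongr
      exact le_self_pow₀ hL1 (by norm_num))) u v
  refine hbound.trans ?_
  simp only [Polynomial.eval_mul, Polynomial.eval_C, Polynomial.eval_pow, Polynomial.eval_add,
    Polynomial.eval_one, Polynomial.eval_X]
  have hpow : 80000 * L ^ 50 ≤ 80000 * (2 * κ * (1 + ‖z‖) * (1 + 1 / InfoPlusNoise.distAxis z)) ^ 50 := by
    gcongr
  calc 1 / (n : ℝ) * (80000 * L ^ 50) * ‖u‖ * ‖v‖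
      ≤ 1 / n * (80000 * (2 * κ * (1 + ‖z‖) * (1 + 1 / InfoPlusNoise.distAxis z)) ^ 50) *
        ‖u‖ * ‖v‖ := by
        gcongr
    _ = _ := by
        generalize 1 + ‖z‖ = a
        generalize 1 + 1 / InfoPlusNoise.distAxis z = b
        rw [mul_pow, mul_pow _ a]
        generalize (2 * κ) ^ 50 = k
        ring
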